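/- Let $n\ge 1$, $\Omega=(0,X_1)\times\dots\times(0,X_n)$, $T>0$, $a_1,\dots,a_n>0$, let $\rho$ be smooth on $\bar\Omega$ with $0<\underline\rho\le\rho(x)\le\bar\rho$, and let $u$ be a solution, smooth on $\bar\Omega\times[0,T]$, of $$\rho\,\partial_t^2u-Lu=f,\quad L=\sum_{k=1}^n a_k^2\partial_k^2,\qquad u|_{\partial\Omega\times[0,T]}=g,\quad u|_{t=0}=u_0,\quad \partial_tu|_{t=0}=u_1,$$ where $g$ and $f|_{\partial\Omega\times[0,T]}$ need not vanish. *Mesh.* For integers $N_k\ge1$ and $M\ge 2$ put $h_k=X_k/N_k$, $h_t=T/M$, $t_m=mh_t$, $\mathbf h=(h_1,\dots,h_n,h_t)$; $\bar\omega_h$ is the set of nodes $(i_1h_1,\dots,i_nh_n)$, $0\le i_k\le N_k$, $\omega_h$ is the set of those with $1\le i_k\le N_k-1$ for all $k$, and $\partial\omega_h=\bar\omega_h\setminus\omega_h$. Write $y^m=y(t_m)$, and, with $i$ the index in direction $k$, $$\Lambda_kw_i=\tfrac{w_{i+1}-2w_i+w_{i-1}}{h_k^2},\quad s_{kN}w_i=\tfrac{w_{i-1}+10w_i+w_{i+1}}{12},\quad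 L_h=\sum_k a_k^2\Lambda_k,$$ $$\Lambda_ty^m=\tfrac{y^{m+1}-2y^m+y^{m-1}}{h_t^2},\quad \delta_ty^m=\tfrac{y^{m+1}-y^m}{h_t},\quad \bar\delta_ty^m=\tfrac{y^m-y^{m-1}}{h_t},\quad I^m_{h_t}y=h_t\sum_{l=1}^m y^l .$$ $H_h$ is the space of functions on $\bar\omega_h$ vanishing on $\partial\omega_h$; $(v,w)_h=h_1\cdots h_n\sum_{x\in\omega_h}v(x)w(x)$, $\|w\|_h=(w,w)_h^{1/2}$ (also for functions given on $\omega_h$ only), $\|w\|_{H_h^1}=(-L_hw,w)_h^{1/2}$ for $w\in H_h$. In $H_h$ let $E_h=-\sum_k a_k^2s_{kN}^{-1}\Lambda_k$. *Scheme.* The functions $v^m$ ($0\le m\le M$) and $v_{kk}^m$ ($0\le m\le M-1$, $1\le k\le n$) on $\bar\omega_h$ satisfy, with $f_{\mathbf h}=f+\frac{h_t^2}{12}(\Lambda_tf+L_h\frac f\rho)$, $$\rho\Lambda_tv^m-\big(\rho I+\tfrac{h_t^2}{12}L_h\big)\tfrac1\rho\sum_k a_k^2v_{kk}^m=f_{\mathbf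 h}^m,\qquad s_{kN}v_{kk}^m=\Lambda_kv^m\qquad\text{on }\omega_h,\ 1\le m\le M-1,$$ $$\rho(\delta_tv)^0=\tfrac{h_t}2\big(\rho I+\tfrac{h_t^2}{12}L_h\big)\tfrac1\rho\sum_k a_k^2v_{kk}^0+\big(\rho I+\tfrac{h_t^2}6L_h\big)u_1+\tfrac{h_t}2\Big(f_d+\tfrac{h_t^2}{12}L_h\tfrac{f|_{t=0}}{\rho}\Big),\qquad s_{kN}v_{kk}^0=\Lambda_kv^0\qquad\text{on }\omega_h,$$ where $f_d=\frac7{12}f^0+\frac12f^1-\frac1{12}f^2$ or $f_d=\frac13f^0+\frac23f|_{t=h_t/2}$. On $\partial\omega_h$: $v^m=g^m$ for $1\le m\le M$, and $a_k^2v_{kk}^m=g_k^m$ for $0\le m\le M-1$ (for $m=0$ one may take $v_{kk}^0=\partial_k^2u_0$ instead), where $g_k=\rho\partial_t^2g-\sum_{l\ne k}a_l^2\partial_l^2g-f$ if $x_k\in\{0,X_k\}$ and $g_k=a_k^2\partial_k^2g$ on the rest of $\partial\Omega$. Finally $v^0=u^0$ on $\bar\omega_h$. **Theorem.** There is a constant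 $C$, depending only on the problem data $n,X_k,T,a_k,\rho,\underline\rho,\bar\rho,u$ (hence not on the mesh, $\varepsilon$, $\varepsilon_0$), such that for all such meshes and all $0<\varepsilon<1$, $0<\varepsilon_0<1$ satisfying $$\tfrac13h_t^2\sum_{k=1}^n\frac{a_k^2}{h_k^2}\le(1-\varepsilon)\underline\rho,\qquad \tfrac14h_t^2E_h\le(1-\varepsilon_0^2)\underline\rho\, I\ \text{ in } H_h,$$ every solution of the scheme satisfies $$\sqrt\varepsilon\,\varepsilon_0\max_{1\le m\le M}\Big(\|\bar\delta_t(u-v)^m\|_h+\|(u-v)^m\|_{H_h^1}+\sqrt\varepsilon\,\|I^m_{h_t}L_h(u-v)\|_h\Big)\le C|\mathbf h|^4 .$$ -/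

import Mathlib

open Set
open scoped ContDiff

noncomputable section

namespace WaveScheme

variable {n : ℕ}

/-! ### The initial-boundary value problem -/

/-- Data of the problem `ρ ∂ₜ²u - (a₁² ∂₁²u + … + aₙ² ∂ₙ²u) = f` in `Ω × (0,T)`,
`Ω = (0,X₁) × … × (0,Xₙ)`, with `u = g` on `∂Ω × (0,T)`, `u = u₀`, `∂ₜu = u₁` at `t = 0`. -/
structure WaveData (n : ℕ) where
  X : Fin n → ℝ
  T : ℝ
  a : Fin n → ℝ
  ρ : (Fin n → ℝ) → ℝ
  f : (Fin n → ℝ) → ℝ → ℝ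
  g : (Fin n → ℝ) → ℝ → ℝ
  u₀ : (Fin n → ℝ) → ℝ
  u₁ : (Fin n → ℝ) → ℝ

/-- The closed box `[0,X₁] × … × [0,Xₙ]`. -/
def closedBox (X : Fin n → ℝ) : Set (Fin n → ℝ) := {x | ∀ k, x k ∈ Icc 0 (X k)}

/-- The open box `(0,X₁) × … × (0,Xₙ)`. -/
def openBox (X : Fin n → ℝ) : Set (Fin n → ℝ) := {x | ∀ k, x k ∈ Ioo 0 (X k)}

/-- `∂ₖ²φ` at `x`, along the segment `0 ≤ xₖ ≤ Xₖ` (one-sided at its end points). It only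
depends on the values of `φ` on that segment. -/
def pdxx (X : Fin n → ℝ) (k : Fin n) (φ : (Fin n → ℝ) → ℝ) (x : Fin n → ℝ) : ℝ :=
  iteratedDerivWithin 2 (fun s => φ (Function.update x k s)) (Icc 0 (X k)) (x k)

/-- `d²φ/dt²` on `[0,T]` (one-sided at the end points). -/
def pdtt (T : ℝ) (φ : ℝ → ℝ) (t : ℝ) : ℝ := iteratedDerivWithin 2 φ (Icc 0 T) t

/-- `u` is a smooth solution (up to the boundary) of the problem with data `P`. -/
structure IsSmoothSolution (P : WaveData n) (u : (Fin n → ℝ) → ℝ → ℝ) : Prop where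
  smooth : ContDiffOn ℝ ∞ (fun p : (Fin n → ℝ) × ℝ => u p.1 p.2)
    (closedBox P.X ×ˢ Icc 0 P.T)
  equation : ∀ x ∈ closedBox P.X, ∀ t ∈ Icc 0 P.T,
    P.ρ x * pdtt P.T (u x) t - ∑ k, P.a k ^ 2 * pdxx P.X k (fun y => u y t) x = P.f x t
  boundary : ∀ x ∈ closedBox P.X \ openBox P.X, ∀ t ∈ Icc 0 P.T, u x t = P.g x t
  initial : ∀ x ∈ closedBox P.X, u x 0 = P.u₀ x
  initial_deriv : ∀ x ∈ closedBox P.X, derivWithin (u x) (Icc 0 P.T) 0 = P.u₁ x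

/-- The boundary values `gₖ` of `aₖ² ∂ₖ²u` that follow from `u = g` on the boundary and from the
equation: the first formula is for `xₖ ∈ {0, Xₖ}`, the second one for the remaining faces. Only
derivatives of `g` along the faces of the box are involved. -/
def WaveData.gk (P : WaveData n) (k : Fin n) (x : Fin n → ℝ) (t : ℝ) : ℝ :=
  open Classical in
  if x k = 0 ∨ x k = P.X k then
    P.ρ x * pdtt P.T (P.g x) t
      - ∑ l ∈ Finset.univ.erase k, P.a l ^ 2 * pdxx P.X l (fun y => P.g y t) x - P.f x t
  else
    P.a k ^ 2 * pdxx P.X k (fun y => P.g y t) x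

/-! ### The mesh and mesh operators -/

/-- Nodes of the closed mesh, indexed by `0 ≤ iₖ ≤ Nₖ`. -/
abbrev Node (N : Fin n → ℕ) : Type := (k : Fin n) → Fin (N k + 1)

/-- Functions on the closed mesh. -/
abbrev MeshFun (N : Fin n → ℕ) : Type := Node N → ℝ

variable {N : Fin n → ℕ}

/-- The node is internal: `1 ≤ iₖ ≤ Nₖ - 1` for all `k`. -/
def Interior (i : Node N) : Prop := ∀ k, 0 < (i k : ℕ) ∧ (i k : ℕ) < N k

instance : DecidablePred (Interior (N := N)) := fun i =>
  inferInstanceAs (Decidable (∀ k, 0 < (i k : ℕ) ∧ (i k : ℕ) < N k))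

/-- The point `(i₁h₁, …, iₙhₙ)`. -/
def point (h : Fin n → ℝ) (i : Node N) : Fin n → ℝ := fun k => ((i k : ℕ) : ℝ) * h k

/-- The next node in direction `k` (clamped at `Nₖ`; only used for `iₖ < Nₖ`). -/
def nextNode (k : Fin n) (i : Node N) : Node N :=
  Function.update i k ⟨min ((i k : ℕ) + 1) (N k), by omega⟩

/-- The previous node in direction `k` (clamped at `0`; only used for `0 < iₖ`). -/
def prevNode (k : Fin n) (i : Node N) : Node N :=
  Function.update i k ⟨(i k : ℕ) - 1, by omega⟩

/-- `Λₖ`; its values are meaningful at internal nodes. -/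
def lam (h : Fin n → ℝ) (k : Fin n) : MeshFun N →ₗ[ℝ] MeshFun N where
  toFun w i := (w (nextNode k i) - 2 * w i + w (prevNode k i)) / h k ^ 2
  map_add' v w := by ext i; simp only [Pi.add_apply]; ring
  map_smul' c w := by ext i; simp only [Pi.smul_apply, smul_eq_mul, RingHom.id_apply]; ring

/-- The Numerov average `s_{kN}`; its values are meaningful at internal nodes. -/
def numerov (k : Fin n) : MeshFun N →ₗ[ℝ] MeshFun N where
  toFun w i := (w (prevNode k i) + 10 * w i + w (nextNode k i)) / 12
  map_add' v w := by ext i; simp only [Pi.add_apply]; ring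
  map_smul' c w := by ext i; simp only [Pi.smul_apply, smul_eq_mul, RingHom.id_apply]; ring

/-- `L_h = a₁² Λ₁ + … + aₙ² Λₙ`. -/
def Lh (a h : Fin n → ℝ) : MeshFun N →ₗ[ℝ] MeshFun N := ∑ k, a k ^ 2 • lam h k

/-- `(v,w)_h = h₁ ⋯ hₙ ∑ v w` over the internal nodes. -/
def ip (h : Fin n → ℝ) (v w : MeshFun N) : ℝ :=
  (∏ k, h k) * ∑ i with Interior i, v i * w i

/-- `‖w‖_h`. -/
def normh (h : Fin n → ℝ) (w : MeshFun N) : ℝ := √(ip h w w)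

/-- `‖w‖_{H_h^1} = (-L_h w, w)_h^{1/2}`, for `w` vanishing at the boundary nodes. -/
def normH1 (a h : Fin n → ℝ) (w : MeshFun N) : ℝ := √(ip h (-Lh a h w) w)

/-- The space `H_h` of functions on the closed mesh that vanish at the boundary nodes. -/
def Hh (N : Fin n → ℕ) : Submodule ℝ (MeshFun N) where
  carrier := {w | ∀ i, ¬ Interior i → w i = 0}
  add_mem' hv hw i hi := by simp [hv i hi, hw i hi]
  zero_mem' _ _ := rfl
  smul_mem' c w hw i hi := by simp [hw i hi]

/-- Keep the values at internal nodes, put zero at boundary nodes. -/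
def cutoff (N : Fin n → ℕ) : MeshFun N →ₗ[ℝ] Hh N where
  toFun w := ⟨fun i => if Interior i then w i else 0, fun i hi => by simp [hi]⟩
  map_add' v w := by ext i; by_cases hi : Interior i <;> simp [hi]
  map_smul' c w := by ext i; by_cases hi : Interior i <;> simp [hi]

/-- A mesh operator regarded as an operator acting in `H_h`. -/
def inHh (A : MeshFun N →ₗ[ℝ] MeshFun N) : Hh N →ₗ[ℝ] Hh N :=
  cutoff N ∘ₗ A ∘ₗ (Hh N).subtype

theorem numerov_injective (k : Fin n) :
    Function.Injective (inHh (numerov (N := N) k)) := by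
  rw [← LinearMap.ker_eq_bot, LinearMap.ker_eq_bot']
  intro w hw
  obtain ⟨j, hj⟩ := Finite.exists_max (fun i : Node N => |(w : MeshFun N) i|)
  have hzero : (w : MeshFun N) j = 0 := by
    by_cases hi : Interior j
    · have h1 : ((inHh (numerov k) w : Hh N) : MeshFun N) j = 0 := by rw [hw]; rfl
      simp only [inHh, cutoff, numerov, LinearMap.comp_apply, LinearMap.coe_mk, AddHom.coe_mk,
        Submodule.subtype_apply, hi, if_true] at h1
      have h2 := abs_le.mp (hj (prevNode k j))
      have h3 := abs_le.mp (hj (nextNode k j))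
      rcases abs_cases ((w : MeshFun N) j) with h | h <;> linarith [h.1, h.2]
    · exact w.2 j hi
  ext i
  have := hj i
  simp only [hzero, abs_zero] at this
  simpa using this

/-- `s_{kN}` as an invertible operator in `H_h`. -/
def numerovEquiv (k : Fin n) : Hh N ≃ₗ[ℝ] Hh N :=
  LinearEquiv.ofInjectiveEndo (inHh (numerov k)) (numerov_injective k)

/-- `E_h = -(a₁² s_{1N}⁻¹ Λ₁ + … + aₙ² s_{nN}⁻¹ Λₙ)` in `H_h`. -/
def Eh (a h : Fin n → ℝ) : Hh N →ₗ[ℝ] Hh N :=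
  -∑ k, a k ^ 2 •
    (((numerovEquiv (N := N) k).symm : Hh N →ₗ[ℝ] Hh N) ∘ₗ inHh (N := N) (lam h k))

/-! ### The scheme -/

/-- `hₖ = Xₖ / Nₖ`. -/
def WaveData.h (P : WaveData n) (N : Fin n → ℕ) (k : Fin n) : ℝ := P.X k / N k

/-- `h_t = T / M`. -/
def WaveData.ht (P : WaveData n) (M : ℕ) : ℝ := P.T / M

/-- Length of the vector `(h₁, …, hₙ, h_t)` of the steps. -/
def WaveData.stepNorm (P : WaveData n) (N : Fin n → ℕ) (M : ℕ) : ℝ :=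
  √(∑ k, P.h N k ^ 2 + P.ht M ^ 2)

/-- `Λ_t y` at level `m ≥ 1`. -/
def lamT (τ : ℝ) (y : ℕ → MeshFun N) (m : ℕ) : MeshFun N :=
  fun i => (y (m + 1) i - 2 * y m i + y (m - 1) i) / τ ^ 2

/-- `δ̄_t y` at level `m ≥ 1`. -/
def dBarT (τ : ℝ) (y : ℕ → MeshFun N) (m : ℕ) : MeshFun N :=
  fun i => (y m i - y (m - 1) i) / τ

/-- `δ_t y` at level `m`. -/
def dT (τ : ℝ) (y : ℕ → MeshFun N) (m : ℕ) : MeshFun N :=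
  fun i => (y (m + 1) i - y m i) / τ

/-- `I_{h_t}^m y = h_t (y¹ + … + y^m)`. -/
def sumT (τ : ℝ) (y : ℕ → MeshFun N) (m : ℕ) : MeshFun N :=
  fun i => τ * ∑ l ∈ Finset.Icc 1 m, y l i

/-- Values at the mesh nodes of a function of `x`. -/
def onMesh (h : Fin n → ℝ) (φ : (Fin n → ℝ) → ℝ) : MeshFun N := fun i => φ (point h i)

/-- Values at the mesh nodes and time levels of a function of `(x,t)`. -/
def onLevels (h : Fin n → ℝ) (τ : ℝ) (φ : (Fin n → ℝ) → ℝ → ℝ) : ℕ → MeshFun N :=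
  fun m => onMesh h (fun x => φ x (m * τ))

/-- `(ρ I + h_t²/12 L_h) (1/ρ) w`. -/
def WaveData.rhoOp (P : WaveData n) (M : ℕ) (w : MeshFun N) : MeshFun N :=
  let r : MeshFun N := onMesh (P.h N) P.ρ
  r * (w / r) + (P.ht M ^ 2 / 12) • Lh P.a (P.h N) (w / r)

/-- The right-hand side `f + h_t²/12 (Λ_t f + L_h (f/ρ))` at level `m`. -/
def WaveData.fh (P : WaveData n) (M : ℕ) (m : ℕ) : MeshFun N :=
  let F : ℕ → MeshFun N := onLevels (P.h N) (P.ht M) P.f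
  F m + (P.ht M ^ 2 / 12) •
    (lamT (P.ht M) F m + Lh P.a (P.h N) (F m / onMesh (P.h N) P.ρ))

/-- The two choices of the average of `f` in the equation at the first level. -/
inductive StartRule
  | threeLevel
  | twoLevel

/-- `7/12 f⁰ + 1/2 f¹ - 1/12 f²`, or `1/3 f⁰ + 2/3 f(h_t/2)`. -/
def WaveData.fd0 (P : WaveData n) (M : ℕ) : StartRule → MeshFun N
  | .threeLevel => fun i =>
      7 / 12 * P.f (point (P.h N) i) 0 + 1 / 2 * P.f (point (P.h N) i) (P.ht M)
        - 1 / 12 * P.f (point (P.h N) i) (2 * P.ht M)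
  | .twoLevel => fun i =>
      1 / 3 * P.f (point (P.h N) i) 0 + 2 / 3 * P.f (point (P.h N) i) (P.ht M / 2)

/-- The right-hand side `f_d⁽⁰⁾ + h_t²/12 L_h (f₀/ρ)` in the equation at the first level. -/
def WaveData.fh0 (P : WaveData n) (M : ℕ) (rule : StartRule) : MeshFun N :=
  P.fd0 M rule + (P.ht M ^ 2 / 12) •
    Lh P.a (P.h N) (onMesh (P.h N) (fun x => P.f x 0 / P.ρ x))

/-- `(ρ I + h_t²/6 L_h) u₁`. -/
def WaveData.u1h (P : WaveData n) (M : ℕ) : MeshFun N :=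
  onMesh (P.h N) P.ρ * onMesh (P.h N) P.u₁
    + (P.ht M ^ 2 / 6) • Lh P.a (P.h N) (onMesh (P.h N) P.u₁)

/-- `(v, v₁₁, …, vₙₙ)` solves the three-level semi-explicit vector compact scheme;
`v m` is the level `m = 0, …, M` of `v` and `vv m k` the level `m = 0, …, M - 1` of `v_{kk}`. -/
structure IsSchemeSolution (P : WaveData n) (N : Fin n → ℕ) (M : ℕ) (rule : StartRule)
    (v : ℕ → MeshFun N) (vv : ℕ → Fin n → MeshFun N) : Prop where
  main : ∀ m, 1 ≤ m → m ≤ M - 1 → ∀ i, Interior i →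
    P.ρ (point (P.h N) i) * lamT (P.ht M) v m i - P.rhoOp M (∑ k, P.a k ^ 2 • vv m k) i
      = P.fh M m i
  aux : ∀ m, 1 ≤ m → m ≤ M - 1 → ∀ k, ∀ i, Interior i →
    numerov k (vv m k) i = lam (P.h N) k (v m) i
  boundary : ∀ m, 1 ≤ m → m ≤ M → ∀ i, ¬ Interior i →
    v m i = P.g (point (P.h N) i) (m * P.ht M)
  aux_boundary : ∀ m, 1 ≤ m → m ≤ M - 1 → ∀ k, ∀ i, ¬ Interior i →
    P.a k ^ 2 * vv m k i = P.gk k (point (P.h N) i) (m * P.ht M)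
  start : ∀ i, Interior i →
    P.ρ (point (P.h N) i) * dT (P.ht M) v 0 i
      = P.ht M / 2 * P.rhoOp M (∑ k, P.a k ^ 2 • vv 0 k) i
        + P.u1h M i + P.ht M / 2 * P.fh0 M rule i
  start_aux : ∀ k, ∀ i, Interior i → numerov k (vv 0 k) i = lam (P.h N) k (v 0) i
  /-- The boundary values of `v_{kk}⁰` come from `gₖ` or from `∂ₖ²u₀`. -/
  start_aux_boundary : ∀ k,
    (∀ i, ¬ Interior i → P.a k ^ 2 * vv 0 k i = P.gk k (point (P.h N) i) 0) ∨
    (∀ i, ¬ Interior i → vv 0 k i = pdxx P.X k P.u₀ (point (P.h N) i))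

/-- First stability condition `h_t²/3 (a₁²/h₁² + … + aₙ²/hₙ²) ≤ (1 - ε) ρ_min`. -/
def StabCond1 (P : WaveData n) (ρmin : ℝ) (N : Fin n → ℕ) (M : ℕ) (ε : ℝ) : Prop :=
  1 / 3 * P.ht M ^ 2 * ∑ k, P.a k ^ 2 / P.h N k ^ 2 ≤ (1 - ε) * ρmin

/-- Second stability condition `h_t²/4 E_h ≤ (1 - ε₀²) ρ_min I`, an inequality between
self-adjoint operators in `H_h`. -/
def StabCond2 (P : WaveData n) (ρmin : ℝ) (N : Fin n → ℕ) (M : ℕ) (ε₀ : ℝ) : Prop :=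
  ∀ w : Hh N, 1 / 4 * P.ht M ^ 2 * ip (P.h N) (Eh P.a (P.h N) w : MeshFun N) (w : MeshFun N)
    ≤ (1 - ε₀ ^ 2) * ρmin * ip (P.h N) (w : MeshFun N) (w : MeshFun N)

end WaveScheme

end

/-! Put r = u - v and e_k = ∂_k²u - v_kk at the nodes. Both vanish at the boundary nodes; for e_k
the reason is that the equation, read on the faces of the box, makes g_k the exact value of
a_k²∂_k²u (`IsSmoothSolution.gk_eq`). So the whole error lives in H_h. With A_k = -Λ_k, σ_k = s_kN =
1 - (h_k²/12) A_k, R = multiplication by ρ, L = Σ a_k² A_k and G = R - (h_t²/12) L, it satisfies σ_k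
e_k = -A_k r + φ_k and R Λ_t r = G R⁻¹ Σ a_k² e_k + ψ, where φ and ψ are the residuals of the exact
solution.

Stability (`stability_vector`). Eliminate the e_k and apply R G⁻¹. The result is D Λ_t r + E r = F
with D = R G⁻¹ R, E = Σ a_k² σ_k⁻¹ A_k and F = R G⁻¹ψ + Σ a_k² σ_k⁻¹ φ_k. For variable ρ the
operator G R⁻¹ is not symmetric, but D and E are. Moreover L ≤ E, so the second stability condition
gives (h_t²/12) L ≤ ρ_min/3; hence G is uniformly invertible and D ≥ ρ_min (`inner_weight_ge`). The
energy ⟨D δ_t r, δ_t r⟩ + ⟨E r⁺, r⟩ then dominates ε₀²⟨D δ_t r, δ_t r⟩ + ¼⟨E(r⁺ + r), r⁺ + r⟩.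
Summation by parts in time moves the difference quotient from r to F, so the estimate `energy_bound`
loses no power of ε₀; its price is that F must be Lipschitz in time. The third norm comes from
summing the equation over the levels, and L replaces E there because L ≤ E and the two commute
(`norm_apply_le_norm_apply_of_commute`).

Consistency. Taylor expansion gives φ, ψ = O(|h|⁴) together with time increments O(h_t |h|⁴): see
`IsJet.numerov_residual_le`, `abs_psiAt_le`, `abs_psiAt_diff_le`, `abs_psiStart_le`. Since f is
expressed through u, the ratio f/ρ combines with (1/ρ) Σ a_k²∂_k²u to give ∂_t²u, and no derivative
of ρ enters. `IsSchemeSolution.error_bound` puts the two halves together. -/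

noncomputable section

namespace WaveScheme

open scoped InnerProductSpace

/-! ### Comparison of symmetric nonnegative operators -/

section Operators

variable {V : Type*} [NormedAddCommGroup V] [InnerProductSpace ℝ V]

theorem inner_apply_sq_le {S : V →ₗ[ℝ] V} (hS : S.IsSymmetric) (hpos : ∀ w, 0 ≤ ⟪S w, w⟫_ℝ)
    (v w : V) : ⟪S v, w⟫_ℝ ^ 2 ≤ ⟪S v, v⟫_ℝ * ⟪S w, w⟫_ℝ := by
  have key : ∀ t : ℝ, 0 ≤ ⟪S w, w⟫_ℝ * (t * t) + 2 * ⟪S v, w⟫_ℝ * t + ⟪S v, v⟫_ℝ := by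
    intro t
    have h := hpos (v + t • w)
    have h2 : ⟪S w, v⟫_ℝ = ⟪S v, w⟫_ℝ := by rw [hS w v, real_inner_comm]
    simp only [map_add, map_smul, inner_add_left, inner_add_right, inner_smul_left,
      inner_smul_right, h2, RCLike.conj_to_real] at h
    linarith
  have := discrim_le_zero key
  unfold discrim at this
  linarith

/-- Cauchy–Schwarz for the form of `S` at the pair `w`, `S w`, followed by division by `‖S w‖²`. It
turns an upper bound of the form into a bound of the norm. -/
theorem norm_apply_sq_le {S : V →ₗ[ℝ] V} (hS : S.IsSymmetric) (hpos : ∀ w, 0 ≤ ⟪S w, w⟫_ℝ)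
    {c : ℝ} (hc : ∀ w, ⟪S w, w⟫_ℝ ≤ c * ‖w‖ ^ 2) (w : V) : ‖S w‖ ^ 2 ≤ c * ⟪S w, w⟫_ℝ := by
  have h := inner_apply_sq_le hS hpos w (S w)
  rw [real_inner_self_eq_norm_sq] at h
  have h1 := mul_le_mul_of_nonneg_left (hc (S w)) (hpos w)
  rcases eq_or_lt_of_le (norm_nonneg (S w)) with h0 | h0
  · rw [norm_eq_zero.mp h0.symm]; simp
  · have h2 : 0 < ‖S w‖ ^ 2 := by positivity
    nlinarith

/-- Formally S T = S^{1/2} T S^{1/2} ≥ 0. The square root is taken by hand in an eigenbasis of `S`;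
since `T` commutes with `S`, it does not mix different eigenvalues of `S`, so √(λ_i λ_j) may be
replaced by λ_i wherever a matrix entry of `T` is nonzero. -/
theorem inner_apply_apply_nonneg_of_commute [FiniteDimensional ℝ V] {S T : V →ₗ[ℝ] V}
    (hS : S.IsSymmetric)
    (hSpos : ∀ w, 0 ≤ ⟪S w, w⟫_ℝ) (hTpos : ∀ w, 0 ≤ ⟪T w, w⟫_ℝ)
    (hST : ∀ w, S (T w) = T (S w)) (w : V) : 0 ≤ ⟪T w, S w⟫_ℝ := by
  set b := hS.eigenvectorBasis rfl with hb
  set l := hS.eigenvalues rfl with hl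
  have hSb : ∀ i, S (b i) = l i • b i := fun i => hS.apply_eigenvectorBasis rfl i
  have hl0 : ∀ i, 0 ≤ l i := by
    intro i
    have h := hSpos (b i)
    rwa [hSb, inner_smul_left, real_inner_self_eq_norm_sq, b.norm_eq_one, RCLike.conj_to_real,
      one_pow, mul_one] at h
  have horth : ∀ i j, l i ≠ l j → ⟪T (b i), b j⟫_ℝ = 0 := by
    intro i j hij
    have h1 : ⟪S (T (b i)), b j⟫_ℝ = l j * ⟪T (b i), b j⟫_ℝ := by
      rw [hS, hSb, inner_smul_right]
    have h2 : ⟪S (T (b i)), b j⟫_ℝ = l i * ⟪T (b i), b j⟫_ℝ := by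
      rw [hST, hSb, map_smul, inner_smul_left, RCLike.conj_to_real]
    have h3 : (l i - l j) * ⟪T (b i), b j⟫_ℝ = 0 := by linarith
    exact (mul_eq_zero.mp h3).resolve_left (sub_ne_zero.mpr hij)
  set c : _ → ℝ := fun i => ⟪b i, w⟫_ℝ with hc
  have hw : w = ∑ i, c i • b i := (b.sum_repr' w).symm
  -- The test vector is S^{1/2} w.
  have h := hTpos (∑ i, (√(l i) * c i) • b i)
  have e1 : ⟪T (∑ i, (√(l i) * c i) • b i), ∑ i, (√(l i) * c i) • b i⟫_ℝ
      = ∑ i, ∑ j, c i * c j * l i * ⟪T (b j), b i⟫_ℝ := by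
    simp only [map_sum, map_smul, sum_inner, inner_sum, inner_smul_left, inner_smul_right,
      RCLike.conj_to_real, Finset.mul_sum]
    refine Finset.sum_congr rfl fun i _ => Finset.sum_congr rfl fun j _ => ?_
    by_cases hij : l j = l i
    · rw [hij]
      linear_combination (c i * c j * ⟪T (b j), b i⟫_ℝ) * Real.mul_self_sqrt (hl0 i)
    · rw [horth j i hij]; ring
  have e2 : ⟪T w, S w⟫_ℝ = ∑ i, ∑ j, c i * c j * l i * ⟪T (b j), b i⟫_ℝ := by
    rw [hw]
    simp only [map_sum, map_smul, sum_inner, inner_sum, inner_smul_left, inner_smul_right,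
      RCLike.conj_to_real, hSb, Finset.mul_sum]
    refine Finset.sum_congr rfl fun i _ => Finset.sum_congr rfl fun j _ => ?_
    ring
  rw [e2, ← e1]
  exact h

/-- Apply the previous lemma to T - S and T + S: ⟨(T + S)w, (T - S)w⟩ = ‖T w‖² - ‖S w‖². Without
commutation S ≤ T would not imply S² ≤ T². -/
theorem norm_apply_le_norm_apply_of_commute [FiniteDimensional ℝ V] {S T : V →ₗ[ℝ] V}
    (hS : S.IsSymmetric) (hT : T.IsSymmetric)
    (hSpos : ∀ w, 0 ≤ ⟪S w, w⟫_ℝ) (hle : ∀ w, ⟪S w, w⟫_ℝ ≤ ⟪T w, w⟫_ℝ)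
    (hST : ∀ w, S (T w) = T (S w)) (w : V) : ‖S w‖ ≤ ‖T w‖ := by
  have h := inner_apply_apply_nonneg_of_commute (S := T - S) (T := T + S) (hT.sub hS)
    (fun w => by simpa [inner_sub_left] using hle w)
    (fun w => by
      simp only [LinearMap.add_apply, inner_add_left]
      linarith [hSpos w, hle w])
    (fun w => by
      simp only [LinearMap.add_apply, LinearMap.sub_apply, map_add, map_sub, hST]
      abel) w
  simp only [LinearMap.add_apply, LinearMap.sub_apply, inner_add_left, inner_sub_right,
    real_inner_self_eq_norm_sq] at h
  have h2 : ⟪T w, S w⟫_ℝ = ⟪S w, T w⟫_ℝ := real_inner_comm _ _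
  exact (sq_le_sq₀ (norm_nonneg _) (norm_nonneg _)).mp (by linarith)

/-! ### The inverse of `σ = 1 - κ A` -/

section Numerov

variable {A : V →ₗ[ℝ] V} {κ : ℝ} {σ : V ≃ₗ[ℝ] V}

theorem inner_numerov_ge (hκA : ∀ w, κ * ⟪A w, w⟫_ℝ ≤ 1 / 3 * ‖w‖ ^ 2)
    (hσ : ∀ w, σ w = w - κ • A w) (w : V) : 2 / 3 * ‖w‖ ^ 2 ≤ ⟪σ w, w⟫_ℝ := by
  rw [hσ, inner_sub_left, inner_smul_left, real_inner_self_eq_norm_sq, RCLike.conj_to_real]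
  linarith [hκA w]

theorem norm_numerov_symm_le (hκA : ∀ w, κ * ⟪A w, w⟫_ℝ ≤ 1 / 3 * ‖w‖ ^ 2)
    (hσ : ∀ w, σ w = w - κ • A w) (w : V) : ‖σ.symm w‖ ≤ 3 / 2 * ‖w‖ := by
  have h := inner_numerov_ge hκA hσ (σ.symm w)
  rw [σ.apply_symm_apply] at h
  have h2 := real_inner_le_norm w (σ.symm w)
  rcases eq_or_lt_of_le (norm_nonneg (σ.symm w)) with h0 | h0
  · rw [← h0]; positivity
  · nlinarith

theorem numerov_symm_apply_comm (hσ : ∀ w, σ w = w - κ • A w) (w : V) :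
    σ.symm (A w) = A (σ.symm w) := by
  rw [LinearEquiv.symm_apply_eq, hσ]
  conv_lhs => rw [← σ.apply_symm_apply w, hσ]
  simp

theorem numerov_symm_comp_isSymmetric (hA : A.IsSymmetric) (hσ : ∀ w, σ w = w - κ • A w) :
    ((σ.symm : V →ₗ[ℝ] V) ∘ₗ A).IsSymmetric := by
  have hs : ∀ v w, ⟪σ v, w⟫_ℝ = ⟪v, σ w⟫_ℝ := by
    intro v w
    simp only [hσ, inner_sub_left, inner_sub_right, inner_smul_left, inner_smul_right,
      RCLike.conj_to_real, hA v w]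
  intro v w
  simp only [LinearMap.comp_apply, LinearEquiv.coe_coe]
  have := hs (σ.symm (A v)) (σ.symm w)
  simp only [LinearEquiv.apply_symm_apply] at this
  rw [← this, numerov_symm_apply_comm hσ w, hA]

/-- With w = σ y the difference of the two sides is κ‖A y‖² - κ²⟨A(A y), A y⟩, which is nonnegative
because κA ≤ 1/3. -/
theorem inner_le_inner_numerov_symm_apply (hA : A.IsSymmetric) (hκ : 0 ≤ κ)
    (hκA : ∀ w, κ * ⟪A w, w⟫_ℝ ≤ 1 / 3 * ‖w‖ ^ 2) (hσ : ∀ w, σ w = w - κ • A w) (w : V) :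
    ⟪A w, w⟫_ℝ ≤ ⟪σ.symm (A w), w⟫_ℝ := by
  obtain ⟨y, rfl⟩ := σ.surjective w
  rw [numerov_symm_apply_comm hσ, σ.symm_apply_apply, hσ]
  have h1 : ⟪A (A y), y⟫_ℝ = ‖A y‖ ^ 2 := by rw [hA, real_inner_self_eq_norm_sq]
  have h2 := mul_le_mul_of_nonneg_left (hκA (A y)) hκ
  simp only [map_sub, map_smul, inner_sub_left, inner_sub_right, inner_smul_left,
    inner_smul_right, RCLike.conj_to_real, h1, real_inner_self_eq_norm_sq]
  nlinarith [mul_nonneg hκ (sq_nonneg ‖A y‖)]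

end Numerov

/-! ### The operator `R G⁻¹ R`, `G = R - K` -/

section Weight

variable {R K : V →ₗ[ℝ] V} {α β : ℝ}

theorem inner_sub_ge (hRα : ∀ w, α * ‖w‖ ^ 2 ≤ ⟪R w, w⟫_ℝ)
    (hKα : ∀ w, ⟪K w, w⟫_ℝ ≤ α / 3 * ‖w‖ ^ 2) (w : V) :
    2 / 3 * α * ‖w‖ ^ 2 ≤ ⟪(R - K) w, w⟫_ℝ := by
  rw [LinearMap.sub_apply, inner_sub_left]
  linarith [hRα w, hKα w]

theorem norm_le_norm_sub_apply (hα : 0 < α) (hRα : ∀ w, α * ‖w‖ ^ 2 ≤ ⟪R w, w⟫_ℝ)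
    (hKα : ∀ w, ⟪K w, w⟫_ℝ ≤ α / 3 * ‖w‖ ^ 2) (w : V) :
    ‖w‖ ≤ 3 / (2 * α) * ‖(R - K) w‖ := by
  have h := inner_sub_ge hRα hKα w
  have h2 := real_inner_le_norm ((R - K) w) w
  rw [div_mul_eq_mul_div, le_div_iff₀ (by positivity)]
  rcases eq_or_lt_of_le (norm_nonneg w) with h0 | h0
  · rw [← h0]; simp
  · nlinarith

theorem exists_sub_equiv [FiniteDimensional ℝ V] (hα : 0 < α)
    (hRα : ∀ w, α * ‖w‖ ^ 2 ≤ ⟪R w, w⟫_ℝ) (hKα : ∀ w, ⟪K w, w⟫_ℝ ≤ α / 3 * ‖w‖ ^ 2) :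
    ∃ G : V ≃ₗ[ℝ] V, ∀ w, G w = R w - K w := by
  have hinj : Function.Injective (R - K) := by
    rw [← LinearMap.ker_eq_bot, LinearMap.ker_eq_bot']
    intro w hw
    have h := norm_le_norm_sub_apply hα hRα hKα w
    rw [hw, norm_zero, mul_zero] at h
    exact norm_le_zero_iff.mp h
  exact ⟨LinearEquiv.ofInjectiveEndo (R - K) hinj, fun w => rfl⟩

variable {G : V ≃ₗ[ℝ] V}

theorem norm_sub_symm_le (hα : 0 < α) (hRα : ∀ w, α * ‖w‖ ^ 2 ≤ ⟪R w, w⟫_ℝ)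
    (hKα : ∀ w, ⟪K w, w⟫_ℝ ≤ α / 3 * ‖w‖ ^ 2) (hG : ∀ w, G w = R w - K w) (w : V) :
    ‖G.symm w‖ ≤ 3 / (2 * α) * ‖w‖ := by
  have h := norm_le_norm_sub_apply hα hRα hKα (G.symm w)
  rwa [LinearMap.sub_apply, ← hG, G.apply_symm_apply] at h

theorem weight_isSymmetric (hR : R.IsSymmetric) (hK : K.IsSymmetric)
    (hG : ∀ w, G w = R w - K w) : (R ∘ₗ (G.symm : V →ₗ[ℝ] V) ∘ₗ R).IsSymmetric := by
  have hs : ∀ v w, ⟪G v, w⟫_ℝ = ⟪v, G w⟫_ℝ := by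
    intro v w
    simp only [hG, inner_sub_left, inner_sub_right, hR v w, hK v w]
  intro v w
  simp only [LinearMap.comp_apply, LinearEquiv.coe_coe]
  have := hs (G.symm (R v)) (G.symm (R w))
  simp only [LinearEquiv.apply_symm_apply] at this
  rw [hR, ← this, hR]

/-- Heuristically G ≤ R gives R G⁻¹ R ≥ R ≥ α. The proof avoids operator monotonicity: with z = G⁻¹R
w and p = z - w one has R p = K z, and ⟨R z, w⟩ - ⟨R w, w⟩ = ⟨K z, z⟩ - ⟨K z, p⟩. The last term is
at most ‖K z‖²/α, hence at most ⟨K z, z⟩/3. -/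
theorem inner_weight_ge (hα : 0 < α) (hR : R.IsSymmetric) (hK : K.IsSymmetric)
    (hRα : ∀ w, α * ‖w‖ ^ 2 ≤ ⟪R w, w⟫_ℝ) (hKpos : ∀ w, 0 ≤ ⟪K w, w⟫_ℝ)
    (hKα : ∀ w, ⟪K w, w⟫_ℝ ≤ α / 3 * ‖w‖ ^ 2) (hG : ∀ w, G w = R w - K w) (w : V) :
    α * ‖w‖ ^ 2 ≤ ⟪R (G.symm (R w)), w⟫_ℝ := by
  set z := G.symm (R w) with hz
  have hRw : R w = R z - K z := by rw [← hG, hz, G.apply_symm_apply]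
  obtain ⟨p, hp⟩ : ∃ p, p = z - w := ⟨_, rfl⟩
  have hRp : R p = K z := by rw [hp, map_sub, hRw]; abel
  have hw : w = z - p := by rw [hp]; abel
  have h1 := hRα w
  have h2 := norm_apply_sq_le hK hKpos hKα z
  have h3 := hRα p
  have h4 := real_inner_le_norm (K z) p
  rw [hRp] at h3
  have h5 : ⟪R z, w⟫_ℝ = ⟪R z, z⟫_ℝ - ⟪K z, z⟫_ℝ := by
    rw [hR, hRw, inner_sub_right, hR z z, hK z z]
  have h6 : ⟪R w, w⟫_ℝ = ⟪R z, z⟫_ℝ - 2 * ⟪K z, z⟫_ℝ + ⟪K z, p⟫_ℝ := by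
    have h7 : ⟪R z, p⟫_ℝ = ⟪K z, z⟫_ℝ := by rw [hR, hRp, real_inner_comm]
    have h11 : ⟪R w, w⟫_ℝ = ⟪R z - K z, z - p⟫_ℝ := by rw [← hRw, ← hw]
    rw [h11, inner_sub_left, inner_sub_right, inner_sub_right, h7]; ring
  have h8 : α * ⟪K z, p⟫_ℝ ≤ ‖K z‖ ^ 2 := by
    have h9 : α * ‖p‖ ≤ ‖K z‖ := by
      rcases eq_or_lt_of_le (norm_nonneg p) with h0 | h0
      · rw [← h0]; simp
      · nlinarith
    nlinarith [norm_nonneg (K z)]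
  have h10 : ⟪K z, p⟫_ℝ ≤ 1 / 3 * ⟪K z, z⟫_ℝ := by
    have : α * ⟪K z, p⟫_ℝ ≤ α * (1 / 3 * ⟪K z, z⟫_ℝ) := by linarith
    exact le_of_mul_le_mul_left this hα
  rw [h5]
  linarith [hKpos z]

end Weight

end Operators

/-! ### Energy estimate for `D Λ_t r + E r = F` -/

section Energy

variable {V : Type*} [NormedAddCommGroup V] [InnerProductSpace ℝ V]

/-- The equation is tested with r₂ - r₀ = τ(y₁ + y₀). The right-hand side is written as an increment
of the sums of consecutive levels, ready for summation by parts in time. -/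
theorem energy_step {D E : V →ₗ[ℝ] V} (hD : D.IsSymmetric) (hE : E.IsSymmetric) {τ : ℝ}
    {r₀ r₁ r₂ y₀ y₁ F : V} (hy₀ : r₁ - r₀ = τ • y₀) (hy₁ : r₂ - r₁ = τ • y₁)
    (heq : D (y₁ - y₀) + τ • E r₁ = τ • F) :
    ⟪D y₁, y₁⟫_ℝ + ⟪E r₂, r₁⟫_ℝ - (⟪D y₀, y₀⟫_ℝ + ⟪E r₁, r₀⟫_ℝ)
      = ⟪F, (r₂ + r₁) - (r₁ + r₀)⟫_ℝ := by
  have h1 : (r₂ + r₁) - (r₁ + r₀) = τ • (y₁ + y₀) := by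
    rw [smul_add, ← hy₀, ← hy₁]; abel
  have h2 : ⟪F, τ • (y₁ + y₀)⟫_ℝ = ⟪D (y₁ - y₀), y₁ + y₀⟫_ℝ + ⟪E r₁, τ • (y₁ + y₀)⟫_ℝ := by
    rw [inner_smul_right, ← RCLike.conj_to_real (x := τ), ← inner_smul_left, ← heq, inner_add_left,
      inner_smul_left, inner_smul_right]
  rw [h1, h2, ← h1]
  have h3 : ⟪D y₀, y₁⟫_ℝ = ⟪D y₁, y₀⟫_ℝ := by rw [hD, real_inner_comm]
  have h4 : ⟪E r₂, r₁⟫_ℝ = ⟪E r₁, r₂⟫_ℝ := by rw [hE, real_inner_comm]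
  simp only [map_sub, inner_sub_left, inner_add_right, inner_sub_right, h3, h4]
  ring

/-- Polarization; the negative term is what the second stability condition absorbs. -/
theorem inner_apply_consecutive {E : V →ₗ[ℝ] V} (hE : E.IsSymmetric) {τ : ℝ}
    {r₀ r₁ y : V} (hy : r₁ - r₀ = τ • y) :
    ⟪E r₁, r₀⟫_ℝ = 1 / 4 * ⟪E (r₁ + r₀), r₁ + r₀⟫_ℝ - 1 / 4 * τ ^ 2 * ⟪E y, y⟫_ℝ := by
  have h : τ ^ 2 * ⟪E y, y⟫_ℝ = ⟪E (r₁ - r₀), r₁ - r₀⟫_ℝ := by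
    rw [hy, map_smul, inner_smul_left, inner_smul_right, RCLike.conj_to_real]; ring
  have h4 : ⟪E r₀, r₁⟫_ℝ = ⟪E r₁, r₀⟫_ℝ := by rw [hE, real_inner_comm]
  rw [mul_assoc, h]
  simp only [map_sub, map_add, inner_add_left, inner_sub_left, inner_add_right, inner_sub_right, h4]
  ring

/-- Bound of the energies of a three-level scheme with a right-hand side that is Lipschitz in
time. -/
theorem energy_bound {D E : V →ₗ[ℝ] V} (hD : D.IsSymmetric) (hE : E.IsSymmetric)
    {τ T c δ w₀ ε₀ : ℝ} (hτ : 0 < τ) (hc : 0 < c) (hδ : 0 ≤ δ)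
    (hDpos : ∀ w, 0 ≤ ⟪D w, w⟫_ℝ) (hEc : ∀ w, c * ‖w‖ ^ 2 ≤ ⟪E w, w⟫_ℝ)
    (hED : ∀ w, 1 / 4 * τ ^ 2 * ⟪E w, w⟫_ℝ ≤ (1 - ε₀ ^ 2) * ⟪D w, w⟫_ℝ)
    {M : ℕ} (hM : M * τ ≤ T) {r y F : ℕ → V}
    (hy : ∀ j, r (j + 1) - r j = τ • y j)
    (heq : ∀ j, j + 1 < M → D (y (j + 1) - y j) + τ • E (r (j + 1)) = τ • F (j + 1))
    (hF : ∀ j, ‖F j‖ ≤ δ) (hFF : ∀ j, ‖F (j + 1) - F j‖ ≤ τ * δ)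
    (h₀ : r 0 = 0) (hw₀ : ⟪D (y 0), y 0⟫_ℝ ≤ w₀ * δ ^ 2) {j : ℕ} (hj : j < M) :
    ε₀ ^ 2 * ⟪D (y j), y j⟫_ℝ + 1 / 4 * ⟪E (r (j + 1) + r j), r (j + 1) + r j⟫_ℝ
      ≤ (2 * w₀ + 4 * (2 + T) ^ 2 / c) * δ ^ 2 := by
  set s : ℕ → V := fun j => r (j + 1) + r j with hs
  set W : ℕ → ℝ := fun j => ⟪D (y j), y j⟫_ℝ + ⟪E (r (j + 1)), r j⟫_ℝ with hW
  have hWge : ∀ j, ε₀ ^ 2 * ⟪D (y j), y j⟫_ℝ + 1 / 4 * ⟪E (s j), s j⟫_ℝ ≤ W j := by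
    intro j
    have h1 := inner_apply_consecutive hE (hy j)
    have h2 := hED (y j)
    simp only [hW, hs]
    rw [h1]; linarith
  have hWs : ∀ j, c / 4 * ‖s j‖ ^ 2 ≤ W j := by
    intro j
    have h1 := hWge j
    have h2 := hEc (s j)
    have h3 := mul_nonneg (sq_nonneg ε₀) (hDpos (y j))
    linarith
  -- The level of largest energy bounds every `‖s i‖` by the same `A`; the inequality is closed at
  -- this level.
  obtain ⟨q, hq, hmax⟩ := Finset.exists_max_image (Finset.range M) W ⟨j, by simpa using hj⟩
  rw [Finset.mem_range] at hq
  have hmax' : ∀ i, i < M → W i ≤ W q := fun i hi => hmax i (by simpa using hi)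
  have hWq : 0 ≤ W q := le_trans (by positivity) (hWs q)
  set A : ℝ := √(4 * W q / c) with hA
  have hA2 : A ^ 2 = 4 * W q / c := Real.sq_sqrt (by positivity)
  have hA0 : 0 ≤ A := Real.sqrt_nonneg _
  have hsA : ∀ i, i < M → ‖s i‖ ≤ A := by
    intro i hi
    apply Real.le_sqrt_of_sq_le
    rw [le_div_iff₀ hc]
    linarith [hWs i, hmax' i hi]
  -- Summation by parts in time: W - ⟨F, s⟩ changes from one level to the next by -⟨F(i+1) - F i, s
  -- i⟩ only. The pairing is with `s`, which the energy controls without a factor ε₀.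
  have hZ : ∀ i, i < M → W i - ⟪F i, s i⟫_ℝ ≤ W 0 - ⟪F 0, s 0⟫_ℝ + i * (τ * δ * A) := by
    intro i
    induction i with
    | zero => intro _; simp
    | succ i ih =>
      intro hi
      have h1 := energy_step hD hE (hy i) (hy (i + 1)) (heq i hi)
      have h2 := ih (by omega)
      have h3 : W (i + 1) - W i = ⟪F (i + 1), s (i + 1) - s i⟫_ℝ := h1
      have h4 : -⟪F (i + 1) - F i, s i⟫_ℝ ≤ τ * δ * A := by
        have h5 := neg_le_of_abs_le (abs_real_inner_le_norm (F (i + 1) - F i) (s i))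
        have h6 := mul_le_mul (hFF i) (hsA i (by omega)) (norm_nonneg _) (by positivity)
        linarith
      rw [inner_sub_left] at h4
      rw [inner_sub_right] at h3
      push_cast
      linarith
  have hFs : ∀ i, i < M → |⟪F i, s i⟫_ℝ| ≤ δ * A := fun i hi =>
    (abs_real_inner_le_norm _ _).trans
      (mul_le_mul (hF i) (hsA i hi) (norm_nonneg _) hδ)
  have hW0 : W 0 ≤ w₀ * δ ^ 2 := by simpa [hW, h₀] using hw₀
  have h1 := hZ q hq
  have h2 := le_of_abs_le (hFs q hq)
  have h3 := neg_le_of_abs_le (hFs 0 (by omega))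
  have h4 : (q : ℝ) * (τ * δ * A) ≤ T * (δ * A) := by
    have : (q : ℝ) * τ ≤ T := le_trans (by
      have : (q : ℝ) ≤ M := by exact_mod_cast hq.le
      nlinarith) hM
    have := mul_le_mul_of_nonneg_right this (mul_nonneg hδ hA0)
    linarith
  -- Young's inequality; half of the maximal energy is absorbed on the left. The 2 comes from the
  -- two end terms ⟨F, s⟩, the T from the sum of increments.
  have h5 : (2 + T) * (δ * A) ≤ 2 * (2 + T) ^ 2 / c * δ ^ 2 + W q / 2 := by
    have h6 : W q / 2 = c / 8 * A ^ 2 := by rw [hA2]; field_simp; ring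
    rw [h6]
    have h7 : 2 * (2 + T) ^ 2 / c * δ ^ 2 + c / 8 * A ^ 2 - (2 + T) * (δ * A)
        = 2 / c * ((2 + T) * δ - c / 4 * A) ^ 2 := by field_simp; ring
    have : 0 ≤ 2 / c * ((2 + T) * δ - c / 4 * A) ^ 2 := by positivity
    linarith
  have h8 : W q ≤ (2 * w₀ + 4 * (2 + T) ^ 2 / c) * δ ^ 2 := by
    have : 4 * (2 + T) ^ 2 / c = 2 * (2 * (2 + T) ^ 2 / c) := by ring
    rw [this]
    linarith
  exact ((hWge j).trans (hmax' j hj)).trans h8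

end Energy

/-! ### Stability of the scheme as an operator equation -/

section Stability

variable {V : Type*} [NormedAddCommGroup V] [InnerProductSpace ℝ V]

/-- The equation summed over the levels: the second time difference telescopes, leaving the time sum
of `E r` in terms of quantities already bounded. -/
theorem sum_range_energy {D E : V →ₗ[ℝ] V} {τ : ℝ} {M : ℕ} {r y F : ℕ → V}
    (heq : ∀ j, j + 1 < M → D (y (j + 1) - y j) + τ • E (r (j + 1)) = τ • F (j + 1))
    {j : ℕ} (hj : j < M) :
    D (y j - y 0) + E (τ • ∑ l ∈ Finset.range j, r (l + 1))
      = τ • ∑ l ∈ Finset.range j, F (l + 1) := by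
  induction j with
  | zero => simp
  | succ j ih =>
    have h1 := ih (by omega)
    have h2 := heq j hj
    rw [Finset.sum_range_succ, Finset.sum_range_succ, smul_add, smul_add, ← h1, ← h2]
    simp only [map_sub, map_add, map_smul]
    abel

theorem le_sqrt_mul_of_sq_le {x Q δ : ℝ} (hδ : 0 ≤ δ) (h : x ^ 2 ≤ Q * δ ^ 2) :
    x ≤ √Q * δ := by
  have h1 : √(Q * δ ^ 2) = √Q * δ := by
    rw [Real.sqrt_mul' _ (sq_nonneg _), Real.sqrt_sq hδ]
  rw [← h1]
  exact Real.le_sqrt_of_sq_le h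

theorem inner_add_le_two_mul {E : V →ₗ[ℝ] V} (hE : E.IsSymmetric)
    (hEpos : ∀ w, 0 ≤ ⟪E w, w⟫_ℝ) (v w : V) :
    ⟪E (v + w), v + w⟫_ℝ ≤ 2 * (⟪E v, v⟫_ℝ + ⟪E w, w⟫_ℝ) := by
  have h := hEpos (v - w)
  have h4 : ⟪E w, v⟫_ℝ = ⟪E v, w⟫_ℝ := by rw [hE, real_inner_comm]
  simp only [map_sub, map_add, inner_add_left, inner_sub_left, inner_add_right, inner_sub_right,
    h4] at h ⊢
  linarith

/-- Stability of `D Λ_t r + E r = F` with three norms of the solution. -/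
theorem stability_symmetrized {D E : V →ₗ[ℝ] V}
    (hD : D.IsSymmetric) (hE : E.IsSymmetric)
    {τ T c α δ w₀ ε₀ d : ℝ} (hτ : 0 < τ) (hc : 0 < c) (hδ : 0 ≤ δ) (hα : 0 < α)
    (hε : 0 ≤ ε₀) (hε1 : ε₀ ≤ 1)
    (hDα : ∀ w, α * ‖w‖ ^ 2 ≤ ⟪D w, w⟫_ℝ) (hDd : ∀ w, ‖D w‖ ≤ d * ‖w‖) (hd : 0 ≤ d)
    (hEc : ∀ w, c * ‖w‖ ^ 2 ≤ ⟪E w, w⟫_ℝ)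
    (hstab : ∀ w, 1 / 4 * τ ^ 2 * ⟪E w, w⟫_ℝ ≤ (1 - ε₀ ^ 2) * α * ‖w‖ ^ 2)
    {M : ℕ} (hM : M * τ ≤ T) {r y F : ℕ → V}
    (hy : ∀ j, r (j + 1) - r j = τ • y j)
    (heq : ∀ j, j + 1 < M → D (y (j + 1) - y j) + τ • E (r (j + 1)) = τ • F (j + 1))
    (hF : ∀ j, ‖F j‖ ≤ δ) (hFF : ∀ j, ‖F (j + 1) - F j‖ ≤ τ * δ)
    (h₀ : r 0 = 0) (hw₀ : ⟪D (y 0), y 0⟫_ℝ ≤ w₀ * δ ^ 2) {j : ℕ} (hj : j < M)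
    {Q : ℝ} (hQ : Q = 2 * w₀ + 4 * (2 + T) ^ 2 / c) :
    ε₀ * ‖y j‖ ≤ √(Q / α) * δ ∧ ε₀ * √⟪E (r (j + 1)), r (j + 1)⟫_ℝ ≤ √(2 * Q) * δ ∧
    ε₀ * ‖E (τ • ∑ l ∈ Finset.range (j + 1), r (l + 1))‖
      ≤ (T + 2 * d * √(Q / α) + √(8 * α * Q)) * δ := by
  have hDpos : ∀ w, 0 ≤ ⟪D w, w⟫_ℝ := fun w => le_trans (by positivity) (hDα w)
  have hEpos : ∀ w, 0 ≤ ⟪E w, w⟫_ℝ := fun w => le_trans (by positivity) (hEc w)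
  have hε2 : ε₀ ^ 2 ≤ 1 := by nlinarith
  have hED : ∀ w, 1 / 4 * τ ^ 2 * ⟪E w, w⟫_ℝ ≤ (1 - ε₀ ^ 2) * ⟪D w, w⟫_ℝ := by
    intro w
    have := mul_le_mul_of_nonneg_left (hDα w) (by linarith : (0 : ℝ) ≤ 1 - ε₀ ^ 2)
    linarith [hstab w]
  have hen : ∀ i, i < M → ε₀ ^ 2 * ⟪D (y i), y i⟫_ℝ
      + 1 / 4 * ⟪E (r (i + 1) + r i), r (i + 1) + r i⟫_ℝ ≤ Q * δ ^ 2 := fun i hi => by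
    rw [hQ]
    exact energy_bound hD hE hτ hc hδ hDpos hEc hED hM hy heq hF hFF h₀ hw₀ hi
  have hyb : ∀ i, i < M → ε₀ * ‖y i‖ ≤ √(Q / α) * δ := by
    intro i hi
    apply le_sqrt_mul_of_sq_le hδ
    have h1 := hen i hi
    have h2 := hEpos (r (i + 1) + r i)
    have h3 := mul_le_mul_of_nonneg_left (hDα (y i)) (sq_nonneg ε₀)
    rw [div_mul_eq_mul_div, le_div_iff₀ hα]
    nlinarith
  -- A single level is half the sum of two levels plus τ/2 times the difference quotient. The latter
  -- is controlled only through ε₀²⟨D y, y⟩, so a factor ε₀ appears in this norm too.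
  have hrE : ε₀ ^ 2 * ⟪E (r (j + 1)), r (j + 1)⟫_ℝ ≤ 2 * Q * δ ^ 2 := by
    have e1 : r (j + 1) = (1 / 2 : ℝ) • (r (j + 1) + r j) + (τ / 2) • y j := by
      rw [mul_comm_div, one_mul] at *
      have : (τ / 2) • y j = (1 / 2 : ℝ) • (r (j + 1) - r j) := by
        rw [hy, smul_smul]; congr 1; ring
      rw [this, ← smul_add]
      have : r (j + 1) + r j + (r (j + 1) - r j) = (2 : ℝ) • r (j + 1) := by
        rw [two_smul]; abel
      rw [this, smul_smul]; norm_num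
    have h1 := inner_add_le_two_mul hE hEpos ((1 / 2 : ℝ) • (r (j + 1) + r j)) ((τ / 2) • y j)
    rw [← e1] at h1
    have h2 := hen j hj
    have h3 := hED (y j)
    have h5 : (1 - ε₀ ^ 2) * ⟪D (y j), y j⟫_ℝ ≤ ⟪D (y j), y j⟫_ℝ := by
      nlinarith [hDpos (y j), sq_nonneg ε₀]
    have h4 := hEpos (r (j + 1) + r j)
    simp only [map_smul, inner_smul_left, inner_smul_right, RCLike.conj_to_real] at h1
    have h6 := mul_le_mul_of_nonneg_left (h1.trans (by
      linarith : _ ≤ 2 * (1 / 4 * ⟪E (r (j + 1) + r j), r (j + 1) + r j⟫_ℝ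
        + ⟪D (y j), y j⟫_ℝ))) (sq_nonneg ε₀)
    nlinarith
  have hrE' : ε₀ * √⟪E (r (j + 1)), r (j + 1)⟫_ℝ ≤ √(2 * Q) * δ := by
    apply le_sqrt_mul_of_sq_le hδ
    rw [mul_pow, Real.sq_sqrt (hEpos _)]
    exact hrE
  refine ⟨hyb j hj, hrE', ?_⟩
  -- The summed equation stops at level j, while the claim includes level j + 1. For that level, E ≤
  -- 4α/τ² gives τ‖E r‖ ≤ 2√α ⟨E r, r⟩^{1/2}, and τ cancels.
  have hlast : ε₀ * ‖τ • E (r (j + 1))‖ ≤ √(8 * α * Q) * δ := by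
    apply le_sqrt_mul_of_sq_le hδ
    have h1 : ∀ w, ⟪E w, w⟫_ℝ ≤ 4 * α / τ ^ 2 * ‖w‖ ^ 2 := by
      intro w
      have h2 := hstab w
      rw [div_mul_eq_mul_div, le_div_iff₀ (by positivity)]
      nlinarith [mul_nonneg (mul_nonneg (sq_nonneg ε₀) hα.le) (sq_nonneg ‖w‖)]
    have h2 := norm_apply_sq_le hE hEpos h1 (r (j + 1))
    rw [div_mul_eq_mul_div, le_div_iff₀ (by positivity)] at h2
    rw [norm_smul, Real.norm_of_nonneg hτ.le, mul_pow, mul_pow]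
    nlinarith [mul_le_mul_of_nonneg_left h2 (sq_nonneg ε₀), mul_le_mul_of_nonneg_left hrE hα.le]
  have hsum := sum_range_energy heq hj
  have e2 : E (τ • ∑ l ∈ Finset.range (j + 1), r (l + 1))
      = τ • ∑ l ∈ Finset.range j, F (l + 1) - D (y j - y 0) + τ • E (r (j + 1)) := by
    rw [← hsum, Finset.sum_range_succ, smul_add, map_add, map_smul E τ (r (j + 1))]
    abel
  have h1 : ‖τ • ∑ l ∈ Finset.range j, F (l + 1)‖ ≤ T * δ := by
    rw [norm_smul, Real.norm_of_nonneg hτ.le]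
    have h2 : ‖∑ l ∈ Finset.range j, F (l + 1)‖ ≤ j * δ := by
      refine (norm_sum_le_of_le _ fun l _ => hF (l + 1)).trans ?_
      simp
    have h3 : (j : ℝ) * τ ≤ T := le_trans (by
      have : (j : ℝ) ≤ M := by exact_mod_cast hj.le
      nlinarith) hM
    nlinarith
  have h2 : ‖D (y j - y 0)‖ ≤ d * (‖y j‖ + ‖y 0‖) :=
    (hDd _).trans (mul_le_mul_of_nonneg_left (norm_sub_le _ _) hd)
  have h3 : ‖E (τ • ∑ l ∈ Finset.range (j + 1), r (l + 1))‖
      ≤ T * δ + d * (‖y j‖ + ‖y 0‖) + ‖τ • E (r (j + 1))‖ := by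
    rw [e2]
    exact (norm_add_le _ _).trans (add_le_add ((norm_sub_le _ _).trans (add_le_add h1 h2)) le_rfl)
  have hT : 0 ≤ T * δ := (norm_nonneg _).trans h1
  have h4 := mul_le_mul_of_nonneg_left h3 hε
  have h5 := mul_le_mul_of_nonneg_left (add_le_add (hyb j hj) (hyb 0 (by omega))) hd
  have h6 : ε₀ * (T * δ) ≤ T * δ := by nlinarith
  linarith

theorem norm_sum_symm_le {ι : Type*} [Fintype ι] {A : ι → V →ₗ[ℝ] V} {σ : ι → V ≃ₗ[ℝ] V}
    {κ : ι → ℝ} (a : ι → ℝ) (hκA : ∀ k w, κ k * ⟪A k w, w⟫_ℝ ≤ 1 / 3 * ‖w‖ ^ 2)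
    (hσ : ∀ k w, σ k w = w - κ k • A k w) {φ : ι → V} {δ : ℝ} (hφ : ∀ k, ‖φ k‖ ≤ δ) :
    ‖∑ k, a k ^ 2 • (σ k).symm (φ k)‖ ≤ 3 / 2 * (∑ k, a k ^ 2) * δ := by
  rw [mul_assoc, Finset.sum_mul, Finset.mul_sum]
  refine norm_sum_le_of_le _ fun k _ => ?_
  rw [norm_smul, Real.norm_of_nonneg (sq_nonneg _)]
  have h1 := norm_numerov_symm_le (hκA k) (hσ k) (φ k)
  nlinarith [mul_le_mul_of_nonneg_left h1 (sq_nonneg (a k)),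
    mul_le_mul_of_nonneg_left (hφ k) (sq_nonneg (a k))]

/-- The constant in the stability bound for the vector scheme. -/
def stabConst (α β c T S : ℝ) : ℝ :=
  let q := 2 * ((1 + T) ^ 2 / α) + 4 * (2 + T) ^ 2 / c
  (√(q / α) + √(2 * q) + (T + 2 * (3 * β ^ 2 / (2 * α)) * √(q / α) + √(8 * α * q)))
    * (3 * β / (2 * α) + 3 / 2 * S)

/-- Stability of the vector scheme. Here `A k` is `-Λₖ`, `σ k` is `s_{kN}`, `R` is the multiplication
by `ρ`, `r` is the error and `e m k` is the error of the auxiliary function at level `m`; `φ` and `ψ`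
are the residuals. -/
theorem stability_vector [FiniteDimensional ℝ V] {ι : Type*} [Fintype ι]
    {A : ι → V →ₗ[ℝ] V} {σ : ι → V ≃ₗ[ℝ] V} {a κ : ι → ℝ} {R Rinv : V →ₗ[ℝ] V}
    {α β c T τ δ ε₀ : ℝ} {M : ℕ} {r ψ : ℕ → V} {φ e : ℕ → ι → V}
    (hκ : ∀ k, 0 ≤ κ k) (hA : ∀ k, (A k).IsSymmetric) (hApos : ∀ k w, 0 ≤ ⟪A k w, w⟫_ℝ)
    (hκA : ∀ k w, κ k * ⟪A k w, w⟫_ℝ ≤ 1 / 3 * ‖w‖ ^ 2)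
    (hAA : ∀ k l w, A k (A l w) = A l (A k w))
    (hσ : ∀ k w, σ k w = w - κ k • A k w)
    (hR : R.IsSymmetric) (hα : 0 < α) (hRα : ∀ w, α * ‖w‖ ^ 2 ≤ ⟪R w, w⟫_ℝ)
    (hβ : 0 ≤ β) (hRβ : ∀ w, ‖R w‖ ≤ β * ‖w‖)
    (hRinv : ∀ w, R (Rinv w) = w)
    (hc : 0 < c) (hAc : ∀ w, c * ‖w‖ ^ 2 ≤ ∑ k, a k ^ 2 * ⟪A k w, w⟫_ℝ)
    (hτ : 0 < τ) (hε : 0 < ε₀) (hε1 : ε₀ < 1)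
    (hstab : ∀ w, 1 / 4 * τ ^ 2 * ⟪∑ k, a k ^ 2 • (σ k).symm (A k w), w⟫_ℝ
      ≤ (1 - ε₀ ^ 2) * α * ‖w‖ ^ 2)
    (hM2 : 2 ≤ M) (hM : M * τ ≤ T) (h₀ : r 0 = 0)
    (haux : ∀ m, m < M → ∀ k, σ k (e m k) = -A k (r m) + φ m k)
    (hmain : ∀ m, m + 1 < M → (1 / τ ^ 2) • R (r (m + 2) - (2 : ℝ) • r (m + 1) + r m)
      = R (Rinv (∑ k, a k ^ 2 • e (m + 1) k))
        - (τ ^ 2 / 12) • ∑ l, a l ^ 2 • A l (Rinv (∑ k, a k ^ 2 • e (m + 1) k)) + ψ (m + 1))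
    (hstart : (1 / τ) • R (r 1) = (τ / 2) • (R (Rinv (∑ k, a k ^ 2 • e 0 k))
        - (τ ^ 2 / 12) • ∑ l, a l ^ 2 • A l (Rinv (∑ k, a k ^ 2 • e 0 k))) + ψ 0)
    (hδ : 0 ≤ δ)
    (hφ : ∀ m, m < M → ∀ k, ‖φ m k‖ ≤ δ)
    (hφφ : ∀ m, m + 1 < M → ∀ k, ‖φ (m + 1) k - φ m k‖ ≤ τ * δ)
    (hψ : ∀ m, m < M → ‖ψ m‖ ≤ δ)
    (hψψ : ∀ m, 1 ≤ m → m + 1 < M → ‖ψ (m + 1) - ψ m‖ ≤ τ * δ)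
    {m : ℕ} (hm1 : 1 ≤ m) (hm : m ≤ M) :
    ε₀ * (‖(1 / τ) • (r m - r (m - 1))‖ + √(∑ k, a k ^ 2 * ⟪A k (r m), r m⟫_ℝ)
      + ‖τ • ∑ l ∈ Finset.Icc 1 m, ∑ k, a k ^ 2 • A k (r l)‖)
    ≤ stabConst α β c T (∑ k, a k ^ 2) * δ := by
  set S := ∑ k, a k ^ 2 with hS
  have hS0 : 0 ≤ S := Finset.sum_nonneg fun k _ => sq_nonneg _
  set L : V →ₗ[ℝ] V := ∑ k, a k ^ 2 • A k with hL
  set E : V →ₗ[ℝ] V := ∑ k, a k ^ 2 • (((σ k).symm : V →ₗ[ℝ] V) ∘ₗ A k) with hE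
  have hLw : ∀ w, L w = ∑ k, a k ^ 2 • A k w := fun w => by
    simp [hL, LinearMap.sum_apply]
  have hEw : ∀ w, E w = ∑ k, a k ^ 2 • (σ k).symm (A k w) := fun w => by
    simp [hE, LinearMap.sum_apply]
  have hLin : ∀ w, ⟪L w, w⟫_ℝ = ∑ k, a k ^ 2 * ⟪A k w, w⟫_ℝ := fun w => by
    rw [hLw, sum_inner]
    simp only [inner_smul_left, RCLike.conj_to_real]
  have hLpos : ∀ w, 0 ≤ ⟪L w, w⟫_ℝ := fun w => by
    rw [hLin]
    exact Finset.sum_nonneg fun k _ => mul_nonneg (sq_nonneg _) (hApos k w)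
  have hLs : L.IsSymmetric := by
    intro v w
    simp only [hLw, sum_inner, inner_sum, inner_smul_left, inner_smul_right, RCLike.conj_to_real]
    exact Finset.sum_congr rfl fun k _ => by rw [hA k v w]
  have hEs : E.IsSymmetric := by
    intro v w
    simp only [hEw, sum_inner, inner_sum, inner_smul_left, inner_smul_right, RCLike.conj_to_real]
    exact Finset.sum_congr rfl fun k _ => by
      rw [show ⟪(σ k).symm (A k v), w⟫_ℝ = ⟪v, (σ k).symm (A k w)⟫_ℝ from
        numerov_symm_comp_isSymmetric (hA k) (hσ k) v w]
  have hLE : ∀ w, ⟪L w, w⟫_ℝ ≤ ⟪E w, w⟫_ℝ := fun w => by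
    rw [hLin, hEw, sum_inner]
    simp only [inner_smul_left, RCLike.conj_to_real]
    exact Finset.sum_le_sum fun k _ => mul_le_mul_of_nonneg_left
      (inner_le_inner_numerov_symm_apply (hA k) (hκ k) (hκA k) (hσ k) w) (sq_nonneg _)
  have hσA : ∀ k l w, (σ k).symm (A l w) = A l ((σ k).symm w) := by
    intro k l w
    rw [LinearEquiv.symm_apply_eq, hσ, hAA k l, ← map_smul, ← map_sub, ← hσ,
      LinearEquiv.apply_symm_apply]
  -- All the `A k` and `(σ k).symm` commute; the weight `R` does not enter `L` or `E`.
  have hLEc : ∀ w, L (E w) = E (L w) := by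
    intro w
    simp only [hLw, hEw, map_sum, map_smul, Finset.smul_sum]
    rw [Finset.sum_comm]
    refine Finset.sum_congr rfl fun k _ => Finset.sum_congr rfl fun l _ => ?_
    rw [smul_comm, hAA k l, hσA k l]
  have hEc : ∀ w, c * ‖w‖ ^ 2 ≤ ⟪E w, w⟫_ℝ := fun w =>
    (hAc w).trans (by rw [← hLin]; exact hLE w)
  set K : V →ₗ[ℝ] V := (τ ^ 2 / 12) • L with hK
  have hKw : ∀ w, K w = (τ ^ 2 / 12) • L w := fun w => rfl
  have hKs : K.IsSymmetric := fun v w => by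
    rw [hKw, hKw, inner_smul_left, inner_smul_right, hLs v w, RCLike.conj_to_real]
  have hKin : ∀ w, ⟪K w, w⟫_ℝ = τ ^ 2 / 12 * ⟪L w, w⟫_ℝ := fun w => by
    rw [hKw, inner_smul_left, RCLike.conj_to_real]
  have hKpos : ∀ w, 0 ≤ ⟪K w, w⟫_ℝ := fun w => by
    rw [hKin]; exact mul_nonneg (by positivity) (hLpos w)
  have hstab' : ∀ w, 1 / 4 * τ ^ 2 * ⟪E w, w⟫_ℝ ≤ (1 - ε₀ ^ 2) * α * ‖w‖ ^ 2 := fun w => by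
    rw [hEw]; exact hstab w
  -- K = (τ²/12) L ≤ (1/3)(τ²/4) E ≤ α/3.
  have hKα : ∀ w, ⟪K w, w⟫_ℝ ≤ α / 3 * ‖w‖ ^ 2 := by
    intro w
    rw [hKin]
    have h1 := hstab' w
    have h2 := mul_le_mul_of_nonneg_left (hLE w) (sq_nonneg τ)
    nlinarith [mul_nonneg (mul_nonneg (sq_nonneg ε₀) hα.le) (sq_nonneg ‖w‖)]
  obtain ⟨G, hG⟩ := exists_sub_equiv (R := R) (K := K) hα hRα hKα
  set D : V →ₗ[ℝ] V := R ∘ₗ (G.symm : V →ₗ[ℝ] V) ∘ₗ R with hD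
  have hDw : ∀ w, D w = R (G.symm (R w)) := fun w => rfl
  have hDs : D.IsSymmetric := weight_isSymmetric hR hKs hG
  have hDα : ∀ w, α * ‖w‖ ^ 2 ≤ ⟪D w, w⟫_ℝ := fun w =>
    inner_weight_ge hα hR hKs hRα hKpos hKα hG w
  have hRG : ∀ w, ‖R (G.symm w)‖ ≤ 3 * β / (2 * α) * ‖w‖ := fun w => by
    have h1 := mul_le_mul_of_nonneg_left (norm_sub_symm_le hα hRα hKα hG w) hβ
    refine (hRβ _).trans (h1.trans (le_of_eq (by ring)))
  have hDd : ∀ w, ‖D w‖ ≤ 3 * β ^ 2 / (2 * α) * ‖w‖ := fun w => by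
    have h1 := mul_le_mul_of_nonneg_left (hRβ w) (by positivity : 0 ≤ 3 * β / (2 * α))
    exact (hRG _).trans (h1.trans (le_of_eq (by ring)))
  set b : ℕ → V := fun m => ∑ k, a k ^ 2 • (σ k).symm (φ m k) with hb
  -- Elimination of the auxiliary errors.
  have hq : ∀ m, m < M → ∑ k, a k ^ 2 • e m k = b m - E (r m) := by
    intro m hm
    rw [hEw, hb, ← Finset.sum_sub_distrib]
    refine Finset.sum_congr rfl fun k _ => ?_
    have : e m k = (σ k).symm (-A k (r m) + φ m k) := by
      rw [← haux m hm k, LinearEquiv.symm_apply_apply]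
    rw [this, map_add, map_neg, ← smul_sub]
    congr 1
    abel
  have hGR : ∀ w, R (Rinv w) - (τ ^ 2 / 12) • ∑ l, a l ^ 2 • A l (Rinv w) = G (Rinv w) :=
    fun w => by rw [hG, hKw, hLw]
  -- The first factor uses ‖R G⁻¹‖ ≤ 3β/(2α) for `ψ`, the second one ‖σ_k⁻¹‖ ≤ 3/2 for `φ`.
  set δ₁ := (3 * β / (2 * α) + 3 / 2 * S) * δ with hδ₁
  have hδ₁0 : 0 ≤ δ₁ := by positivity
  set y : ℕ → V := fun j => (1 / τ) • (r (j + 1) - r j) with hy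
  have hry : ∀ j, r (j + 1) - r j = τ • y j := fun j => by
    simp only [hy]; rw [smul_smul, mul_one_div_cancel hτ.ne', one_smul]
  set F₁ : ℕ → V := fun m => R (G.symm (ψ m)) + b m with hF₁
  have hbb : ∀ m, m < M → ‖b m‖ ≤ 3 / 2 * S * δ := fun m hm =>
    norm_sum_symm_le a hκA hσ (hφ m hm)
  have hF₁b : ∀ m, m < M → ‖F₁ m‖ ≤ δ₁ := by
    intro m hm
    have h1 := hRG (ψ m)
    have h2 := mul_le_mul_of_nonneg_left (hψ m hm) (by positivity : 0 ≤ 3 * β / (2 * α))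
    have h3 := norm_add_le (R (G.symm (ψ m))) (b m)
    have h4 := hbb m hm
    simp only [hF₁, hδ₁]
    linarith
  have hF₁d : ∀ m, 1 ≤ m → m + 1 < M → ‖F₁ (m + 1) - F₁ m‖ ≤ τ * δ₁ := by
    intro m hm1 hm
    have h1 := hRG (ψ (m + 1) - ψ m)
    have h2 := mul_le_mul_of_nonneg_left (hψψ m hm1 hm) (by positivity : 0 ≤ 3 * β / (2 * α))
    have h4 : ‖b (m + 1) - b m‖ ≤ 3 / 2 * S * (τ * δ) := by
      have : b (m + 1) - b m = ∑ k, a k ^ 2 • (σ k).symm (φ (m + 1) k - φ m k) := by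
        simp only [hb, map_sub, smul_sub, Finset.sum_sub_distrib]
      rw [this]
      exact norm_sum_symm_le a hκA hσ (hφφ m hm)
    have e1 : F₁ (m + 1) - F₁ m
        = R (G.symm (ψ (m + 1) - ψ m)) + (b (m + 1) - b m) := by
      simp only [hF₁, map_sub]; abel
    have h3 := norm_add_le (R (G.symm (ψ (m + 1) - ψ m))) (b (m + 1) - b m)
    rw [e1]
    simp only [hδ₁]
    linarith
  -- `F₁` is Lipschitz only on the levels 1, …, M - 1, where the three-level equation is used: `ψ 0`
  -- belongs to the starting equation and is unrelated to `ψ 1`. Outside this range it is continued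
  -- by its end values.
  set F : ℕ → V := fun j => F₁ (max 1 (min j (M - 1))) with hF
  have hFb : ∀ j, ‖F j‖ ≤ δ₁ := fun j => hF₁b _ (by omega)
  have hFd : ∀ j, ‖F (j + 1) - F j‖ ≤ τ * δ₁ := by
    intro j
    by_cases h1 : 1 ≤ j ∧ j + 1 < M
    · have e1 : max 1 (min (j + 1) (M - 1)) = j + 1 := by omega
      have e2 : max 1 (min j (M - 1)) = j := by omega
      simp only [hF, e1, e2]
      exact hF₁d j h1.1 h1.2
    · have e1 : max 1 (min (j + 1) (M - 1)) = max 1 (min j (M - 1)) := by omega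
      simp only [hF, e1, sub_self, norm_zero]
      positivity
  have heq : ∀ j, j + 1 < M → D (y (j + 1) - y j) + τ • E (r (j + 1)) = τ • F (j + 1) := by
    intro j hj
    have e1 : max 1 (min (j + 1) (M - 1)) = j + 1 := by omega
    have h1 := hmain j hj
    rw [hGR, hq _ hj] at h1
    have e2 : y (j + 1) - y j = τ • ((1 / τ ^ 2) • (r (j + 2) - (2 : ℝ) • r (j + 1) + r j)) := by
      simp only [hy]
      rw [smul_smul, ← smul_sub, two_smul]
      congr 1
      · field_simp
      · rw [show j + 1 + 1 = j + 2 from rfl]; abel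
    have h2 : D (y (j + 1) - y j) = τ • (b (j + 1) - E (r (j + 1)) + R (G.symm (ψ (j + 1)))) := by
      rw [hDw, e2, map_smul R, map_smul R, h1]
      simp only [map_smul, map_add, LinearEquiv.symm_apply_apply, hRinv]
    rw [h2]
    simp only [hF, hF₁, e1]
    rw [← smul_add]
    congr 1
    abel
  have hτT : τ ≤ T := by
    have : (2 : ℝ) ≤ M := by exact_mod_cast hM2
    nlinarith
  -- Since r 0 = 0, the starting equation gives D y₀ = (τ/2) b₀ + R G⁻¹ψ₀, and D ≥ α yields ⟨D y₀,
  -- y₀⟩ ≤ ‖D y₀‖²/α.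
  have hw₀ : ⟪D (y 0), y 0⟫_ℝ ≤ (1 + T) ^ 2 / α * δ₁ ^ 2 := by
    have h1 := hstart
    rw [hGR, hq 0 (by omega), h₀, map_zero, sub_zero] at h1
    have e1 : y 0 = (1 / τ) • r 1 := by simp [hy, h₀]
    have h2 : D (y 0) = (τ / 2) • b 0 + R (G.symm (ψ 0)) := by
      rw [hDw, e1, map_smul R, h1]
      simp only [map_smul, map_add, LinearEquiv.symm_apply_apply, hRinv]
    have h3 : ‖D (y 0)‖ ≤ (1 + T) * δ₁ := by
      rw [h2]
      have h4 := norm_add_le ((τ / 2) • b 0) (R (G.symm (ψ 0)))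
      rw [norm_smul, Real.norm_of_nonneg (by positivity)] at h4
      have h5 := hRG (ψ 0)
      have h6 := mul_le_mul_of_nonneg_left (hψ 0 (by omega)) (by positivity : 0 ≤ 3 * β / (2 * α))
      have h7 := hbb 0 (by omega)
      have h8 : τ / 2 * ‖b 0‖ ≤ T * (3 / 2 * S * δ) :=
        mul_le_mul (by linarith) h7 (norm_nonneg _) (by linarith)
      have h9 : 0 ≤ T * (3 * β / (2 * α) * δ) := mul_nonneg (by linarith) (by positivity)
      have h10 : 0 ≤ 3 / 2 * S * δ := by positivity
      simp only [hδ₁]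
      linarith
    have h4 := hDα (y 0)
    have h5 := real_inner_le_norm (D (y 0)) (y 0)
    have h6 : α * ‖y 0‖ ≤ ‖D (y 0)‖ := by
      rcases eq_or_lt_of_le (norm_nonneg (y 0)) with h0 | h0
      · rw [← h0]; simp
      · nlinarith
    have h7 : α * ⟪D (y 0), y 0⟫_ℝ ≤ ‖D (y 0)‖ ^ 2 := by nlinarith [norm_nonneg (D (y 0))]
    have h8 : ‖D (y 0)‖ ^ 2 ≤ ((1 + T) * δ₁) ^ 2 := pow_le_pow_left₀ (norm_nonneg _) h3 2
    rw [div_mul_eq_mul_div, le_div_iff₀ hα]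
    linarith
  obtain ⟨j, rfl⟩ : ∃ j, m = j + 1 := ⟨m - 1, by omega⟩
  obtain ⟨h1, h2, h3⟩ := stability_symmetrized hDs hEs hτ hc hδ₁0 hα hε.le hε1.le hDα hDd
    (by positivity) hEc hstab' hM hry heq hFb hFd h₀ hw₀ (j := j) (by omega) rfl
  have h4 : √(∑ k, a k ^ 2 * ⟪A k (r (j + 1)), r (j + 1)⟫_ℝ)
      ≤ √⟪E (r (j + 1)), r (j + 1)⟫_ℝ := by
    rw [← hLin]; exact Real.sqrt_le_sqrt (hLE _)
  have e5 : τ • ∑ l ∈ Finset.Icc 1 (j + 1), ∑ k, a k ^ 2 • A k (r l)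
      = L (τ • ∑ l ∈ Finset.range (j + 1), r (l + 1)) := by
    rw [map_smul, map_sum]
    simp only [hLw]
    congr 1
    rw [Finset.range_eq_Ico, Finset.sum_Ico_add' (fun l => ∑ k, a k ^ 2 • A k (r l)) 0 (j + 1) 1]
    rfl
  have h5 := norm_apply_le_norm_apply_of_commute hLs hEs hLpos hLE hLEc
    (τ • ∑ l ∈ Finset.range (j + 1), r (l + 1))
  have h6 := mul_le_mul_of_nonneg_left h4 hε.le
  have h7 := mul_le_mul_of_nonneg_left h5 hε.le
  rw [e5]
  have e8 : (1 / τ) • (r (j + 1) - r (j + 1 - 1)) = y j := rfl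
  rw [e8]
  have e9 : stabConst α β c T S * δ
      = (√((2 * ((1 + T) ^ 2 / α) + 4 * (2 + T) ^ 2 / c) / α)
        + √(2 * (2 * ((1 + T) ^ 2 / α) + 4 * (2 + T) ^ 2 / c))
        + (T + 2 * (3 * β ^ 2 / (2 * α))
            * √((2 * ((1 + T) ^ 2 / α) + 4 * (2 + T) ^ 2 / c) / α)
          + √(8 * α * (2 * ((1 + T) ^ 2 / α) + 4 * (2 + T) ^ 2 / c)))) * δ₁ := by
    simp only [stabConst, hδ₁]; ring
  rw [e9]
  linarith

end Stability

/-- The same bound with the inner product passed as a form: as a space of functions H_h already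
carries the maximum norm, so (·,·)_h is installed as a local structure only. -/
theorem stability_vector_bilinForm {V : Type*} [AddCommGroup V] [Module ℝ V]
    [FiniteDimensional ℝ V] (B : LinearMap.BilinForm ℝ V) (hB : ∀ v w, B v w = B w v)
    (hBpos : ∀ v, 0 ≤ B v v) (hBdef : ∀ v, B v v = 0 → v = 0) {ι : Type*} [Fintype ι]
    {A : ι → V →ₗ[ℝ] V} {σ : ι → V ≃ₗ[ℝ] V} {a κ : ι → ℝ} {R Rinv : V →ₗ[ℝ] V}
    {α β c T τ δ ε₀ : ℝ} {M : ℕ} {r ψ : ℕ → V} {φ e : ℕ → ι → V}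
    (hκ : ∀ k, 0 ≤ κ k) (hA : ∀ k v w, B (A k v) w = B v (A k w)) (hApos : ∀ k w, 0 ≤ B (A k w) w)
    (hκA : ∀ k w, κ k * B (A k w) w ≤ 1 / 3 * B w w)
    (hAA : ∀ k l w, A k (A l w) = A l (A k w))
    (hσ : ∀ k w, σ k w = w - κ k • A k w)
    (hR : ∀ v w, B (R v) w = B v (R w)) (hα : 0 < α) (hRα : ∀ w, α * B w w ≤ B (R w) w)
    (hβ : 0 ≤ β) (hRβ : ∀ w, √(B (R w) (R w)) ≤ β * √(B w w))
    (hRinv : ∀ w, R (Rinv w) = w)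
    (hc : 0 < c) (hAc : ∀ w, c * B w w ≤ ∑ k, a k ^ 2 * B (A k w) w)
    (hτ : 0 < τ) (hε : 0 < ε₀) (hε1 : ε₀ < 1)
    (hstab : ∀ w, 1 / 4 * τ ^ 2 * B (∑ k, a k ^ 2 • (σ k).symm (A k w)) w
      ≤ (1 - ε₀ ^ 2) * α * B w w)
    (hM2 : 2 ≤ M) (hM : M * τ ≤ T) (h₀ : r 0 = 0)
    (haux : ∀ m, m < M → ∀ k, σ k (e m k) = -A k (r m) + φ m k)
    (hmain : ∀ m, m + 1 < M → (1 / τ ^ 2) • R (r (m + 2) - (2 : ℝ) • r (m + 1) + r m)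
      = R (Rinv (∑ k, a k ^ 2 • e (m + 1) k))
        - (τ ^ 2 / 12) • ∑ l, a l ^ 2 • A l (Rinv (∑ k, a k ^ 2 • e (m + 1) k)) + ψ (m + 1))
    (hstart : (1 / τ) • R (r 1) = (τ / 2) • (R (Rinv (∑ k, a k ^ 2 • e 0 k))
        - (τ ^ 2 / 12) • ∑ l, a l ^ 2 • A l (Rinv (∑ k, a k ^ 2 • e 0 k))) + ψ 0)
    (hδ : 0 ≤ δ)
    (hφ : ∀ m, m < M → ∀ k, √(B (φ m k) (φ m k)) ≤ δ)
    (hφφ : ∀ m, m + 1 < M → ∀ k, √(B (φ (m + 1) k - φ m k) (φ (m + 1) k - φ m k)) ≤ τ * δ)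
    (hψ : ∀ m, m < M → √(B (ψ m) (ψ m)) ≤ δ)
    (hψψ : ∀ m, 1 ≤ m → m + 1 < M → √(B (ψ (m + 1) - ψ m) (ψ (m + 1) - ψ m)) ≤ τ * δ)
    {m : ℕ} (hm1 : 1 ≤ m) (hm : m ≤ M) :
    ε₀ * (√(B ((1 / τ) • (r m - r (m - 1))) ((1 / τ) • (r m - r (m - 1))))
      + √(∑ k, a k ^ 2 * B (A k (r m)) (r m))
      + √(B (τ • ∑ l ∈ Finset.Icc 1 m, ∑ k, a k ^ 2 • A k (r l))
          (τ • ∑ l ∈ Finset.Icc 1 m, ∑ k, a k ^ 2 • A k (r l))))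
    ≤ stabConst α β c T (∑ k, a k ^ 2) * δ := by
  let cd : InnerProductSpace.Core ℝ V :=
    { inner := fun v w => B v w
      conj_inner_symm := fun v w => hB w v
      re_inner_nonneg := fun v => hBpos v
      add_left := fun u v w => by simp
      smul_left := fun v w t => by simp
      definite := hBdef }
  let _ : NormedAddCommGroup V := cd.toNormedAddCommGroup
  let _ : InnerProductSpace ℝ V := InnerProductSpace.ofCore cd.toCore
  have hn : ∀ w : V, ‖w‖ ^ 2 = B w w := fun w => (real_inner_self_eq_norm_sq w).symm
  refine stability_vector (V := V) (σ := σ) (φ := φ) (e := e) (ψ := ψ) (R := R) (Rinv := Rinv)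
    (κ := κ) (M := M) (α := α) hκ hA hApos ?_ hAA hσ hR hα ?_ hβ hRβ hRinv hc ?_ hτ hε hε1 ?_ hM2 hM h₀
    haux hmain hstart hδ hφ hφφ hψ hψψ hm1 hm
  · simp only [hn]; exact hκA
  · simp only [hn]; exact hRα
  · simp only [hn]; exact hAc
  · simp only [hn]; exact hstab

/-! ### Neighbours of a node -/

section Mesh

variable {n : ℕ} {N : Fin n → ℕ}

theorem nextNode_apply_self (k : Fin n) (i : Node N) :
    ((nextNode k i k : Fin (N k + 1)) : ℕ) = min ((i k : ℕ) + 1) (N k) := by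
  simp [nextNode]

theorem prevNode_apply_self (k : Fin n) (i : Node N) :
    ((prevNode k i k : Fin (N k + 1)) : ℕ) = (i k : ℕ) - 1 := by
  simp [prevNode]

theorem nextNode_apply_of_ne {k l : Fin n} (h : l ≠ k) (i : Node N) : nextNode k i l = i l := by
  simp [nextNode, h]

theorem prevNode_apply_of_ne {k l : Fin n} (h : l ≠ k) (i : Node N) : prevNode k i l = i l := by
  simp [prevNode, h]

theorem prevNode_nextNode {k : Fin n} {i : Node N} (h : (i k : ℕ) < N k) :
    prevNode k (nextNode k i) = i := by
  funext l
  by_cases hl : l = k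
  · subst hl
    apply Fin.ext
    rw [prevNode_apply_self, nextNode_apply_self]
    omega
  · rw [prevNode_apply_of_ne hl, nextNode_apply_of_ne hl]

theorem nextNode_prevNode {k : Fin n} {i : Node N} (h : 0 < (i k : ℕ)) :
    nextNode k (prevNode k i) = i := by
  funext l
  by_cases hl : l = k
  · subst hl
    apply Fin.ext
    have := (i l).isLt
    rw [nextNode_apply_self, prevNode_apply_self]
    omega
  · rw [nextNode_apply_of_ne hl, prevNode_apply_of_ne hl]

/-- An edge of the mesh in direction `k` may be labelled by its left or by its right end point. -/
theorem sum_nextNode (k : Fin n) (φ : Node N → Node N → ℝ) :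
    ∑ i with (i k : ℕ) < N k, φ (nextNode k i) i
      = ∑ i : Node N with 0 < (i k : ℕ), φ i (prevNode k i) := by
  refine Finset.sum_bij' (fun i _ => nextNode k i) (fun i _ => prevNode k i) ?_ ?_ ?_ ?_ ?_
  · intro i hi
    simp only [Finset.mem_filter, Finset.mem_univ, true_and] at hi ⊢
    rw [nextNode_apply_self]; omega
  · intro i hi
    simp only [Finset.mem_filter, Finset.mem_univ, true_and] at hi ⊢
    have := (i k).isLt
    rw [prevNode_apply_self]; omega
  · intro i hi
    simp only [Finset.mem_filter, Finset.mem_univ, true_and] at hi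
    exact prevNode_nextNode hi
  · intro i hi
    simp only [Finset.mem_filter, Finset.mem_univ, true_and] at hi
    exact nextNode_prevNode hi
  · intro i hi
    simp only [Finset.mem_filter, Finset.mem_univ, true_and] at hi
    rw [prevNode_nextNode hi]

theorem sum_filter_eq_sum_interior {p : Node N → Prop} [DecidablePred p]
    (hp : ∀ i, Interior i → p i) {f : Node N → ℝ} (hf : ∀ i, ¬ Interior i → f i = 0) :
    ∑ i with p i, f i = ∑ i with Interior i, f i := by
  symm
  refine Finset.sum_subset (fun i hi => ?_) fun i _ hi => ?_
  · simp only [Finset.mem_filter, Finset.mem_univ, true_and] at hi ⊢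
    exact hp i hi
  · simp only [Finset.mem_filter, Finset.mem_univ, true_and] at hi
    exact hf i hi

/-! ### The operators `-Λₖ` in `H_h` -/

theorem inHh_apply (A : MeshFun N →ₗ[ℝ] MeshFun N) (w : Hh N) (i : Node N) :
    (inHh A w : MeshFun N) i = if Interior i then A (w : MeshFun N) i else 0 := rfl

theorem inHh_apply_of_interior (A : MeshFun N →ₗ[ℝ] MeshFun N) (w : Hh N) {i : Node N}
    (hi : Interior i) : (inHh A w : MeshFun N) i = A (w : MeshFun N) i := by
  rw [inHh_apply, if_pos hi]

theorem cutoff_apply (w : MeshFun N) (i : Node N) :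
    (cutoff N w : MeshFun N) i = if Interior i then w i else 0 := rfl

theorem cutoff_apply_of_interior (w : MeshFun N) {i : Node N} (hi : Interior i) :
    (cutoff N w : MeshFun N) i = w i := by
  rw [cutoff_apply, if_pos hi]

theorem Hh_ext {v w : Hh N} (h : ∀ i, Interior i → (v : MeshFun N) i = (w : MeshFun N) i) :
    v = w := by
  ext i
  by_cases hi : Interior i
  · exact h i hi
  · rw [v.2 i hi, w.2 i hi]

/-- `-Λₖ` in `H_h`. -/
def negLam (h : Fin n → ℝ) (k : Fin n) : Hh N →ₗ[ℝ] Hh N := -inHh (lam h k)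

theorem negLam_apply (h : Fin n → ℝ) (k : Fin n) (w : Hh N) (i : Node N) :
    (negLam h k w : MeshFun N) i = if Interior i then
      -(((w : MeshFun N) (nextNode k i) - 2 * (w : MeshFun N) i + (w : MeshFun N) (prevNode k i))
        / h k ^ 2) else 0 := by
  have : (negLam h k w : MeshFun N) i = -(inHh (lam h k) w : MeshFun N) i := rfl
  rw [this, inHh_apply]
  split_ifs
  · rfl
  · simp

/-- Summation by parts. -/
theorem sum_negLam_mul (h : Fin n → ℝ) (k : Fin n) (v w : Hh N) :
    ∑ i with Interior i, (negLam h k v : MeshFun N) i * (w : MeshFun N) i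
      = 1 / h k ^ 2 * ∑ i with (i k : ℕ) < N k,
        ((v : MeshFun N) (nextNode k i) - (v : MeshFun N) i)
          * ((w : MeshFun N) (nextNode k i) - (w : MeshFun N) i) := by
  have e1 : ∑ i with Interior i, (negLam h k v : MeshFun N) i * (w : MeshFun N) i
      = 1 / h k ^ 2 * (∑ i with Interior i,
          ((v : MeshFun N) i - (v : MeshFun N) (nextNode k i)) * (w : MeshFun N) i
        + ∑ i with Interior i,
          ((v : MeshFun N) i - (v : MeshFun N) (prevNode k i)) * (w : MeshFun N) i) := by
    rw [← Finset.sum_add_distrib, Finset.mul_sum]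
    refine Finset.sum_congr rfl fun i hi => ?_
    rw [negLam_apply, if_pos (Finset.mem_filter.mp hi).2]
    ring
  rw [e1, ← sum_filter_eq_sum_interior (p := fun i => (i k : ℕ) < N k) (fun i hi => (hi k).2)
      (fun i hi => by rw [w.2 i hi, mul_zero]),
    ← sum_filter_eq_sum_interior (p := fun i => 0 < (i k : ℕ)) (fun i hi => (hi k).1)
      (fun i hi => by rw [w.2 i hi, mul_zero]),
    ← sum_nextNode k (fun i j => ((v : MeshFun N) i - (v : MeshFun N) j) * (w : MeshFun N) i),
    ← Finset.sum_add_distrib]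
  congr 1
  refine Finset.sum_congr rfl fun i _ => ?_
  ring

theorem sum_nextNode_sq (k : Fin n) (w : Hh N) :
    ∑ i with (i k : ℕ) < N k, (w : MeshFun N) (nextNode k i) ^ 2
      = ∑ i with Interior i, (w : MeshFun N) i ^ 2 := by
  rw [sum_nextNode k (fun i _ => (w : MeshFun N) i ^ 2)]
  exact sum_filter_eq_sum_interior (fun i hi => (hi k).1) (fun i hi => by rw [w.2 i hi]; ring)

theorem sum_edge_sq (k : Fin n) (w : Hh N) :
    ∑ i with (i k : ℕ) < N k, (w : MeshFun N) i ^ 2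
      = ∑ i with Interior i, (w : MeshFun N) i ^ 2 :=
  sum_filter_eq_sum_interior (fun i hi => (hi k).2) (fun i hi => by rw [w.2 i hi]; ring)

theorem sum_edge_diff_sq_le (k : Fin n) (w : Hh N) :
    ∑ i with (i k : ℕ) < N k, ((w : MeshFun N) (nextNode k i) - (w : MeshFun N) i) ^ 2
      ≤ 4 * ∑ i with Interior i, (w : MeshFun N) i ^ 2 := by
  have h1 := sum_nextNode_sq k w
  have h2 := sum_edge_sq k w
  calc ∑ i with (i k : ℕ) < N k, ((w : MeshFun N) (nextNode k i) - (w : MeshFun N) i) ^ 2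
      ≤ ∑ i with (i k : ℕ) < N k, (2 * (w : MeshFun N) (nextNode k i) ^ 2
          + 2 * (w : MeshFun N) i ^ 2) :=
        Finset.sum_le_sum fun i _ => by
          nlinarith [sq_nonneg ((w : MeshFun N) (nextNode k i) + (w : MeshFun N) i)]
    _ = 4 * ∑ i with Interior i, (w : MeshFun N) i ^ 2 := by
        rw [Finset.sum_add_distrib, ← Finset.mul_sum, ← Finset.mul_sum, h1, h2]; ring

/-- Discrete Poincaré inequality in direction `k`. -/
theorem sum_sq_le_sum_edge_diff_sq (k : Fin n) (w : Hh N) :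
    ∑ i with Interior i, (w : MeshFun N) i ^ 2
      ≤ 4 * (N k : ℝ) ^ 2 * ∑ i with (i k : ℕ) < N k,
        ((w : MeshFun N) (nextNode k i) - (w : MeshFun N) i) ^ 2 := by
  have h1 := sum_nextNode_sq k w
  have h2 := sum_edge_sq k w
  -- With the weight i_k the two sums agree by shifting along edges, so the bracket in `h4` sums to
  -- zero. This replaces writing w as a sum of differences from the boundary.
  have h3 : ∑ i with (i k : ℕ) < N k, (((i k : ℕ) : ℝ) + 1) * (w : MeshFun N) (nextNode k i) ^ 2
      = ∑ i with (i k : ℕ) < N k, ((i k : ℕ) : ℝ) * (w : MeshFun N) i ^ 2 := by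
    have e1 : ∑ i with (i k : ℕ) < N k,
        (((i k : ℕ) : ℝ) + 1) * (w : MeshFun N) (nextNode k i) ^ 2
        = ∑ i with (i k : ℕ) < N k,
          ((nextNode k i k : ℕ) : ℝ) * (w : MeshFun N) (nextNode k i) ^ 2 := by
      refine Finset.sum_congr rfl fun i hi => ?_
      simp only [Finset.mem_filter, Finset.mem_univ, true_and] at hi
      rw [nextNode_apply_self, min_eq_left (by omega)]
      push_cast
      ring
    rw [e1, sum_nextNode k (fun i _ => ((i k : ℕ) : ℝ) * (w : MeshFun N) i ^ 2),
      sum_filter_eq_sum_interior (fun i hi => (hi k).1) (fun i hi => by rw [w.2 i hi]; ring),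
      sum_filter_eq_sum_interior (fun i hi => (hi k).2) (fun i hi => by rw [w.2 i hi]; ring)]
  have h4 : ∑ i with (i k : ℕ) < N k, (w : MeshFun N) i ^ 2
      ≤ ∑ i with (i k : ℕ) < N k, (((((i k : ℕ) : ℝ) + 1) * (w : MeshFun N) (nextNode k i) ^ 2
          - ((i k : ℕ) : ℝ) * (w : MeshFun N) i ^ 2)
        + (2 * (N k : ℝ) ^ 2 * ((w : MeshFun N) (nextNode k i) - (w : MeshFun N) i) ^ 2
          + 1 / 4 * ((w : MeshFun N) (nextNode k i) ^ 2 + (w : MeshFun N) i ^ 2))) := by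
    refine Finset.sum_le_sum fun i hi => ?_
    simp only [Finset.mem_filter, Finset.mem_univ, true_and] at hi
    have hq : ((i k : ℕ) : ℝ) + 1 ≤ N k := by exact_mod_cast hi
    have hq0 : (0 : ℝ) ≤ ((i k : ℕ) : ℝ) := Nat.cast_nonneg _
    generalize ((i k : ℕ) : ℝ) = q at *
    generalize (w : MeshFun N) (nextNode k i) = x
    generalize (w : MeshFun N) i = y
    -- Abel summation gives y² = ((q+1)x² - q y²) + (q+1)(y² - x²). Young's inequality is weighted
    -- so that, after summation, half of the sum of squares is absorbed on the left.
    have e1 : (q + 1) * ((y - x) * (x + y)) ≤ 2 * (q + 1) ^ 2 * (x - y) ^ 2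
        + 1 / 8 * (x + y) ^ 2 := by
      nlinarith [sq_nonneg (4 * (q + 1) * (y - x) - (x + y))]
    have e2 : (q + 1) ^ 2 ≤ (N k : ℝ) ^ 2 := pow_le_pow_left₀ (by linarith) hq 2
    have e3 := mul_le_mul_of_nonneg_right e2 (sq_nonneg (x - y))
    nlinarith [sq_nonneg (x - y)]
  rw [Finset.sum_add_distrib, Finset.sum_sub_distrib, h3, sub_self, zero_add,
    Finset.sum_add_distrib, ← Finset.mul_sum, ← Finset.mul_sum, Finset.sum_add_distrib, h1, h2] at h4
  linarith

theorem nextNode_comm {k l : Fin n} (hkl : l ≠ k) (i : Node N) :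
    nextNode k (nextNode l i) = nextNode l (nextNode k i) := by
  funext j
  rcases eq_or_ne j k with rfl | h1
  · apply Fin.ext
    rw [nextNode_apply_self, nextNode_apply_of_ne hkl.symm, nextNode_apply_of_ne hkl.symm,
      nextNode_apply_self]
  rcases eq_or_ne j l with rfl | h2
  · apply Fin.ext
    rw [nextNode_apply_of_ne h1, nextNode_apply_self, nextNode_apply_self, nextNode_apply_of_ne h1]
  · rw [nextNode_apply_of_ne h1, nextNode_apply_of_ne h2, nextNode_apply_of_ne h2,
      nextNode_apply_of_ne h1]

theorem prevNode_comm {k l : Fin n} (hkl : l ≠ k) (i : Node N) :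
    prevNode k (prevNode l i) = prevNode l (prevNode k i) := by
  funext j
  rcases eq_or_ne j k with rfl | h1
  · apply Fin.ext
    rw [prevNode_apply_self, prevNode_apply_of_ne hkl.symm, prevNode_apply_of_ne hkl.symm,
      prevNode_apply_self]
  rcases eq_or_ne j l with rfl | h2
  · apply Fin.ext
    rw [prevNode_apply_of_ne h1, prevNode_apply_self, prevNode_apply_self, prevNode_apply_of_ne h1]
  · rw [prevNode_apply_of_ne h1, prevNode_apply_of_ne h2, prevNode_apply_of_ne h2,
      prevNode_apply_of_ne h1]

theorem nextNode_prevNode_comm {k l : Fin n} (hkl : l ≠ k) (i : Node N) :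
    nextNode k (prevNode l i) = prevNode l (nextNode k i) := by
  funext j
  rcases eq_or_ne j k with rfl | h1
  · apply Fin.ext
    rw [nextNode_apply_self, prevNode_apply_of_ne hkl.symm, prevNode_apply_of_ne hkl.symm,
      nextNode_apply_self]
  rcases eq_or_ne j l with rfl | h2
  · apply Fin.ext
    rw [nextNode_apply_of_ne h1, prevNode_apply_self, prevNode_apply_self, nextNode_apply_of_ne h1]
  · rw [nextNode_apply_of_ne h1, prevNode_apply_of_ne h2, prevNode_apply_of_ne h2,
      nextNode_apply_of_ne h1]

/-- The second difference in direction `k` of a function in `H_h` at a node that is internal in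
all directions but `l ≠ k`. -/
theorem negLam_apply_of_ne (h : Fin n → ℝ) {k l : Fin n} (hkl : l ≠ k) (w : Hh N) {i j : Node N}
    (hi : Interior i) (hj : ∀ q, q ≠ l → j q = i q) :
    (negLam h k w : MeshFun N) j =
      -(((w : MeshFun N) (nextNode k j) - 2 * (w : MeshFun N) j + (w : MeshFun N) (prevNode k j))
        / h k ^ 2) := by
  rw [negLam_apply]
  split_ifs with hint
  · rfl
  · have hl : ¬ (0 < (j l : ℕ) ∧ (j l : ℕ) < N l) := by
      intro hc
      apply hint
      intro q
      by_cases hq : q = l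
      · subst hq; exact hc
      · rw [hj q hq]; exact hi q
    rw [w.2 j hint, w.2 (nextNode k j) (fun hc => hl (by
        have := hc l; rwa [nextNode_apply_of_ne hkl] at this)),
      w.2 (prevNode k j) (fun hc => hl (by
        have := hc l; rwa [prevNode_apply_of_ne hkl] at this))]
    simp

/-- Differences in distinct directions commute away from the boundary. If a neighbour in direction
`l` lies on the boundary, its own neighbours in direction `k` lie on the same face, so the
difference formula gives the correct value 0 there. -/
theorem negLam_comm (h : Fin n → ℝ) (k l : Fin n) (w : Hh N) :
    negLam h k (negLam h l w) = negLam h l (negLam h k w) := by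
  by_cases hkl : l = k
  · rw [hkl]
  apply Hh_ext
  intro i hi
  have hkl' : k ≠ l := fun h => hkl h.symm
  rw [negLam_apply h k (negLam h l w), if_pos hi, negLam_apply h l (negLam h k w), if_pos hi,
    negLam_apply_of_ne h hkl' w hi (fun q hq => nextNode_apply_of_ne hq i),
    negLam_apply_of_ne h hkl' w hi (fun q hq => prevNode_apply_of_ne hq i),
    negLam_apply_of_ne h hkl w hi (fun q hq => nextNode_apply_of_ne hq i),
    negLam_apply_of_ne h hkl w hi (fun q hq => prevNode_apply_of_ne hq i),
    negLam_apply h k w, if_pos hi, negLam_apply h l w, if_pos hi,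
    nextNode_comm hkl, prevNode_comm hkl, nextNode_prevNode_comm hkl,
    ← nextNode_prevNode_comm hkl']
  ring

theorem numerovEquiv_apply {h : Fin n → ℝ} {k : Fin n} (hk : h k ≠ 0) (w : Hh N) :
    numerovEquiv k w = w - (h k ^ 2 / 12) • negLam h k w := by
  apply Hh_ext
  intro i hi
  have e1 : (numerovEquiv k w : MeshFun N) i = (inHh (numerov k) w : MeshFun N) i := rfl
  have e2 : ((w - (h k ^ 2 / 12) • negLam h k w : Hh N) : MeshFun N) i
      = (w : MeshFun N) i - (h k ^ 2 / 12) * (negLam h k w : MeshFun N) i := rfl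
  have e3 : numerov k (w : MeshFun N) i
    = ((w : MeshFun N) (prevNode k i) + 10 * (w : MeshFun N) i + (w : MeshFun N) (nextNode k i))
      / 12 := rfl
  rw [e1, e2, inHh_apply_of_interior _ _ hi, negLam_apply, if_pos hi, e3]
  field_simp
  ring

/-! ### The inner product of `H_h` -/

/-- `(·,·)_h` as a bilinear form on `H_h`. -/
def ipForm (h : Fin n → ℝ) : LinearMap.BilinForm ℝ (Hh N) :=
  LinearMap.mk₂ ℝ (fun v w => ip h (v : MeshFun N) (w : MeshFun N))
    (fun u v w => by
      simp only [ip, Submodule.coe_add, Pi.add_apply, add_mul, Finset.sum_add_distrib, mul_add])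
    (fun c v w => by
      simp only [ip, Submodule.coe_smul, Pi.smul_apply, smul_eq_mul, mul_assoc, ← Finset.mul_sum]
      ring)
    (fun u v w => by
      simp only [ip, Submodule.coe_add, Pi.add_apply, mul_add, Finset.sum_add_distrib])
    (fun c v w => by
      simp only [ip, Submodule.coe_smul, Pi.smul_apply, smul_eq_mul, mul_left_comm _ c,
        ← Finset.mul_sum])

theorem ipForm_apply (h : Fin n → ℝ) (v w : Hh N) :
    ipForm h v w = ip h (v : MeshFun N) (w : MeshFun N) := rfl

theorem ip_self (h : Fin n → ℝ) (w : MeshFun N) :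
    ip h w w = (∏ k, h k) * ∑ i with Interior i, w i ^ 2 := by
  simp only [ip, sq]

variable {h : Fin n → ℝ}

theorem ip_comm (v w : MeshFun N) : ip h v w = ip h w v := by
  simp only [ip, mul_comm]

theorem ip_congr {v v' w w' : MeshFun N} (hv : ∀ i, Interior i → v i = v' i)
    (hw : ∀ i, Interior i → w i = w' i) : ip h v w = ip h v' w' := by
  unfold ip
  congr 1
  refine Finset.sum_congr rfl fun i hi => ?_
  rw [hv i (Finset.mem_filter.mp hi).2, hw i (Finset.mem_filter.mp hi).2]

theorem ip_self_nonneg (hh : ∀ k, 0 < h k) (w : MeshFun N) : 0 ≤ ip h w w := by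
  rw [ip_self]
  exact mul_nonneg (Finset.prod_nonneg fun k _ => (hh k).le)
    (Finset.sum_nonneg fun i _ => sq_nonneg _)

theorem eq_zero_of_ip_self (hh : ∀ k, 0 < h k) {w : Hh N}
    (h0 : ip h (w : MeshFun N) (w : MeshFun N) = 0) : w = 0 := by
  rw [ip_self] at h0
  have h1 := (mul_eq_zero.mp h0).resolve_left (Finset.prod_pos fun k _ => hh k).ne'
  rw [Finset.sum_eq_zero_iff_of_nonneg fun i _ => sq_nonneg _] at h1
  apply Hh_ext
  intro i hi
  simpa using h1 i (by simpa using hi)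

theorem ip_negLam (k : Fin n) (v w : Hh N) :
    ip h (negLam h k v : MeshFun N) (w : MeshFun N) = (∏ k, h k) * (1 / h k ^ 2 *
      ∑ i with (i k : ℕ) < N k, ((v : MeshFun N) (nextNode k i) - (v : MeshFun N) i)
          * ((w : MeshFun N) (nextNode k i) - (w : MeshFun N) i)) := by
  rw [← sum_negLam_mul]; rfl

theorem ip_negLam_comm (k : Fin n) (v w : Hh N) :
    ip h (negLam h k v : MeshFun N) (w : MeshFun N)
      = ip h (v : MeshFun N) (negLam h k w : MeshFun N) := by
  rw [ip_comm (v : MeshFun N), ip_negLam, ip_negLam]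
  simp only [mul_comm]

theorem ip_negLam_self_nonneg (hh : ∀ k, 0 < h k) (k : Fin n) (w : Hh N) :
    0 ≤ ip h (negLam h k w : MeshFun N) (w : MeshFun N) := by
  rw [ip_negLam]
  exact mul_nonneg (Finset.prod_nonneg fun k _ => (hh k).le)
    (mul_nonneg (by positivity) (Finset.sum_nonneg fun i _ => mul_self_nonneg _))

/-- In other words -Λ_k ≤ 4/h_k², which is the bound κA ≤ 1/3 required for s_kN. -/
theorem ip_negLam_self_le (hh : ∀ k, 0 < h k) (k : Fin n) (w : Hh N) :
    h k ^ 2 / 12 * ip h (negLam h k w : MeshFun N) (w : MeshFun N)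
      ≤ 1 / 3 * ip h (w : MeshFun N) (w : MeshFun N) := by
  have h1 := sum_edge_diff_sq_le k w
  have h2 := mul_le_mul_of_nonneg_left h1 (Finset.prod_nonneg fun k _ => (hh k).le : 0 ≤ ∏ k, h k)
  rw [ip_negLam, ip_self]
  simp only [← sq]
  have h3 : h k ≠ 0 := (hh k).ne'
  have e1 : ∀ p s : ℝ, h k ^ 2 / 12 * (p * (1 / h k ^ 2 * s)) = 1 / 12 * (p * s) := by
    intro p s; field_simp
  rw [e1]
  linarith

/-- As N_k h_k = X_k, the Poincaré constant does not depend on the mesh. -/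
theorem ip_self_le_ip_negLam (hh : ∀ k, 0 < h k) (k : Fin n) (w : Hh N) :
    ip h (w : MeshFun N) (w : MeshFun N)
      ≤ 4 * (N k * h k) ^ 2 * ip h (negLam h k w : MeshFun N) (w : MeshFun N) := by
  have h1 := sum_sq_le_sum_edge_diff_sq k w
  have h2 := mul_le_mul_of_nonneg_left h1 (Finset.prod_nonneg fun k _ => (hh k).le : 0 ≤ ∏ k, h k)
  rw [ip_negLam, ip_self]
  simp only [← sq]
  have h3 : h k ≠ 0 := (hh k).ne'
  have e1 : ∀ p s : ℝ, 4 * (N k * h k) ^ 2 * (p * (1 / h k ^ 2 * s)) = p * (4 * N k ^ 2 * s) := by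
    intro p s; field_simp
  rw [e1]
  exact h2

theorem Eh_apply (a : Fin n → ℝ) (w : Hh N) :
    Eh a h w = ∑ k, a k ^ 2 • (numerovEquiv k).symm (negLam h k w) := by
  simp [Eh, negLam, LinearMap.sum_apply]

/-- There are at most ∏ (N_k + 1) ≤ ∏ 2N_k nodes, so pointwise residual bounds pass to the mesh norm
with a mesh-independent constant. -/
theorem normh_le_of_abs_le (hh : ∀ k, 0 < h k) (hN : ∀ k, 1 ≤ N k) {w : MeshFun N} {c : ℝ}
    (hc : 0 ≤ c) (hw : ∀ i, Interior i → |w i| ≤ c) :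
    normh h w ≤ √(∏ k, (2 * (N k * h k))) * c := by
  have h1 : ip h w w ≤ (∏ k, (2 * (N k * h k))) * c ^ 2 := by
    rw [ip_self]
    have h2 : ∑ i with Interior i, w i ^ 2 ≤ (∏ k, (2 * (N k : ℝ))) * c ^ 2 := by
      have h3 : ∑ i with Interior i, w i ^ 2 ≤ ∑ i : Node N with Interior i, c ^ 2 :=
        Finset.sum_le_sum fun i hi => by
          rw [← sq_abs]
          exact pow_le_pow_left₀ (abs_nonneg _) (hw i (Finset.mem_filter.mp hi).2) 2
      refine h3.trans ?_
      rw [Finset.sum_const, nsmul_eq_mul]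
      refine mul_le_mul_of_nonneg_right ?_ (sq_nonneg c)
      have h4 : (Finset.filter (fun i : Node N => Interior i) Finset.univ).card
          ≤ ∏ k, (N k + 1) := by
        refine (Finset.card_filter_le _ _).trans (le_of_eq ?_)
        rw [Finset.card_univ, Fintype.card_pi]
        simp
      calc ((Finset.filter (fun i : Node N => Interior i) Finset.univ).card : ℝ)
          ≤ ((∏ k, (N k + 1) : ℕ) : ℝ) := by exact_mod_cast h4
        _ = ∏ k, ((N k : ℝ) + 1) := by push_cast; rfl
        _ ≤ ∏ k, (2 * (N k : ℝ)) := by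
          refine Finset.prod_le_prod (fun k _ => by positivity) fun k _ => ?_
          have : (1 : ℝ) ≤ N k := by exact_mod_cast hN k
          linarith
    have h5 := mul_le_mul_of_nonneg_left h2
      (Finset.prod_nonneg fun k _ => (hh k).le : 0 ≤ ∏ k, h k)
    have h6 : ∏ k, (2 * (N k * h k)) = (∏ k, h k) * ∏ k, (2 * (N k : ℝ)) := by
      rw [← Finset.prod_mul_distrib]
      exact Finset.prod_congr rfl fun k _ => by ring
    rw [h6]
    linarith
  have h7 : √((∏ k, (2 * (N k * h k))) * c ^ 2) = √(∏ k, (2 * (N k * h k))) * c := by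
    rw [Real.sqrt_mul' _ (sq_nonneg _), Real.sqrt_sq hc]
  rw [← h7]
  exact Real.sqrt_le_sqrt h1

end Mesh

/-! ### Taylor expansions on an interval -/

section Jets

/-- `d 0` is infinitely differentiable on `s` with the successive derivatives `d 1, d 2, …`. -/
def IsJet (d : ℕ → ℝ → ℝ) (s : Set ℝ) : Prop :=
  ∀ j, ∀ x ∈ s, HasDerivWithinAt (d j) (d (j + 1) x) s x

theorem IsJet.shift {d : ℕ → ℝ → ℝ} {s : Set ℝ} (hd : IsJet d s) (m : ℕ) :
    IsJet (fun j => d (j + m)) s := fun j x hx => by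
  have := hd (j + m) x hx
  rwa [show j + m + 1 = j + 1 + m by ring] at this

theorem IsJet.sub {d e : ℕ → ℝ → ℝ} {s : Set ℝ} (hd : IsJet d s) (he : IsJet e s) :
    IsJet (fun j x => d j x - e j x) s := fun j x hx => (hd j x hx).sub (he j x hx)

theorem IsJet.abs_sub_le {d : ℕ → ℝ → ℝ} {s : Set ℝ} (hd : IsJet d s) (hs : Convex ℝ s) {B : ℝ}
    {m : ℕ} (hB : ∀ y ∈ s, |d (m + 1) y| ≤ B) {x y : ℝ} (hx : x ∈ s) (hy : y ∈ s) :
    |d m y - d m x| ≤ B * |y - x| := by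
  simpa [Real.norm_eq_abs] using hs.norm_image_sub_le_of_norm_hasDerivWithin_le (hd m) hB hx hy

/-- The increment over a time step is again a jet. Every residual is linear in the function, so its
time increment is the residual of the increment and gains a factor τ. -/
theorem IsJet.translate {d : ℕ → ℝ → ℝ} {T τ : ℝ} (hd : IsJet d (Icc 0 T)) (hτ : 0 ≤ τ) :
    IsJet (fun j x => d j (x + τ) - d j x) (Icc 0 (T - τ)) := by
  intro j x hx
  have h1 : MapsTo (fun y => y + τ) (Icc 0 (T - τ)) (Icc 0 T) := fun y hy =>
    ⟨by linarith [hy.1], by linarith [hy.2]⟩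
  have h2 := (hd j (x + τ) (h1 hx)).scomp x ((hasDerivWithinAt_id x (Icc 0 (T - τ))).add_const τ) h1
  have h3 := (hd j x ⟨hx.1, by linarith [hx.2]⟩).mono (Icc_subset_Icc le_rfl (by linarith) :
    Icc 0 (T - τ) ⊆ Icc 0 T)
  have h4 := h2.sub h3
  simp only [one_smul] at h4
  exact h4

/-- Induction on the order: the derivative of the remainder is the remainder of the shifted jet, and
the mean value inequality on the segment gains a factor |y - x|. The factorial in the remainder is
given up. -/
theorem IsJet.taylor {m : ℕ} : ∀ {d : ℕ → ℝ → ℝ} {s : Set ℝ}, IsJet d s → Convex ℝ s → ∀ {B : ℝ},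
    (∀ y ∈ s, |d m y| ≤ B) → ∀ {x y : ℝ}, x ∈ s → y ∈ s →
    |d 0 y - ∑ j ∈ Finset.range m, d j x * (y - x) ^ j / (j.factorial : ℝ)| ≤ B * |y - x| ^ m := by
  induction m with
  | zero => intro d s _ _ B hB x y _ hy; simpa using hB y hy
  | succ m ih =>
    intro d s hd hs B hB x y hx hy
    have hB0 : 0 ≤ B := (abs_nonneg _).trans (hB x hx)
    set g : ℝ → ℝ := fun z =>
      d 0 z - ∑ j ∈ Finset.range (m + 1), d j x * (z - x) ^ j / (j.factorial : ℝ) with hg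
    set g' : ℝ → ℝ := fun z =>
      d 1 z - ∑ j ∈ Finset.range m, d (j + 1) x * (z - x) ^ j / (j.factorial : ℝ) with hg'
    have hsub : segment ℝ x y ⊆ s := hs.segment_subset hx hy
    have hder : ∀ z ∈ segment ℝ x y, HasDerivWithinAt g (g' z) (segment ℝ x y) z := by
      intro z hz
      have h1 : HasDerivWithinAt (fun z => ∑ j ∈ Finset.range (m + 1),
          d j x * (z - x) ^ j / (j.factorial : ℝ))
          (∑ j ∈ Finset.range (m + 1), d j x * (j * (z - x) ^ (j - 1)) / (j.factorial : ℝ))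
          (segment ℝ x y) z := by
        apply HasDerivWithinAt.fun_sum
        intro j _
        have h2 : HasDerivAt (fun z => (z - x) ^ j) ((j : ℝ) * (z - x) ^ (j - 1)) z := by
          simpa using ((hasDerivAt_id z).sub_const x).fun_pow j
        exact ((h2.const_mul (d j x)).div_const _).hasDerivWithinAt
      have h3 := (((hd 0) z (hsub hz)).mono hsub).sub h1
      have e1 : ∑ j ∈ Finset.range (m + 1), d j x * (j * (z - x) ^ (j - 1)) / (j.factorial : ℝ)
          = ∑ j ∈ Finset.range m, d (j + 1) x * (z - x) ^ j / (j.factorial : ℝ) := by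
        rw [Finset.sum_range_succ' _ m]
        simp only [Nat.cast_zero, zero_mul, mul_zero, zero_div, add_zero]
        refine Finset.sum_congr rfl fun j _ => ?_
        rw [Nat.factorial_succ]
        have : (j.factorial : ℝ) ≠ 0 := by exact_mod_cast j.factorial_ne_zero
        have : (j : ℝ) + 1 ≠ 0 := by positivity
        push_cast
        field_simp
      rw [e1] at h3
      exact h3
    have hbd : ∀ z ∈ segment ℝ x y, ‖g' z‖ ≤ B * |y - x| ^ m := by
      intro z hz
      have h1 := ih (hd.shift 1) hs hB hx (hsub hz)
      have h2 : |z - x| ≤ |y - x| := by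
        rw [segment_eq_uIcc] at hz
        exact abs_sub_left_of_mem_uIcc hz
      exact h1.trans (mul_le_mul_of_nonneg_left (pow_le_pow_left₀ (abs_nonneg _) h2 m) hB0)
    have h := (convex_segment x y).norm_image_sub_le_of_norm_hasDerivWithin_le hder hbd
      (left_mem_segment ℝ x y) (right_mem_segment ℝ x y)
    have hgx : g x = 0 := by
      simp only [hg]
      rw [Finset.sum_range_succ' _ m]
      simp
    rw [hgx, sub_zero, Real.norm_eq_abs, Real.norm_eq_abs] at h
    rw [pow_succ, ← mul_assoc]
    exact h

theorem IsJet.second_difference_le {d : ℕ → ℝ → ℝ} {s : Set ℝ} (hd : IsJet d s)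
    (hs : Convex ℝ s) {B x η : ℝ} (hB : ∀ y ∈ s, |d 4 y| ≤ B) (hη : 0 < η) (hx : x ∈ s)
    (hp : x + η ∈ s) (hm : x - η ∈ s) :
    |(d 0 (x + η) - 2 * d 0 x + d 0 (x - η)) / η ^ 2 - d 2 x| ≤ 2 * B * η ^ 2 := by
  have h1 := hd.taylor hs hB hx hp
  have h2 := hd.taylor hs hB hx hm
  simp only [add_sub_cancel_left, sub_sub_cancel_left, abs_neg, abs_of_pos hη,
    Finset.sum_range_succ, Finset.sum_range_zero, Nat.factorial] at h1 h2
  norm_num at h1 h2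
  have e : (d 0 (x + η) - 2 * d 0 x + d 0 (x - η)) / η ^ 2 - d 2 x
      = ((d 0 (x + η) - 2 * d 0 x + d 0 (x - η)) - d 2 x * η ^ 2) / η ^ 2 := by
    field_simp
  rw [e, abs_div, abs_of_pos (by positivity : 0 < η ^ 2), div_le_iff₀ (by positivity)]
  rw [abs_le] at h1 h2 ⊢
  constructor <;> nlinarith [h1.1, h1.2, h2.1, h2.2]

/-- Both expressions equal d₂ + η²d₄/12 up to O(η⁴); odd terms cancel by symmetry. Hence the
function is expanded to order 6 and its second derivative to order 4. -/
theorem IsJet.numerov_residual_le {d : ℕ → ℝ → ℝ} {s : Set ℝ} (hd : IsJet d s)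
    (hs : Convex ℝ s) {B x η : ℝ} (hB : ∀ y ∈ s, |d 6 y| ≤ B) (hη : 0 < η) (hx : x ∈ s)
    (hp : x + η ∈ s) (hm : x - η ∈ s) :
    |(d 2 (x - η) + 10 * d 2 x + d 2 (x + η)) / 12
      - (d 0 (x + η) - 2 * d 0 x + d 0 (x - η)) / η ^ 2| ≤ 3 * B * η ^ 4 := by
  have hB0 : 0 ≤ B := (abs_nonneg _).trans (hB x hx)
  have h1 := hd.taylor hs hB hx hp
  have h2 := hd.taylor hs hB hx hm
  have h3 := (hd.shift 2).taylor (m := 4) hs hB hx hp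
  have h4 := (hd.shift 2).taylor (m := 4) hs hB hx hm
  simp only [add_sub_cancel_left, sub_sub_cancel_left, abs_neg, abs_of_pos hη,
    Finset.sum_range_succ, Finset.sum_range_zero, Nat.factorial] at h1 h2 h3 h4
  norm_num at h1 h2 h3 h4
  have e : (d 2 (x - η) + 10 * d 2 x + d 2 (x + η)) / 12
      - (d 0 (x + η) - 2 * d 0 x + d 0 (x - η)) / η ^ 2
      = ((d 2 (x - η) + 10 * d 2 x + d 2 (x + η)) / 12 - (d 2 x + d 4 x * η ^ 2 / 12))
        - ((d 0 (x + η) - 2 * d 0 x + d 0 (x - η)) - (d 2 x * η ^ 2 + d 4 x * η ^ 4 / 12))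
          / η ^ 2 := by
    field_simp
    ring
  have h5 : |(d 2 (x - η) + 10 * d 2 x + d 2 (x + η)) / 12 - (d 2 x + d 4 x * η ^ 2 / 12)|
      ≤ B * η ^ 4 := by
    have : 0 ≤ B * η ^ 4 := by positivity
    rw [abs_le] at h3 h4 ⊢
    constructor <;> linarith [h3.1, h3.2, h4.1, h4.2]
  have h6 : |((d 0 (x + η) - 2 * d 0 x + d 0 (x - η)) - (d 2 x * η ^ 2 + d 4 x * η ^ 4 / 12))
          / η ^ 2| ≤ 2 * B * η ^ 4 := by
    rw [abs_div, abs_of_pos (by positivity : 0 < η ^ 2), div_le_iff₀ (by positivity)]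
    rw [abs_le] at h1 h2 ⊢
    constructor <;> linarith [h1.1, h1.2, h2.1, h2.2]
  rw [e]
  refine (abs_sub _ _).trans ?_
  linarith

theorem IsJet.iteratedDerivWithin_two {d : ℕ → ℝ → ℝ} {T : ℝ} (hT : 0 < T)
    (hd : IsJet d (Icc 0 T)) {f : ℝ → ℝ} (hf : ∀ y ∈ Icc 0 T, f y = d 0 y) {x : ℝ}
    (hx : x ∈ Icc 0 T) : iteratedDerivWithin 2 f (Icc 0 T) x = d 2 x := by
  have hu : UniqueDiffOn ℝ (Icc 0 T) := uniqueDiffOn_Icc hT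
  rw [iteratedDerivWithin_congr hf hx, iteratedDerivWithin_succ, iteratedDerivWithin_one]
  have h1 : ∀ y ∈ Icc 0 T, derivWithin (d 0) (Icc 0 T) y = d 1 y := fun y hy =>
    (hd 0 y hy).derivWithin (hu y hy)
  rw [derivWithin_congr h1 (h1 x hx)]
  exact (hd 1 x hx).derivWithin (hu x hx)

end Jets

/-! ### Smooth functions on the closed space-time box -/

section Cylinder

variable {n : ℕ}

/-- `Ω̄ × [0,T]`. -/
def cylinder (X : Fin n → ℝ) (T : ℝ) : Set ((Fin n → ℝ) × ℝ) := closedBox X ×ˢ Icc 0 T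

/-- The derivative of a function on `Ω̄ × [0,T]` in the direction `e`. -/
def dirDeriv (X : Fin n → ℝ) (T : ℝ) (e : (Fin n → ℝ) × ℝ) (F : (Fin n → ℝ) × ℝ → ℝ) :
    (Fin n → ℝ) × ℝ → ℝ :=
  fun p => fderivWithin ℝ F (cylinder X T) p e

/-- `∂ₖ` on `Ω̄ × [0,T]`. -/
def dx (X : Fin n → ℝ) (T : ℝ) (k : Fin n) : ((Fin n → ℝ) × ℝ → ℝ) → (Fin n → ℝ) × ℝ → ℝ :=
  dirDeriv X T (Pi.single k 1, 0)

/-- `∂ₜ` on `Ω̄ × [0,T]`. -/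
def dt (X : Fin n → ℝ) (T : ℝ) : ((Fin n → ℝ) × ℝ → ℝ) → (Fin n → ℝ) × ℝ → ℝ :=
  dirDeriv X T (0, 1)

variable {X : Fin n → ℝ} {T : ℝ}

theorem closedBox_eq_pi (X : Fin n → ℝ) : closedBox X = Set.univ.pi fun k => Icc 0 (X k) := by
  ext x
  simp only [closedBox, mem_ofPred_eq, Set.mem_pi, mem_univ, true_implies]

theorem convex_cylinder : Convex ℝ (cylinder X T) := by
  rw [cylinder, closedBox_eq_pi]
  exact (convex_pi fun k _ => convex_Icc _ _).prod (convex_Icc _ _)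

theorem isCompact_cylinder : IsCompact (cylinder X T) := by
  rw [cylinder, closedBox_eq_pi]
  exact (isCompact_univ_pi fun k => isCompact_Icc).prod isCompact_Icc

theorem interior_cylinder_nonempty (hX : ∀ k, 0 < X k) (hT : 0 < T) :
    (interior (cylinder X T)).Nonempty := by
  rw [cylinder, closedBox_eq_pi, interior_prod_eq, interior_pi_set Set.finite_univ, interior_Icc]
  exact ⟨(fun k => X k / 2, T / 2), fun k _ => by
    change X k / 2 ∈ interior (Icc 0 (X k))
    rw [interior_Icc]; exact ⟨by linarith [hX k], by linarith [hX k]⟩,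
    ⟨by simp; linarith, by simp; linarith⟩⟩

theorem uniqueDiffOn_cylinder (hX : ∀ k, 0 < X k) (hT : 0 < T) :
    UniqueDiffOn ℝ (cylinder X T) :=
  uniqueDiffOn_convex convex_cylinder (interior_cylinder_nonempty hX hT)

theorem contDiffOn_dirDeriv (hX : ∀ k, 0 < X k) (hT : 0 < T) {F : (Fin n → ℝ) × ℝ → ℝ}
    (hF : ContDiffOn ℝ ∞ F (cylinder X T)) (e : (Fin n → ℝ) × ℝ) :
    ContDiffOn ℝ ∞ (dirDeriv X T e F) (cylinder X T) :=
  (hF.fderivWithin (uniqueDiffOn_cylinder hX hT) (by simp)).clm_apply contDiffOn_const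

theorem contDiffOn_iterate_dirDeriv (hX : ∀ k, 0 < X k) (hT : 0 < T) {F : (Fin n → ℝ) × ℝ → ℝ}
    (hF : ContDiffOn ℝ ∞ F (cylinder X T)) (e : (Fin n → ℝ) × ℝ) (j : ℕ) :
    ContDiffOn ℝ ∞ ((dirDeriv X T e)^[j] F) (cylinder X T) := by
  induction j with
  | zero => exact hF
  | succ j ih =>
    rw [Function.iterate_succ_apply']
    exact contDiffOn_dirDeriv hX hT ih e

/-- The closed box lies in the closure of its interior, so the second derivative is symmetric up to
the boundary, edges and corners included. -/
theorem dirDeriv_comm (hX : ∀ k, 0 < X k) (hT : 0 < T) {F : (Fin n → ℝ) × ℝ → ℝ}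
    (hF : ContDiffOn ℝ ∞ F (cylinder X T)) (e e' : (Fin n → ℝ) × ℝ) :
    EqOn (dirDeriv X T e (dirDeriv X T e' F)) (dirDeriv X T e' (dirDeriv X T e F))
      (cylinder X T) := by
  intro p hp
  have hu := uniqueDiffOn_cylinder hX hT
  have hcl : p ∈ closure (interior (cylinder X T)) :=
    (convex_cylinder.closure_interior_eq_closure_of_nonempty_interior
      (interior_cylinder_nonempty hX hT)).symm ▸ subset_closure hp
  have hsymm : IsSymmSndFDerivWithinAt ℝ F (cylinder X T) p :=
    (hF p hp).isSymmSndFDerivWithinAt (by simp; exact WithTop.coe_le_coe.mpr le_top) hu hcl hp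
  have hdiff : DifferentiableWithinAt ℝ (fderivWithin ℝ F (cylinder X T)) (cylinder X T) p :=
    ((hF.fderivWithin hu (m := ∞) (by simp)).differentiableOn (by simp)) p hp
  have key : ∀ e e' : (Fin n → ℝ) × ℝ, dirDeriv X T e (dirDeriv X T e' F) p
      = fderivWithin ℝ (fderivWithin ℝ F (cylinder X T)) (cylinder X T) p e e' := by
    intro e e'
    unfold dirDeriv
    have := (hdiff.hasFDerivWithinAt.clm_apply
      (hasFDerivWithinAt_const e' p (cylinder X T))).fderivWithin (hu p hp)
    rw [this]
    simp
  rw [key, key, hsymm e e']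

theorem dirDeriv_congr {F G : (Fin n → ℝ) × ℝ → ℝ} (h : EqOn F G (cylinder X T))
    (e : (Fin n → ℝ) × ℝ) : EqOn (dirDeriv X T e F) (dirDeriv X T e G) (cylinder X T) := by
  intro p hp
  unfold dirDeriv
  rw [fderivWithin_congr h (h hp)]

theorem dirDeriv_sq_comm (hX : ∀ k, 0 < X k) (hT : 0 < T) {F : (Fin n → ℝ) × ℝ → ℝ}
    (hF : ContDiffOn ℝ ∞ F (cylinder X T)) (e e' : (Fin n → ℝ) × ℝ) :
    EqOn (dirDeriv X T e (dirDeriv X T e' (dirDeriv X T e' F)))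
      (dirDeriv X T e' (dirDeriv X T e' (dirDeriv X T e F))) (cylinder X T) :=
  (dirDeriv_comm hX hT (contDiffOn_dirDeriv hX hT hF e') e e').trans
    (dirDeriv_congr (dirDeriv_comm hX hT hF e e') e')

theorem dirDeriv_sq_sq_comm (hX : ∀ k, 0 < X k) (hT : 0 < T) {F : (Fin n → ℝ) × ℝ → ℝ}
    (hF : ContDiffOn ℝ ∞ F (cylinder X T)) (e e' : (Fin n → ℝ) × ℝ) :
    EqOn (dirDeriv X T e (dirDeriv X T e (dirDeriv X T e' (dirDeriv X T e' F))))
      (dirDeriv X T e' (dirDeriv X T e' (dirDeriv X T e (dirDeriv X T e F)))) (cylinder X T) :=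
  (dirDeriv_congr (dirDeriv_sq_comm hX hT hF e e') e).trans
    (dirDeriv_sq_comm hX hT (contDiffOn_dirDeriv hX hT hF e) e e')

theorem hasDerivWithinAt_comp_dirDeriv {F : (Fin n → ℝ) × ℝ → ℝ}
    (hF : ContDiffOn ℝ ∞ F (cylinder X T)) {γ : ℝ → (Fin n → ℝ) × ℝ} {e : (Fin n → ℝ) × ℝ}
    {s : Set ℝ} (hγ : MapsTo γ s (cylinder X T)) {y : ℝ} (hy : y ∈ s)
    (hγ' : HasDerivWithinAt γ e s y) :
    HasDerivWithinAt (fun y => F (γ y)) (dirDeriv X T e F (γ y)) s y :=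
  ((hF.differentiableOn (by simp)) (γ y) (hγ hy)).hasFDerivWithinAt.comp_hasDerivWithinAt y hγ' hγ

theorem isJet_comp_dirDeriv (hX : ∀ k, 0 < X k) (hT : 0 < T) {F : (Fin n → ℝ) × ℝ → ℝ}
    (hF : ContDiffOn ℝ ∞ F (cylinder X T)) {γ : ℝ → (Fin n → ℝ) × ℝ} {e : (Fin n → ℝ) × ℝ}
    {s : Set ℝ} (hγ : MapsTo γ s (cylinder X T)) (hγ' : ∀ y ∈ s, HasDerivWithinAt γ e s y) :
    IsJet (fun j y => (dirDeriv X T e)^[j] F (γ y)) s := by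
  intro j y hy
  change HasDerivWithinAt _ ((dirDeriv X T e)^[j + 1] F (γ y)) s y
  rw [Function.iterate_succ_apply']
  exact hasDerivWithinAt_comp_dirDeriv (contDiffOn_iterate_dirDeriv hX hT hF e j) hγ hy (hγ' y hy)

theorem update_mem_closedBox {x : Fin n → ℝ} (hx : x ∈ closedBox X) {k : Fin n} {s : ℝ}
    (hs : s ∈ Icc 0 (X k)) : Function.update x k s ∈ closedBox X := by
  intro l
  rcases eq_or_ne l k with rfl | h
  · simpa using hs
  · simpa [h] using hx l

theorem isJet_time (hX : ∀ k, 0 < X k) (hT : 0 < T) {F : (Fin n → ℝ) × ℝ → ℝ}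
    (hF : ContDiffOn ℝ ∞ F (cylinder X T)) {x : Fin n → ℝ} (hx : x ∈ closedBox X) :
    IsJet (fun j t => (dt X T)^[j] F (x, t)) (Icc 0 T) :=
  isJet_comp_dirDeriv hX hT hF (γ := fun t => (x, t)) (fun _ ht => ⟨hx, ht⟩) fun t _ =>
    (hasDerivWithinAt_const t (Icc 0 T) x).prodMk (hasDerivWithinAt_id t (Icc 0 T))

theorem isJet_space (hX : ∀ k, 0 < X k) (hT : 0 < T) {F : (Fin n → ℝ) × ℝ → ℝ}
    (hF : ContDiffOn ℝ ∞ F (cylinder X T)) (k : Fin n) {x : Fin n → ℝ} (hx : x ∈ closedBox X)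
    {t : ℝ} (ht : t ∈ Icc 0 T) :
    IsJet (fun j s => (dx X T k)^[j] F (Function.update x k s, t)) (Icc 0 (X k)) :=
  isJet_comp_dirDeriv hX hT hF (γ := fun s => (Function.update x k s, t))
    (fun _ hs => ⟨update_mem_closedBox hx hs, ht⟩) fun s _ =>
    ((hasDerivAt_update x k s).hasDerivWithinAt).prodMk (hasDerivWithinAt_const s _ t)

theorem exists_abs_le (hX : ∀ k, 0 < X k) (hT : 0 < T) {ι : Type*} [Fintype ι]
    {F : ι → (Fin n → ℝ) × ℝ → ℝ} (hF : ∀ i, ContDiffOn ℝ ∞ (F i) (cylinder X T)) :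
    ∃ B, 0 ≤ B ∧ ∀ i, ∀ p ∈ cylinder X T, |F i p| ≤ B := by
  have h1 : ∀ i, ∃ B, ∀ p ∈ cylinder X T, |F i p| ≤ B := fun i => by
    simpa [Real.norm_eq_abs] using isCompact_cylinder.exists_bound_of_continuousOn (hF i).continuousOn
  choose B hB using h1
  have hp : ((0 : Fin n → ℝ), (0 : ℝ)) ∈ cylinder X T :=
    ⟨fun k => ⟨le_rfl, (hX k).le⟩, ⟨le_rfl, hT.le⟩⟩
  have hB0 : ∀ i, 0 ≤ B i := fun i => (abs_nonneg _).trans (hB i _ hp)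
  exact ⟨∑ i, B i, Finset.sum_nonneg fun i _ => hB0 i, fun i p hp =>
    (hB i p hp).trans (Finset.single_le_sum (fun i _ => hB0 i) (Finset.mem_univ i))⟩

end Cylinder

/-! ### Difference quotients of smooth functions and their time increments -/

section Consistency

variable {n : ℕ} {X : Fin n → ℝ} {T : ℝ}

/-- The second difference quotient in time. -/
def diffT (τ : ℝ) (F : (Fin n → ℝ) × ℝ → ℝ) (x : Fin n → ℝ) (t : ℝ) : ℝ :=
  (F (x, t + τ) - 2 * F (x, t) + F (x, t - τ)) / τ ^ 2

/-- The second difference quotient in direction `k`. -/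
def diffX (η : ℝ) (k : Fin n) (F : (Fin n → ℝ) × ℝ → ℝ) (x : Fin n → ℝ) (t : ℝ) : ℝ :=
  (F (Function.update x k (x k + η), t) - 2 * F (x, t) + F (Function.update x k (x k - η), t))
    / η ^ 2

/-- The residual of the Numerov formula in time; `G` is to be `∂ₜ²F`. -/
def resT (τ : ℝ) (F G : (Fin n → ℝ) × ℝ → ℝ) (x : Fin n → ℝ) (t : ℝ) : ℝ :=
  (G (x, t - τ) + 10 * G (x, t) + G (x, t + τ)) / 12 - diffT τ F x t

/-- The residual of the Numerov formula in direction `k`; `G` is to be `∂ₖ²F`. -/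
def resX (η : ℝ) (k : Fin n) (F G : (Fin n → ℝ) × ℝ → ℝ) (x : Fin n → ℝ) (t : ℝ) : ℝ :=
  (G (Function.update x k (x k - η), t) + 10 * G (x, t) + G (Function.update x k (x k + η), t)) / 12
    - diffX η k F x t

variable {F : (Fin n → ℝ) × ℝ → ℝ} {x : Fin n → ℝ} {t τ η B : ℝ} {k : Fin n}

theorem abs_sub_le_of_dt (hX : ∀ k, 0 < X k) (hT : 0 < T)
    (hF : ContDiffOn ℝ ∞ F (cylinder X T)) (hB : ∀ p ∈ cylinder X T, |dt X T F p| ≤ B)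
    (hx : x ∈ closedBox X) (hτ : 0 < τ) (ht : t ∈ Icc 0 T) (ht' : t + τ ∈ Icc 0 T) :
    |F (x, t + τ) - F (x, t)| ≤ τ * B := by
  have h := (isJet_time hX hT hF hx).abs_sub_le (convex_Icc 0 T) (B := B) (m := 0)
    (fun s hs => hB (x, s) ⟨hx, hs⟩) ht ht'
  rw [add_sub_cancel_left, abs_of_pos hτ] at h
  rw [mul_comm]
  exact h

theorem isJet_time_diff (hX : ∀ k, 0 < X k) (hT : 0 < T) (hF : ContDiffOn ℝ ∞ F (cylinder X T))
    {m : ℕ} (hB : ∀ p ∈ cylinder X T, |(dt X T)^[m + 1] F p| ≤ B) (hx : x ∈ closedBox X)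
    (hτ : 0 < τ) :
    IsJet (fun j s => (dt X T)^[j] F (x, s + τ) - (dt X T)^[j] F (x, s)) (Icc 0 (T - τ)) ∧
    ∀ s ∈ Icc 0 (T - τ), |(dt X T)^[m] F (x, s + τ) - (dt X T)^[m] F (x, s)| ≤ τ * B := by
  refine ⟨(isJet_time hX hT hF hx).translate hτ.le, fun s hs => ?_⟩
  refine abs_sub_le_of_dt hX hT (contDiffOn_iterate_dirDeriv hX hT hF _ m) ?_ hx hτ
    ⟨hs.1, by linarith [hs.2]⟩ ⟨by linarith [hs.1], by linarith [hs.2]⟩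
  intro p hp
  have := hB p hp
  rwa [Function.iterate_succ_apply'] at this

theorem isJet_space_diff (hX : ∀ k, 0 < X k) (hT : 0 < T) (hF : ContDiffOn ℝ ∞ F (cylinder X T))
    {m : ℕ} (hB : ∀ p ∈ cylinder X T, |dt X T ((dx X T k)^[m] F) p| ≤ B) (hx : x ∈ closedBox X)
    (hτ : 0 < τ) (ht : t ∈ Icc 0 T) (ht' : t + τ ∈ Icc 0 T) :
    IsJet (fun j s => (dx X T k)^[j] F (Function.update x k s, t + τ)
      - (dx X T k)^[j] F (Function.update x k s, t)) (Icc 0 (X k)) ∧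
    ∀ s ∈ Icc 0 (X k), |(dx X T k)^[m] F (Function.update x k s, t + τ)
      - (dx X T k)^[m] F (Function.update x k s, t)| ≤ τ * B :=
  ⟨(isJet_space hX hT hF k hx ht').sub (isJet_space hX hT hF k hx ht), fun _ hs =>
    abs_sub_le_of_dt hX hT (contDiffOn_iterate_dirDeriv hX hT hF _ m) hB
      (update_mem_closedBox hx hs) hτ ht ht'⟩

theorem abs_resT_le (hX : ∀ k, 0 < X k) (hT : 0 < T) (hF : ContDiffOn ℝ ∞ F (cylinder X T))
    (hB : ∀ p ∈ cylinder X T, |(dt X T)^[6] F p| ≤ B) (hx : x ∈ closedBox X) (hτ : 0 < τ)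
    (hm : 0 ≤ t - τ) (hp : t + τ ≤ T) :
    |resT τ F (dt X T (dt X T F)) x t| ≤ 3 * B * τ ^ 4 :=
  (isJet_time hX hT hF hx).numerov_residual_le (convex_Icc 0 T) (fun s hs => hB (x, s) ⟨hx, hs⟩) hτ
    ⟨by linarith, by linarith⟩ ⟨by linarith, by linarith⟩ ⟨by linarith, by linarith⟩

/-- The Numerov bound applied to s ↦ F(x, s + τ) - F(x, s) on [0, T - τ], which is why three
consecutive steps must fit into [0, T]. One more time derivative supplies the factor τ. -/
theorem abs_resT_diff_le (hX : ∀ k, 0 < X k) (hT : 0 < T) (hF : ContDiffOn ℝ ∞ F (cylinder X T))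
    (hB : ∀ p ∈ cylinder X T, |(dt X T)^[7] F p| ≤ B) (hx : x ∈ closedBox X) (hτ : 0 < τ)
    (hm : 0 ≤ t - τ) (hp : t + τ + τ ≤ T) :
    |resT τ F (dt X T (dt X T F)) x (t + τ) - resT τ F (dt X T (dt X T F)) x t|
      ≤ 3 * (τ * B) * τ ^ 4 := by
  obtain ⟨h1, h2⟩ := isJet_time_diff hX hT hF hB hx hτ
  have h := h1.numerov_residual_le (convex_Icc _ _) h2 hτ (x := t)
    ⟨by linarith, by linarith⟩ ⟨by linarith, by linarith⟩ ⟨by linarith, by linarith⟩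
  refine le_trans (le_of_eq ?_) h
  simp only [resT, diffT, Function.iterate_succ, Function.iterate_zero, Function.comp_apply, id_eq,
    add_sub_cancel_right, sub_add_cancel]
  congr 1
  ring

theorem abs_diffT_sub_le (hX : ∀ k, 0 < X k) (hT : 0 < T) (hF : ContDiffOn ℝ ∞ F (cylinder X T))
    (hB : ∀ p ∈ cylinder X T, |(dt X T)^[4] F p| ≤ B) (hx : x ∈ closedBox X) (hτ : 0 < τ)
    (hm : 0 ≤ t - τ) (hp : t + τ ≤ T) :
    |diffT τ F x t - dt X T (dt X T F) (x, t)| ≤ 2 * B * τ ^ 2 :=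
  (isJet_time hX hT hF hx).second_difference_le (convex_Icc 0 T) (fun s hs => hB (x, s) ⟨hx, hs⟩) hτ
    ⟨by linarith, by linarith⟩ ⟨by linarith, by linarith⟩ ⟨by linarith, by linarith⟩

theorem abs_diffT_sub_diff_le (hX : ∀ k, 0 < X k) (hT : 0 < T)
    (hF : ContDiffOn ℝ ∞ F (cylinder X T))
    (hB : ∀ p ∈ cylinder X T, |(dt X T)^[5] F p| ≤ B) (hx : x ∈ closedBox X) (hτ : 0 < τ)
    (hm : 0 ≤ t - τ) (hp : t + τ + τ ≤ T) :
    |(diffT τ F x (t + τ) - dt X T (dt X T F) (x, t + τ))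
      - (diffT τ F x t - dt X T (dt X T F) (x, t))| ≤ 2 * (τ * B) * τ ^ 2 := by
  obtain ⟨h1, h2⟩ := isJet_time_diff hX hT hF hB hx hτ
  have h := h1.second_difference_le (convex_Icc _ _) h2 hτ (x := t)
    ⟨by linarith, by linarith⟩ ⟨by linarith, by linarith⟩ ⟨by linarith, by linarith⟩
  refine le_trans (le_of_eq ?_) h
  simp only [diffT, Function.iterate_succ, Function.iterate_zero, Function.comp_apply, id_eq,
    add_sub_cancel_right, sub_add_cancel]
  congr 1
  ring

theorem abs_resX_le (hX : ∀ k, 0 < X k) (hT : 0 < T) (hF : ContDiffOn ℝ ∞ F (cylinder X T))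
    (hB : ∀ p ∈ cylinder X T, |(dx X T k)^[6] F p| ≤ B) (hx : x ∈ closedBox X) (hη : 0 < η)
    (hm : 0 ≤ x k - η) (hp : x k + η ≤ X k) (ht : t ∈ Icc 0 T) :
    |resX η k F (dx X T k (dx X T k F)) x t| ≤ 3 * B * η ^ 4 := by
  have h := (isJet_space hX hT hF k hx ht).numerov_residual_le (convex_Icc 0 (X k))
    (fun s hs => hB (_, t) ⟨update_mem_closedBox hx hs, ht⟩) hη (x := x k)
    ⟨by linarith, by linarith⟩ ⟨by linarith, by linarith⟩ ⟨by linarith, by linarith⟩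
  simpa [resX, diffX] using h

theorem abs_resX_diff_le (hX : ∀ k, 0 < X k) (hT : 0 < T) (hF : ContDiffOn ℝ ∞ F (cylinder X T))
    (hB : ∀ p ∈ cylinder X T, |dt X T ((dx X T k)^[6] F) p| ≤ B) (hx : x ∈ closedBox X)
    (hη : 0 < η) (hm : 0 ≤ x k - η) (hp : x k + η ≤ X k) (hτ : 0 < τ) (ht : t ∈ Icc 0 T)
    (ht' : t + τ ∈ Icc 0 T) :
    |resX η k F (dx X T k (dx X T k F)) x (t + τ) - resX η k F (dx X T k (dx X T k F)) x t|
      ≤ 3 * (τ * B) * η ^ 4 := by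
  obtain ⟨h1, h2⟩ := isJet_space_diff hX hT hF hB hx hτ ht ht'
  have h := h1.numerov_residual_le (convex_Icc _ _) h2 hη (x := x k)
    ⟨by linarith, by linarith⟩ ⟨by linarith, by linarith⟩ ⟨by linarith, by linarith⟩
  refine le_trans (le_of_eq ?_) h
  simp only [resX, diffX, Function.iterate_succ, Function.iterate_zero, Function.comp_apply, id_eq,
    Function.update_eq_self]
  congr 1
  ring

theorem abs_diffX_sub_le (hX : ∀ k, 0 < X k) (hT : 0 < T) (hF : ContDiffOn ℝ ∞ F (cylinder X T))
    (hB : ∀ p ∈ cylinder X T, |(dx X T k)^[4] F p| ≤ B) (hx : x ∈ closedBox X) (hη : 0 < η)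
    (hm : 0 ≤ x k - η) (hp : x k + η ≤ X k) (ht : t ∈ Icc 0 T) :
    |diffX η k F x t - dx X T k (dx X T k F) (x, t)| ≤ 2 * B * η ^ 2 := by
  have h := (isJet_space hX hT hF k hx ht).second_difference_le (convex_Icc 0 (X k))
    (fun s hs => hB (_, t) ⟨update_mem_closedBox hx hs, ht⟩) hη (x := x k)
    ⟨by linarith, by linarith⟩ ⟨by linarith, by linarith⟩ ⟨by linarith, by linarith⟩
  simpa [diffX] using h

theorem abs_diffX_sub_diff_le (hX : ∀ k, 0 < X k) (hT : 0 < T)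
    (hF : ContDiffOn ℝ ∞ F (cylinder X T))
    (hB : ∀ p ∈ cylinder X T, |dt X T ((dx X T k)^[4] F) p| ≤ B) (hx : x ∈ closedBox X)
    (hη : 0 < η) (hm : 0 ≤ x k - η) (hp : x k + η ≤ X k) (hτ : 0 < τ) (ht : t ∈ Icc 0 T)
    (ht' : t + τ ∈ Icc 0 T) :
    |(diffX η k F x (t + τ) - dx X T k (dx X T k F) (x, t + τ))
      - (diffX η k F x t - dx X T k (dx X T k F) (x, t))| ≤ 2 * (τ * B) * η ^ 2 := by
  obtain ⟨h1, h2⟩ := isJet_space_diff hX hT hF hB hx hτ ht ht'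
  have h := h1.second_difference_le (convex_Icc _ _) h2 hη (x := x k)
    ⟨by linarith, by linarith⟩ ⟨by linarith, by linarith⟩ ⟨by linarith, by linarith⟩
  refine le_trans (le_of_eq ?_) h
  simp only [diffX, Function.iterate_succ, Function.iterate_zero, Function.comp_apply, id_eq,
    Function.update_eq_self]
  congr 1
  ring

end Consistency

/-! ### Residuals of the scheme: fourth order, and Lipschitz in time -/

section Residuals

variable {n : ℕ}

/-- `B` bounds the derivatives of `U` that occur in the residuals of the scheme. -/
structure DerivBound (X : Fin n → ℝ) (T : ℝ) (U : (Fin n → ℝ) × ℝ → ℝ) (B : ℝ) : Prop where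
  nonneg : 0 ≤ B
  dx6 : ∀ k, ∀ p ∈ cylinder X T, |(dx X T k)^[6] U p| ≤ B
  dt_dx6 : ∀ k, ∀ p ∈ cylinder X T, |dt X T ((dx X T k)^[6] U) p| ≤ B
  dt5 : ∀ p ∈ cylinder X T, |(dt X T)^[5] U p| ≤ B
  dt6 : ∀ p ∈ cylinder X T, |(dt X T)^[6] U p| ≤ B
  dt7 : ∀ p ∈ cylinder X T, |(dt X T)^[7] U p| ≤ B
  dt3_dx2 : ∀ k, ∀ p ∈ cylinder X T, |(dt X T)^[3] (dx X T k (dx X T k U)) p| ≤ B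
  dt4_dx2 : ∀ k, ∀ p ∈ cylinder X T, |(dt X T)^[4] (dx X T k (dx X T k U)) p| ≤ B
  dt5_dx2 : ∀ k, ∀ p ∈ cylinder X T, |(dt X T)^[5] (dx X T k (dx X T k U)) p| ≤ B
  dx4_dt : ∀ k, ∀ p ∈ cylinder X T, |(dx X T k)^[4] (dt X T U) p| ≤ B
  dx4_dt2 : ∀ k, ∀ p ∈ cylinder X T, |(dx X T k)^[4] (dt X T (dt X T U)) p| ≤ B
  dt_dx4_dt2 : ∀ k, ∀ p ∈ cylinder X T, |dt X T ((dx X T k)^[4] (dt X T (dt X T U))) p| ≤ B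

theorem exists_derivBound {X : Fin n → ℝ} {T : ℝ} (hX : ∀ k, 0 < X k) (hT : 0 < T)
    {U : (Fin n → ℝ) × ℝ → ℝ} (hU : ContDiffOn ℝ ∞ U (cylinder X T)) :
    ∃ B, DerivBound X T U B := by
  have hD : ∀ {F : (Fin n → ℝ) × ℝ → ℝ} (e) (j : ℕ), ContDiffOn ℝ ∞ F (cylinder X T) →
      ContDiffOn ℝ ∞ ((dirDeriv X T e)^[j] F) (cylinder X T) := fun e j hF =>
    contDiffOn_iterate_dirDeriv hX hT hF e j
  have hdx2 : ∀ k, ContDiffOn ℝ ∞ (dx X T k (dx X T k U)) (cylinder X T) := fun k => hD _ 2 hU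
  have hdt2 : ContDiffOn ℝ ∞ (dt X T (dt X T U)) (cylinder X T) := hD _ 2 hU
  obtain ⟨B₁, h₁, hB₁⟩ := exists_abs_le hX hT (ι := Fin n) (fun k => hD (Pi.single k 1, 0) 6 hU)
  obtain ⟨B₂, h₂, hB₂⟩ := exists_abs_le hX hT (ι := Fin n)
    (fun k => hD (0, 1) 1 (hD (Pi.single k 1, 0) 6 hU))
  obtain ⟨B₃, h₃, hB₃⟩ := exists_abs_le hX hT (ι := Fin 8) (fun j => hD (0, 1) j hU)
  obtain ⟨B₄, h₄, hB₄⟩ := exists_abs_le hX hT (ι := Fin n × Fin 6)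
    (fun i => hD (0, 1) i.2 (hdx2 i.1))
  obtain ⟨B₅, h₅, hB₅⟩ := exists_abs_le hX hT (ι := Fin n)
    (fun k => hD (Pi.single k 1, 0) 4 (hD (0, 1) 1 hU))
  obtain ⟨B₆, h₆, hB₆⟩ := exists_abs_le hX hT (ι := Fin n)
    (fun k => hD (Pi.single k 1, 0) 4 hdt2)
  obtain ⟨B₇, h₇, hB₇⟩ := exists_abs_le hX hT (ι := Fin n)
    (fun k => hD (0, 1) 1 (hD (Pi.single k 1, 0) 4 hdt2))
  exact ⟨B₁ + B₂ + B₃ + B₄ + B₅ + B₆ + B₇,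
    { nonneg := by positivity
      dx6 := fun k p hp => (hB₁ k p hp).trans (by linarith)
      dt_dx6 := fun k p hp => (hB₂ k p hp).trans (by linarith)
      dt5 := fun p hp => (hB₃ 5 p hp).trans (by linarith)
      dt6 := fun p hp => (hB₃ 6 p hp).trans (by linarith)
      dt7 := fun p hp => (hB₃ 7 p hp).trans (by linarith)
      dt3_dx2 := fun k p hp => (hB₄ (k, 3) p hp).trans (by linarith)
      dt4_dx2 := fun k p hp => (hB₄ (k, 4) p hp).trans (by linarith)
      dt5_dx2 := fun k p hp => (hB₄ (k, 5) p hp).trans (by linarith)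
      dx4_dt := fun k p hp => (hB₅ k p hp).trans (by linarith)
      dx4_dt2 := fun k p hp => (hB₆ k p hp).trans (by linarith)
      dt_dx4_dt2 := fun k p hp => (hB₇ k p hp).trans (by linarith) }⟩

theorem abs_sum_sq_mul_le (a : Fin n → ℝ) {c : Fin n → ℝ} {b : ℝ} (hc : ∀ k, |c k| ≤ b) :
    |∑ k, a k ^ 2 * c k| ≤ (∑ k, a k ^ 2) * b := by
  rw [Finset.sum_mul]
  refine (Finset.abs_sum_le_sum_abs _ _).trans (Finset.sum_le_sum fun k _ => ?_)
  rw [abs_mul, abs_of_nonneg (sq_nonneg (a k))]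
  exact mul_le_mul_of_nonneg_left (hc k) (sq_nonneg _)

/-- The residual of the equation of the scheme at `(x,t)`. -/
def WaveData.psiAt (P : WaveData n) (η : Fin n → ℝ) (τ : ℝ) (U : (Fin n → ℝ) × ℝ → ℝ)
    (x : Fin n → ℝ) (t : ℝ) : ℝ :=
  -(P.ρ x * resT τ U (dt P.X P.T (dt P.X P.T U)) x t)
    + τ ^ 2 / 12 * ∑ k, P.a k ^ 2 * (diffT τ (dx P.X P.T k (dx P.X P.T k U)) x t
      - diffX (η k) k (dt P.X P.T (dt P.X P.T U)) x t)

/-- The residual of the equation at the first level, with `fd` for `f_d`. -/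
def WaveData.psiStart (P : WaveData n) (η : Fin n → ℝ) (τ : ℝ) (U : (Fin n → ℝ) × ℝ → ℝ)
    (fd : ℝ) (x : Fin n → ℝ) : ℝ :=
  P.ρ x * ((U (x, τ) - U (x, 0)) / τ)
    - τ / 2 * (P.ρ x * dt P.X P.T (dt P.X P.T U) (x, 0) - P.f x 0)
    - τ / 2 * (τ ^ 2 / 12) * ∑ k, P.a k ^ 2 * diffX (η k) k (dt P.X P.T (dt P.X P.T U)) x 0
    - P.ρ x * dt P.X P.T U (x, 0)
    - τ ^ 2 / 6 * ∑ k, P.a k ^ 2 * diffX (η k) k (dt P.X P.T U) x 0 - τ / 2 * fd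

variable {P : WaveData n} {U : (Fin n → ℝ) × ℝ → ℝ} {B : ℝ} {η : Fin n → ℝ} {τ t H ρmax : ℝ}
  {x : Fin n → ℝ}

theorem residual_combination_le {r s q b₁ b₂ : ℝ} (hr0 : 0 ≤ r) (hr : r ≤ ρmax)
    (hs : |s| ≤ b₁) (hq : |q| ≤ b₂) : |-(r * s) + τ ^ 2 / 12 * q| ≤ ρmax * b₁ + τ ^ 2 / 12 * b₂ := by
  refine (abs_add_le _ _).trans (add_le_add ?_ ?_)
  · rw [abs_neg, abs_mul, abs_of_nonneg hr0]
    exact mul_le_mul hr hs (abs_nonneg _) (hr0.trans hr)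
  · rw [abs_mul, abs_of_nonneg (by positivity)]
    exact mul_le_mul_of_nonneg_left hq (by positivity)

/-- The first term is the Numerov residual in time. In the second, both difference quotients
approximate the same mixed derivative ∂_t²∂_k²U to second order, so their difference is O(H), and
the prefactor τ² supplies the other power of H. -/
theorem abs_psiAt_le (hX : ∀ k, 0 < P.X k) (hT : 0 < P.T)
    (hU : ContDiffOn ℝ ∞ U (cylinder P.X P.T)) (hB : DerivBound P.X P.T U B)
    (hρ0 : 0 ≤ P.ρ x) (hρ : P.ρ x ≤ ρmax) (hx : x ∈ closedBox P.X) (hη : ∀ k, 0 < η k)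
    (hxm : ∀ k, 0 ≤ x k - η k) (hxp : ∀ k, x k + η k ≤ P.X k) (hτ : 0 < τ)
    (hτH : τ ^ 2 ≤ H) (hηH : ∀ k, η k ^ 2 ≤ H) (hm : 0 ≤ t - τ) (hp : t + τ ≤ P.T) :
    |P.psiAt η τ U x t| ≤ (3 * ρmax + ∑ k, P.a k ^ 2) * B * H ^ 2 := by
  have hB0 := hB.nonneg
  have ht : t ∈ Icc 0 P.T := ⟨by linarith, by linarith⟩
  have h1 := abs_resT_le hX hT hU hB.dt6 hx hτ hm hp
  have h2 : ∀ k, |diffT τ (dx P.X P.T k (dx P.X P.T k U)) x t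
      - diffX (η k) k (dt P.X P.T (dt P.X P.T U)) x t| ≤ 4 * B * H := by
    intro k
    have h3 := abs_diffT_sub_le hX hT
      (contDiffOn_iterate_dirDeriv hX hT hU (Pi.single k 1, 0) 2) (hB.dt4_dx2 k) hx hτ hm hp
    have h4 := abs_diffX_sub_le hX hT
      (contDiffOn_iterate_dirDeriv hX hT hU (0, 1) 2) (hB.dx4_dt2 k) hx (hη k) (hxm k) (hxp k) ht
    have h5 : dt P.X P.T (dt P.X P.T (dx P.X P.T k (dx P.X P.T k U))) (x, t)
        = dx P.X P.T k (dx P.X P.T k (dt P.X P.T (dt P.X P.T U))) (x, t) :=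
      dirDeriv_sq_sq_comm hX hT hU _ _ ⟨hx, ht⟩
    have h6 := mul_le_mul_of_nonneg_left hτH (by positivity : 0 ≤ 2 * B)
    have h7 := mul_le_mul_of_nonneg_left (hηH k) (by positivity : 0 ≤ 2 * B)
    simp only [Function.iterate_succ, Function.iterate_zero, Function.comp_apply, id_eq] at h3 h4
    change |diffT τ (dx P.X P.T k (dx P.X P.T k U)) x t - _| ≤ _ at h3
    change |diffX (η k) k (dt P.X P.T (dt P.X P.T U)) x t - _| ≤ _ at h4
    rw [abs_le] at h3 h4 ⊢
    change _ ≤ _ - dt P.X P.T (dt P.X P.T (dx P.X P.T k (dx P.X P.T k U))) (x, t) ∧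
      _ - dt P.X P.T (dt P.X P.T (dx P.X P.T k (dx P.X P.T k U))) (x, t) ≤ _ at h3
    change _ ≤ _ - dx P.X P.T k (dx P.X P.T k (dt P.X P.T (dt P.X P.T U))) (x, t) ∧
      _ - dx P.X P.T k (dx P.X P.T k (dt P.X P.T (dt P.X P.T U))) (x, t) ≤ _ at h4
    rw [h5] at h3
    constructor <;> linarith [h3.1, h3.2, h4.1, h4.2]
  have h3 := abs_sum_sq_mul_le P.a h2
  have hS : 0 ≤ ∑ k, P.a k ^ 2 := Finset.sum_nonneg fun k _ => sq_nonneg _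
  have hH : 0 ≤ H := (sq_nonneg τ).trans hτH
  refine (residual_combination_le hρ0 hρ h1 h3).trans ?_
  have h4 : τ ^ 4 ≤ H ^ 2 := by
    have := pow_le_pow_left₀ (sq_nonneg τ) hτH 2
    rwa [← pow_mul] at this
  have hρm : 0 ≤ ρmax := hρ0.trans hρ
  have h5 := mul_le_mul_of_nonneg_left h4 (by positivity : 0 ≤ ρmax * (3 * B))
  have h6 := mul_le_mul_of_nonneg_left hτH
    (by positivity : 0 ≤ (∑ k, P.a k ^ 2) * (4 * B * H) / 12)
  have h7 : 0 ≤ (∑ k, P.a k ^ 2) * B * H ^ 2 := by positivity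
  linarith

theorem abs_psiAt_diff_le (hX : ∀ k, 0 < P.X k) (hT : 0 < P.T)
    (hU : ContDiffOn ℝ ∞ U (cylinder P.X P.T)) (hB : DerivBound P.X P.T U B)
    (hρ0 : 0 ≤ P.ρ x) (hρ : P.ρ x ≤ ρmax) (hx : x ∈ closedBox P.X) (hη : ∀ k, 0 < η k)
    (hxm : ∀ k, 0 ≤ x k - η k) (hxp : ∀ k, x k + η k ≤ P.X k) (hτ : 0 < τ)
    (hτH : τ ^ 2 ≤ H) (hηH : ∀ k, η k ^ 2 ≤ H) (hm : 0 ≤ t - τ) (hp : t + τ + τ ≤ P.T) :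
    |P.psiAt η τ U x (t + τ) - P.psiAt η τ U x t|
      ≤ τ * ((3 * ρmax + ∑ k, P.a k ^ 2) * B * H ^ 2) := by
  have hB0 := hB.nonneg
  have ht : t ∈ Icc 0 P.T := ⟨by linarith, by linarith⟩
  have ht' : t + τ ∈ Icc 0 P.T := ⟨by linarith, by linarith⟩
  have h1 := abs_resT_diff_le hX hT hU hB.dt7 hx hτ hm hp
  have h2 : ∀ k, |(diffT τ (dx P.X P.T k (dx P.X P.T k U)) x (t + τ)
      - diffX (η k) k (dt P.X P.T (dt P.X P.T U)) x (t + τ))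
      - (diffT τ (dx P.X P.T k (dx P.X P.T k U)) x t
      - diffX (η k) k (dt P.X P.T (dt P.X P.T U)) x t)| ≤ 4 * (τ * B) * H := by
    intro k
    have hUxx : ContDiffOn ℝ ∞ (dx P.X P.T k (dx P.X P.T k U)) (cylinder P.X P.T) :=
      contDiffOn_iterate_dirDeriv hX hT hU (Pi.single k 1, 0) 2
    have hUtt : ContDiffOn ℝ ∞ (dt P.X P.T (dt P.X P.T U)) (cylinder P.X P.T) :=
      contDiffOn_iterate_dirDeriv hX hT hU (0, 1) 2
    have h3 := abs_diffT_sub_diff_le hX hT hUxx (hB.dt5_dx2 k) hx hτ hm hp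
    have h4 := abs_diffX_sub_diff_le hX hT hUtt (hB.dt_dx4_dt2 k) hx (hη k) (hxm k) (hxp k) hτ ht ht'
    have h5 : EqOn (dt P.X P.T (dt P.X P.T (dx P.X P.T k (dx P.X P.T k U))))
        (dx P.X P.T k (dx P.X P.T k (dt P.X P.T (dt P.X P.T U)))) (cylinder P.X P.T) :=
      dirDeriv_sq_sq_comm hX hT hU _ _
    have h6 := mul_le_mul_of_nonneg_left hτH (by positivity : 0 ≤ 2 * (τ * B))
    have h7 := mul_le_mul_of_nonneg_left (hηH k) (by positivity : 0 ≤ 2 * (τ * B))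
    rw [h5 (show (x, t) ∈ _ from ⟨hx, ht⟩), h5 (show (x, t + τ) ∈ _ from ⟨hx, ht'⟩)] at h3
    rw [abs_le] at h3 h4 ⊢
    constructor <;> linarith [h3.1, h3.2, h4.1, h4.2]
  have h3 := abs_sum_sq_mul_le P.a h2
  have hS : 0 ≤ ∑ k, P.a k ^ 2 := Finset.sum_nonneg fun k _ => sq_nonneg _
  have hH : 0 ≤ H := (sq_nonneg τ).trans hτH
  have e1 : P.psiAt η τ U x (t + τ) - P.psiAt η τ U x t
      = -(P.ρ x * (resT τ U (dt P.X P.T (dt P.X P.T U)) x (t + τ)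
          - resT τ U (dt P.X P.T (dt P.X P.T U)) x t))
        + τ ^ 2 / 12 * ∑ k, P.a k ^ 2 * ((diffT τ (dx P.X P.T k (dx P.X P.T k U)) x (t + τ)
          - diffX (η k) k (dt P.X P.T (dt P.X P.T U)) x (t + τ))
          - (diffT τ (dx P.X P.T k (dx P.X P.T k U)) x t
          - diffX (η k) k (dt P.X P.T (dt P.X P.T U)) x t)) := by
    simp only [WaveData.psiAt, mul_sub, Finset.sum_sub_distrib]
    ring
  rw [e1]
  refine (residual_combination_le hρ0 hρ h1 h3).trans ?_
  have h4 : τ ^ 4 ≤ H ^ 2 := by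
    have := pow_le_pow_left₀ (sq_nonneg τ) hτH 2
    rwa [← pow_mul] at this
  have hρm : 0 ≤ ρmax := hρ0.trans hρ
  have h5 := mul_le_mul_of_nonneg_left h4 (by positivity : 0 ≤ ρmax * (3 * (τ * B)))
  have h6 := mul_le_mul_of_nonneg_left hτH
    (by positivity : 0 ≤ (∑ k, P.a k ^ 2) * (4 * (τ * B) * H) / 12)
  have h7 : 0 ≤ τ * ((∑ k, P.a k ^ 2) * B * H ^ 2) := by positivity
  linarith

/-- The right-hand side expressed through the solution. -/
def WaveData.IsSource (P : WaveData n) (U : (Fin n → ℝ) × ℝ → ℝ) : Prop :=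
  ∀ x ∈ closedBox P.X, ∀ t ∈ Icc 0 P.T, P.f x t
    = P.ρ x * dt P.X P.T (dt P.X P.T U) (x, t)
      - ∑ k, P.a k ^ 2 * dx P.X P.T k (dx P.X P.T k U) (x, t)

theorem isJet_source (hX : ∀ k, 0 < P.X k) (hT : 0 < P.T)
    (hU : ContDiffOn ℝ ∞ U (cylinder P.X P.T)) (hx : x ∈ closedBox P.X) :
    IsJet (fun j t => P.ρ x * (dt P.X P.T)^[j + 2] U (x, t)
      - ∑ k, P.a k ^ 2 * (dt P.X P.T)^[j] (dx P.X P.T k (dx P.X P.T k U)) (x, t))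
      (Icc 0 P.T) := by
  intro j t ht
  refine (((isJet_time hX hT hU hx).shift 2 j t ht).const_mul (P.ρ x)).sub ?_
  apply HasDerivWithinAt.fun_sum
  intro k _
  exact (isJet_time hX hT (contDiffOn_iterate_dirDeriv hX hT hU (Pi.single k 1, 0) 2) hx j t
    ht).const_mul (P.a k ^ 2)

/-- The terms of order 0 to 3 in τ of the expansions of U and of f cancel through the equation; the
weights of f_d are chosen for this. -/
theorem abs_psiStart_le (hX : ∀ k, 0 < P.X k) (hT : 0 < P.T)
    (hU : ContDiffOn ℝ ∞ U (cylinder P.X P.T)) (hB : DerivBound P.X P.T U B)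
    (hf : P.IsSource U)
    (hρ0 : 0 ≤ P.ρ x) (hρ : P.ρ x ≤ ρmax) (hx : x ∈ closedBox P.X) (hη : ∀ k, 0 < η k)
    (hxm : ∀ k, 0 ≤ x k - η k) (hxp : ∀ k, x k + η k ≤ P.X k) (hτ : 0 < τ)
    (hτH : τ ^ 2 ≤ H) (hηH : ∀ k, η k ^ 2 ≤ H) (hp : 2 * τ ≤ P.T) {fd : ℝ}
    (hfd : fd = 7 / 12 * P.f x 0 + 1 / 2 * P.f x τ - 1 / 12 * P.f x (2 * τ) ∨
      fd = 1 / 3 * P.f x 0 + 2 / 3 * P.f x (τ / 2)) :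
    |P.psiStart η τ U fd x|
      ≤ (3 * ρmax + (3 + P.T) * ∑ k, P.a k ^ 2) * B * H ^ 2 := by
  have hB0 := hB.nonneg
  have h0 : (0 : ℝ) ∈ Icc 0 P.T := ⟨le_rfl, hT.le⟩
  have hτm : τ ∈ Icc 0 P.T := ⟨hτ.le, by linarith⟩
  set S := ∑ k, P.a k ^ 2 with hS
  have hS0 : 0 ≤ S := Finset.sum_nonneg fun k _ => sq_nonneg _
  have hH : 0 ≤ H := (sq_nonneg τ).trans hτH
  have hρm : 0 ≤ ρmax := hρ0.trans hρ
  -- expansion of the solution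
  have hu := (isJet_time hX hT hU hx).taylor (m := 5) (convex_Icc 0 P.T)
    (fun s hs => hB.dt5 (x, s) ⟨hx, hs⟩) h0 hτm
  -- expansion of the source
  have hfB : ∀ s ∈ Icc 0 P.T, |P.ρ x * (dt P.X P.T)^[3 + 2] U (x, s)
      - ∑ k, P.a k ^ 2 * (dt P.X P.T)^[3] (dx P.X P.T k (dx P.X P.T k U)) (x, s)|
      ≤ (ρmax + S) * B := by
    intro s hs
    have h1 := abs_sum_sq_mul_le P.a fun k => hB.dt3_dx2 k (x, s) ⟨hx, hs⟩
    have h2 : |P.ρ x * (dt P.X P.T)^[3 + 2] U (x, s)| ≤ ρmax * B := by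
      rw [abs_mul, abs_of_nonneg hρ0]
      exact mul_le_mul hρ (hB.dt5 (x, s) ⟨hx, hs⟩) (abs_nonneg _) hρm
    refine (abs_sub _ _).trans ?_
    linarith
  have hft : ∀ s ∈ Icc 0 P.T, _ := fun s hs =>
    (isJet_source hX hT hU hx).taylor (m := 3) (convex_Icc 0 P.T) hfB h0 hs
  set D : ℕ → ℝ := fun j => (dt P.X P.T)^[j] U (x, 0) with hD
  set W : ℕ → ℝ := fun j =>
    ∑ k, P.a k ^ 2 * (dt P.X P.T)^[j] (dx P.X P.T k (dx P.X P.T k U)) (x, 0) with hW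
  have hf0 : P.f x 0 = P.ρ x * D 2 - W 0 := hf x hx 0 h0
  have hft' : ∀ s ∈ Icc 0 P.T, |P.f x s - (P.f x 0 + (P.ρ x * D 3 - W 1) * s
      + (P.ρ x * D 4 - W 2) * s ^ 2 / 2)| ≤ (ρmax + S) * B * s ^ 3 := by
    intro s hs
    have h1 := hft s hs
    rw [sub_zero, abs_of_nonneg hs.1] at h1
    refine le_trans (le_of_eq ?_) h1
    rw [hf x hx s hs, hf0]
    congr 1
    simp only [Finset.sum_range_succ, Finset.sum_range_zero, Nat.factorial]
    norm_num
    simp only [hD, hW]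
    norm_num [Function.iterate_succ]
  -- Both rules agree up to O(τ³) with the average (2/τ)∫₀^τ (1 - s/τ) f ds; its moments give τ/3
  -- and τ²/12.
  have hfdb : |fd - (P.f x 0 + (P.ρ x * D 3 - W 1) * (τ / 3)
      + (P.ρ x * D 4 - W 2) * τ ^ 2 / 12)| ≤ 2 * ((ρmax + S) * B) * τ ^ 3 := by
    have hc : 0 ≤ (ρmax + S) * B * τ ^ 3 := by positivity
    rcases hfd with h | h
    · have h1 := hft' τ hτm
      have h2 := hft' (2 * τ) ⟨by linarith, hp⟩
      rw [h]
      rw [abs_le] at h1 h2 ⊢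
      constructor <;> nlinarith [h1.1, h1.2, h2.1, h2.2]
    · have h1 := hft' (τ / 2) ⟨by linarith, by linarith⟩
      rw [h]
      rw [abs_le] at h1 ⊢
      constructor <;> nlinarith [h1.1, h1.2]
  -- second differences
  have hx1 := abs_sum_sq_mul_le P.a (b := 2 * B * H) fun k =>
    (abs_diffX_sub_le hX hT (contDiffOn_iterate_dirDeriv hX hT hU (0, 1) 1) (hB.dx4_dt k) hx (hη k)
      (hxm k) (hxp k) h0).trans (mul_le_mul_of_nonneg_left (hηH k) (by positivity))
  have hx2 := abs_sum_sq_mul_le P.a (b := 2 * B * H) fun k =>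
    (abs_diffX_sub_le hX hT (contDiffOn_iterate_dirDeriv hX hT hU (0, 1) 2) (hB.dx4_dt2 k) hx (hη k)
      (hxm k) (hxp k) h0).trans (mul_le_mul_of_nonneg_left (hηH k) (by positivity))
  have hW1 : ∑ k, P.a k ^ 2 * dx P.X P.T k (dx P.X P.T k ((dirDeriv P.X P.T (0, 1))^[1] U)) (x, 0)
      = W 1 := Finset.sum_congr rfl fun k _ => by
    congr 1
    exact (dirDeriv_sq_comm hX hT hU (0, 1) (Pi.single k 1, 0) ⟨hx, h0⟩).symm
  have hW2 : ∑ k, P.a k ^ 2 * dx P.X P.T k (dx P.X P.T k ((dirDeriv P.X P.T (0, 1))^[2] U)) (x, 0)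
      = W 2 := Finset.sum_congr rfl fun k _ => by
    congr 1
    exact (dirDeriv_sq_sq_comm hX hT hU (0, 1) (Pi.single k 1, 0) ⟨hx, h0⟩).symm
  simp only [mul_sub, Finset.sum_sub_distrib] at hx1 hx2
  rw [hW1] at hx1
  rw [hW2] at hx2
  have hu' : |(U (x, τ) - U (x, 0)) / τ - (D 1 + D 2 * τ / 2 + D 3 * τ ^ 2 / 6 + D 4 * τ ^ 3 / 24)|
      ≤ B * τ ^ 4 := by
    have e : (U (x, τ) - U (x, 0)) / τ - (D 1 + D 2 * τ / 2 + D 3 * τ ^ 2 / 6 + D 4 * τ ^ 3 / 24)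
        = (U (x, τ) - (U (x, 0) + D 1 * τ + D 2 * τ ^ 2 / 2 + D 3 * τ ^ 3 / 6
          + D 4 * τ ^ 4 / 24)) / τ := by
      field_simp
      ring
    rw [e, abs_div, abs_of_pos hτ, div_le_iff₀ hτ]
    rw [sub_zero, abs_of_pos hτ] at hu
    refine le_trans (le_of_eq ?_) (hu.trans (le_of_eq (by ring)))
    congr 1
    simp only [Finset.sum_range_succ, Finset.sum_range_zero, Nat.factorial, hD]
    norm_num
  -- The terms in D 1 and D 2 cancel directly. At order τ² the terms ρD₃ and W₁ cancel against f',
  -- at order τ³ the terms ρD₄ and W₂ against f''. Four remainders are left.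
  have e1 : P.psiStart η τ U fd x
      = P.ρ x * ((U (x, τ) - U (x, 0)) / τ
          - (D 1 + D 2 * τ / 2 + D 3 * τ ^ 2 / 6 + D 4 * τ ^ 3 / 24))
        - τ ^ 2 / 6 * (∑ k, P.a k ^ 2 * diffX (η k) k ((dirDeriv P.X P.T (0, 1))^[1] U) x 0 - W 1)
        - τ ^ 2 / 6 * (τ / 4) *
          (∑ k, P.a k ^ 2 * diffX (η k) k ((dirDeriv P.X P.T (0, 1))^[2] U) x 0 - W 2)
        - τ / 2 * (fd - (P.f x 0 + (P.ρ x * D 3 - W 1) * (τ / 3)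
          + (P.ρ x * D 4 - W 2) * τ ^ 2 / 12)) := by
    have d1 : D 1 = dt P.X P.T U (x, 0) := rfl
    have d2 : D 2 = dt P.X P.T (dt P.X P.T U) (x, 0) := rfl
    have i1 : (dirDeriv P.X P.T (0, 1))^[1] U = dt P.X P.T U := rfl
    have i2 : (dirDeriv P.X P.T (0, 1))^[2] U = dt P.X P.T (dt P.X P.T U) := rfl
    rw [WaveData.psiStart, i1, i2, ← d1, ← d2]
    ring
  have h4 : τ ^ 4 ≤ H ^ 2 := by
    have := pow_le_pow_left₀ (sq_nonneg τ) hτH 2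
    rwa [← pow_mul] at this
  have b1 : |P.ρ x * ((U (x, τ) - U (x, 0)) / τ
      - (D 1 + D 2 * τ / 2 + D 3 * τ ^ 2 / 6 + D 4 * τ ^ 3 / 24))| ≤ ρmax * B * H ^ 2 := by
    rw [abs_mul, abs_of_nonneg hρ0, mul_assoc]
    exact mul_le_mul hρ (hu'.trans (mul_le_mul_of_nonneg_left h4 hB0)) (abs_nonneg _) hρm
  have b2 : |τ ^ 2 / 6 * (∑ k, P.a k ^ 2 * diffX (η k) k ((dirDeriv P.X P.T (0, 1))^[1] U) x 0
      - W 1)| ≤ S * B * H ^ 2 := by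
    rw [abs_mul, abs_of_nonneg (by positivity)]
    have h1 := mul_le_mul (by linarith : τ ^ 2 / 6 ≤ H / 6) hx1 (abs_nonneg _) (by positivity)
    have h2 : 0 ≤ S * B * H ^ 2 := by positivity
    linarith
  have b3 : |τ ^ 2 / 6 * (τ / 4) * (∑ k, P.a k ^ 2 * diffX (η k) k
      ((dirDeriv P.X P.T (0, 1))^[2] U) x 0 - W 2)| ≤ P.T * (S * B * H ^ 2) := by
    rw [abs_mul, abs_of_nonneg (by positivity)]
    have h0 := mul_le_mul (by linarith : τ ^ 2 / 6 ≤ H / 6) (by linarith : τ / 4 ≤ P.T)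
      (by positivity) (by positivity)
    have h1 := mul_le_mul h0 hx2 (abs_nonneg _) (by positivity)
    have h2 : 0 ≤ P.T * (S * B * H ^ 2) := by positivity
    linarith
  have b4 : |τ / 2 * (fd - (P.f x 0 + (P.ρ x * D 3 - W 1) * (τ / 3)
      + (P.ρ x * D 4 - W 2) * τ ^ 2 / 12))| ≤ (ρmax + S) * B * H ^ 2 := by
    rw [abs_mul, abs_of_nonneg (by positivity)]
    have h1 := mul_le_mul_of_nonneg_left hfdb (by positivity : 0 ≤ τ / 2)
    have h2 := mul_le_mul_of_nonneg_left h4 (by positivity : 0 ≤ (ρmax + S) * B)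
    linarith
  rw [e1]
  have hfin : 0 ≤ ρmax * B * H ^ 2 := by positivity
  have hfin2 : 0 ≤ S * B * H ^ 2 := by positivity
  refine (abs_sub _ _).trans ?_
  refine (add_le_add_left ((abs_sub _ _).trans (add_le_add_left (abs_sub _ _) _)) _).trans ?_
  linarith

end Residuals

/-! ### The data of the problem expressed through the solution -/

section Solution

variable {n : ℕ} {P : WaveData n} {u : (Fin n → ℝ) → ℝ → ℝ} {x : Fin n → ℝ} {t : ℝ}

theorem pdtt_eq_dt_dt {X : Fin n → ℝ} {T : ℝ} (hX : ∀ k, 0 < X k) (hT : 0 < T)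
    {U : (Fin n → ℝ) × ℝ → ℝ} (hU : ContDiffOn ℝ ∞ U (cylinder X T)) (hx : x ∈ closedBox X)
    (ht : t ∈ Icc 0 T) {φ : ℝ → ℝ} (hφ : ∀ s ∈ Icc 0 T, φ s = U (x, s)) :
    pdtt T φ t = dt X T (dt X T U) (x, t) :=
  (isJet_time hX hT hU hx).iteratedDerivWithin_two hT hφ ht

theorem pdxx_eq_dx_dx {X : Fin n → ℝ} {T : ℝ} (hX : ∀ k, 0 < X k) (hT : 0 < T)
    {U : (Fin n → ℝ) × ℝ → ℝ} (hU : ContDiffOn ℝ ∞ U (cylinder X T)) (hx : x ∈ closedBox X)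
    (ht : t ∈ Icc 0 T) {k : Fin n} {φ : (Fin n → ℝ) → ℝ}
    (hφ : ∀ s ∈ Icc 0 (X k), φ (Function.update x k s) = U (Function.update x k s, t)) :
    pdxx X k φ x = dx X T k (dx X T k U) (x, t) := by
  have h := (isJet_space hX hT hU k hx ht).iteratedDerivWithin_two (hX k) hφ (hx k)
  simp only [Function.iterate_succ, Function.iterate_zero, Function.comp_apply, id_eq,
    Function.update_eq_self] at h
  exact h

theorem IsSmoothSolution.isSource (hu : IsSmoothSolution P u) (hX : ∀ k, 0 < P.X k)
    (hT : 0 < P.T) : P.IsSource (fun p => u p.1 p.2) := by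
  intro x hx t ht
  rw [← hu.equation x hx t ht, pdtt_eq_dt_dt hX hT hu.smooth hx ht fun s _ => rfl]
  congr 1
  refine Finset.sum_congr rfl fun k _ => ?_
  rw [pdxx_eq_dx_dx hX hT hu.smooth hx ht fun s _ => rfl]

theorem IsSmoothSolution.u₁_eq (hu : IsSmoothSolution P u) (hX : ∀ k, 0 < P.X k)
    (hT : 0 < P.T) (hx : x ∈ closedBox P.X) :
    P.u₁ x = dt P.X P.T (fun p => u p.1 p.2) (x, 0) := by
  have h0 : (0 : ℝ) ∈ Icc 0 P.T := ⟨le_rfl, hT.le⟩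
  rw [← hu.initial_deriv x hx]
  exact (isJet_time hX hT hu.smooth hx 0 0 h0).derivWithin (uniqueDiffOn_Icc hT 0 h0)

theorem notMem_openBox {X : Fin n → ℝ} {l : Fin n} (h : x l = 0 ∨ x l = X l) :
    x ∉ openBox X := fun hx => by
  rcases h with h | h
  · exact absurd (hx l).1 (by rw [h]; exact lt_irrefl 0)
  · exact absurd (hx l).2 (by rw [h]; exact lt_irrefl _)

theorem exists_of_notMem_openBox {X : Fin n → ℝ} (hx : x ∈ closedBox X) (hx' : x ∉ openBox X) :
    ∃ l, x l = 0 ∨ x l = X l := by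
  by_contra! h
  exact hx' fun l => ⟨lt_of_le_of_ne (hx l).1 (h l).1.symm, lt_of_le_of_ne (hx l).2 (h l).2⟩

theorem IsSmoothSolution.gk_eq (hu : IsSmoothSolution P u) (hX : ∀ k, 0 < P.X k)
    (hT : 0 < P.T) (k : Fin n) (hx : x ∈ closedBox P.X) (hx' : x ∉ openBox P.X)
    (ht : t ∈ Icc 0 P.T) :
    P.gk k x t = P.a k ^ 2 * dx P.X P.T k (dx P.X P.T k (fun p => u p.1 p.2)) (x, t) := by
  -- If x lies on a face orthogonal to direction l, the whole segment through x in a direction l' ≠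
  -- l stays on that face, where g = u. If x_k is an end point, this covers all directions but k,
  -- and the equation yields the missing derivative; otherwise x lies on a face l ≠ k and direction
  -- k is covered.
  have hseg : ∀ l l' : Fin n, l ≠ l' → (x l = 0 ∨ x l = P.X l) →
      pdxx P.X l' (fun y => P.g y t) x
        = dx P.X P.T l' (dx P.X P.T l' (fun p => u p.1 p.2)) (x, t) := by
    intro l l' hl hxl
    refine pdxx_eq_dx_dx hX hT hu.smooth hx ht fun s hs => ?_
    refine (hu.boundary _ ⟨update_mem_closedBox hx hs, notMem_openBox (l := l) ?_⟩ t ht).symm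
    rwa [Function.update_of_ne hl]
  unfold WaveData.gk
  split_ifs with h
  · rw [pdtt_eq_dt_dt hX hT hu.smooth hx ht fun s hs => (hu.boundary x ⟨hx, hx'⟩ s hs).symm,
      hu.isSource hX hT x hx t ht,
      Finset.sum_congr rfl fun l hl => by rw [hseg k l (Finset.ne_of_mem_erase hl).symm h],
      ← Finset.add_sum_erase _ _ (Finset.mem_univ k)]
    ring
  · obtain ⟨l, hl⟩ := exists_of_notMem_openBox hx hx'
    rw [hseg l k (fun hlk => h (hlk ▸ hl)) hl]

theorem IsSmoothSolution.pdxx_u₀_eq (hu : IsSmoothSolution P u) (hX : ∀ k, 0 < P.X k)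
    (hT : 0 < P.T) (k : Fin n) (hx : x ∈ closedBox P.X) :
    pdxx P.X k P.u₀ x = dx P.X P.T k (dx P.X P.T k (fun p => u p.1 p.2)) (x, 0) :=
  pdxx_eq_dx_dx hX hT hu.smooth hx ⟨le_rfl, hT.le⟩ fun _ hs =>
    (hu.initial _ (update_mem_closedBox hx hs)).symm

end Solution

/-! ### Mesh operators applied to restrictions of smooth functions -/

section Nodes

variable {n : ℕ} {N : Fin n → ℕ} {X h : Fin n → ℝ}

theorem point_mem_closedBox (hh : ∀ k, 0 < h k) (hNh : ∀ k, N k * h k = X k) (i : Node N) :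
    point h i ∈ closedBox X := fun k => by
  refine ⟨mul_nonneg (Nat.cast_nonneg _) (hh k).le, ?_⟩
  rw [← hNh k]
  have : ((i k : ℕ) : ℝ) ≤ N k := by exact_mod_cast Nat.lt_succ_iff.mp (i k).isLt
  exact mul_le_mul_of_nonneg_right this (hh k).le

theorem point_notMem_openBox (hNh : ∀ k, N k * h k = X k) {i : Node N} (hi : ¬ Interior i) :
    point h i ∉ openBox X := by
  unfold Interior at hi
  push Not at hi
  obtain ⟨k, hk⟩ := hi
  apply notMem_openBox (l := k)
  rcases Nat.eq_zero_or_pos (i k : ℕ) with h0 | h0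
  · left; simp only [point]; rw [h0]; simp
  · right
    have : (i k : ℕ) = N k := le_antisymm (Nat.lt_succ_iff.mp (i k).isLt) (hk h0)
    simp only [point]
    rw [this, hNh]

theorem point_nextNode {i : Node N} {k : Fin n} (hi : (i k : ℕ) < N k) :
    point h (nextNode k i) = Function.update (point h i) k (point h i k + h k) := by
  funext l
  rcases eq_or_ne l k with rfl | hl
  · simp only [point, Function.update_self]
    rw [nextNode_apply_self, min_eq_left (by omega)]
    push_cast
    ring
  · rw [Function.update_of_ne hl]
    simp only [point]
    rw [nextNode_apply_of_ne hl]

theorem point_prevNode {i : Node N} {k : Fin n} (hi : 0 < (i k : ℕ)) :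
    point h (prevNode k i) = Function.update (point h i) k (point h i k - h k) := by
  funext l
  rcases eq_or_ne l k with rfl | hl
  · simp only [point, Function.update_self]
    rw [prevNode_apply_self, Nat.cast_sub hi]
    push_cast
    ring
  · rw [Function.update_of_ne hl]
    simp only [point]
    rw [prevNode_apply_of_ne hl]

theorem point_sub_nonneg (hh : ∀ k, 0 < h k) {i : Node N} (hi : Interior i) (k : Fin n) :
    0 ≤ point h i k - h k := by
  have : (1 : ℝ) ≤ ((i k : ℕ) : ℝ) := by exact_mod_cast (hi k).1
  have := mul_le_mul_of_nonneg_right this (hh k).le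
  simp only [point]
  linarith

theorem point_add_le (hh : ∀ k, 0 < h k) (hNh : ∀ k, N k * h k = X k) {i : Node N}
    (hi : Interior i) (k : Fin n) : point h i k + h k ≤ X k := by
  have : ((i k : ℕ) : ℝ) + 1 ≤ N k := by exact_mod_cast (hi k).2
  have := mul_le_mul_of_nonneg_right this (hh k).le
  rw [← hNh]
  simp only [point]
  linarith

theorem lam_eq_diffX {F : (Fin n → ℝ) × ℝ → ℝ} {w : MeshFun N} {t : ℝ}
    (hw : ∀ j, w j = F (point h j, t)) {i : Node N} (hi : Interior i) (k : Fin n) :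
    lam h k w i = diffX (h k) k F (point h i) t := by
  change (w (nextNode k i) - 2 * w i + w (prevNode k i)) / h k ^ 2 = _
  rw [hw, hw, hw, point_nextNode (hi k).2, point_prevNode (hi k).1]
  rfl

theorem numerov_sub_lam_eq_resX {F G : (Fin n → ℝ) × ℝ → ℝ} {w z : MeshFun N} {t : ℝ}
    (hw : ∀ j, w j = F (point h j, t)) (hz : ∀ j, z j = G (point h j, t)) {i : Node N}
    (hi : Interior i) (k : Fin n) :
    numerov k z i - lam h k w i = resX (h k) k F G (point h i) t := by
  rw [lam_eq_diffX hw hi]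
  change (z (prevNode k i) + 10 * z i + z (nextNode k i)) / 12 - _ = _
  rw [hz, hz, hz, point_nextNode (hi k).2, point_prevNode (hi k).1]
  rfl

theorem Lh_apply (a : Fin n → ℝ) (w : MeshFun N) (i : Node N) :
    Lh a h w i = ∑ k, a k ^ 2 * lam h k w i := by
  simp [Lh, LinearMap.sum_apply, Finset.sum_apply]

theorem Lh_apply_Hh (a : Fin n → ℝ) (w : Hh N) {i : Node N} (hi : Interior i) :
    Lh a h (w : MeshFun N) i = -((∑ k, a k ^ 2 • negLam h k w : Hh N) : MeshFun N) i := by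
  rw [Lh_apply, Submodule.coe_sum, Finset.sum_apply, ← Finset.sum_neg_distrib]
  refine Finset.sum_congr rfl fun k _ => ?_
  rw [Submodule.coe_smul, Pi.smul_apply, smul_eq_mul, negLam_apply, if_pos hi]
  change _ * (((w : MeshFun N) (nextNode k i) - 2 * (w : MeshFun N) i
    + (w : MeshFun N) (prevNode k i)) / h k ^ 2) = _
  ring

/-- Multiplication by a mesh function, in `H_h`. -/
def mulHh (c : MeshFun N) : Hh N →ₗ[ℝ] Hh N where
  toFun w := ⟨fun i => c i * (w : MeshFun N) i, fun i hi => by simp [w.2 i hi]⟩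
  map_add' v w := by ext i; simp [mul_add]
  map_smul' b w := by ext i; simp [mul_left_comm]

theorem mulHh_apply (c : MeshFun N) (w : Hh N) (i : Node N) :
    (mulHh c w : MeshFun N) i = c i * (w : MeshFun N) i := rfl

end Nodes

/-! ### The exact solution inserted into the scheme -/

section Scheme

variable {n : ℕ} {P : WaveData n} {N : Fin n → ℕ} {M : ℕ}

theorem WaveData.rhoOp_sub (P : WaveData n) (v w : MeshFun N) :
    P.rhoOp M (v - w) = P.rhoOp M v - P.rhoOp M w := by
  have e : (v - w) / onMesh (P.h N) P.ρ
      = (v / onMesh (P.h N) P.ρ - w / onMesh (P.h N) P.ρ : MeshFun N) := by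
    funext j
    simp only [Pi.div_apply, Pi.sub_apply, sub_div]
  simp only [WaveData.rhoOp, e, mul_sub, map_sub, smul_sub]
  abel

theorem WaveData.rhoOp_apply_Hh (P : WaveData n) (q : Hh N) {i : Node N} (hi : Interior i) :
    P.rhoOp M (q : MeshFun N) i
      = ((mulHh (onMesh (P.h N) P.ρ) (mulHh (onMesh (P.h N) P.ρ)⁻¹ q)
        - (P.ht M ^ 2 / 12) • ∑ l, P.a l ^ 2 • negLam (P.h N) l (mulHh (onMesh (P.h N) P.ρ)⁻¹ q)
          : Hh N) : MeshFun N) i := by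
  have e1 : (q : MeshFun N) / onMesh (P.h N) P.ρ
      = (mulHh (onMesh (P.h N) P.ρ)⁻¹ q : MeshFun N) := by
    funext j
    rw [mulHh_apply, Pi.div_apply, Pi.inv_apply]
    ring
  simp only [WaveData.rhoOp, e1]
  rw [Pi.add_apply, Pi.smul_apply, Lh_apply_Hh _ _ hi, Submodule.coe_sub, Pi.sub_apply,
    Submodule.coe_smul, Pi.smul_apply, mulHh_apply]
  simp only [smul_eq_mul, Pi.mul_apply]
  ring

variable {U : (Fin n → ℝ) × ℝ → ℝ}

/-- `∂ₖ²U` at the nodes, at level `m`. -/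
def WaveData.dxxMesh (P : WaveData n) (N : Fin n → ℕ) (M : ℕ) (U : (Fin n → ℝ) × ℝ → ℝ) (m : ℕ)
    (k : Fin n) : MeshFun N :=
  fun i => dx P.X P.T k (dx P.X P.T k U) (point (P.h N) i, m * P.ht M)

theorem sum_smul_apply (a : Fin n → ℝ) (w : Fin n → MeshFun N) (i : Node N) :
    (∑ k, a k ^ 2 • w k) i = ∑ k, a k ^ 2 * w k i := by
  simp [Finset.sum_apply]

/-- At every node, boundary nodes included, f + Σ a_k²∂_k²U = ρ∂_t²U; dividing by ρ removes the
coefficient before L_h acts. -/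
theorem Lh_div_add_Lh_div (hf : P.IsSource U)
    (hbox : ∀ i : Node N, point (P.h N) i ∈ closedBox P.X)
    (hρ : ∀ i : Node N, P.ρ (point (P.h N) i) ≠ 0) {m : ℕ} {t : ℝ} (ht : m * P.ht M = t)
    (htT : t ∈ Icc 0 P.T) {i : Node N} (hi : Interior i) {F : MeshFun N}
    (hF : ∀ j, F j = P.f (point (P.h N) j) t / P.ρ (point (P.h N) j)) :
    Lh P.a (P.h N) ((∑ k, P.a k ^ 2 • P.dxxMesh N M U m k) / onMesh (P.h N) P.ρ) i
      + Lh P.a (P.h N) F i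
      = ∑ k, P.a k ^ 2 * diffX (P.h N k) k (dt P.X P.T (dt P.X P.T U)) (point (P.h N) i) t := by
  rw [← Pi.add_apply, ← map_add, Lh_apply]
  refine Finset.sum_congr rfl fun k _ => ?_
  rw [lam_eq_diffX (F := dt P.X P.T (dt P.X P.T U)) (t := t) (fun j => ?_) hi]
  rw [Pi.add_apply, Pi.div_apply, sum_smul_apply, hF, hf _ (hbox j) t htT]
  simp only [WaveData.dxxMesh, ht, onMesh]
  field_simp [hρ j]
  ring

/-- The residual of the equation of the scheme. -/
theorem residual_main (hf : P.IsSource U)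
    (hbox : ∀ i : Node N, point (P.h N) i ∈ closedBox P.X)
    (hρ : ∀ i : Node N, P.ρ (point (P.h N) i) ≠ 0) (hτ : 0 < P.ht M) {m : ℕ}
    (hm : (m + 1 + 1) * P.ht M ≤ P.T) {i : Node N} (hi : Interior i) {w : ℕ → MeshFun N}
    (hw : ∀ l j, w l j = U (point (P.h N) j, l * P.ht M)) :
    P.ρ (point (P.h N) i) * lamT (P.ht M) w (m + 1) i
      = P.rhoOp M (∑ k, P.a k ^ 2 • P.dxxMesh N M U (m + 1) k) i + P.fh M (m + 1) i
        + P.psiAt (P.h N) (P.ht M) U (point (P.h N) i) ((m + 1) * P.ht M) := by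
  have hm0 : (0 : ℝ) ≤ m * P.ht M := by positivity
  have e0 : ((m + 1 : ℕ) : ℝ) * P.ht M = (m + 1) * P.ht M := by push_cast; ring
  have h0 : m * P.ht M ∈ Icc 0 P.T := ⟨hm0, by linarith⟩
  have h1 : (m + 1) * P.ht M ∈ Icc 0 P.T := ⟨by linarith, by linarith⟩
  have h2 : (m + 1) * P.ht M + P.ht M ∈ Icc 0 P.T := ⟨by linarith, by linarith⟩
  have e1 : (m + 1) * P.ht M - P.ht M = m * P.ht M := by ring
  have e2 : ((m + 1 + 1 : ℕ) : ℝ) * P.ht M = (m + 1) * P.ht M + P.ht M := by push_cast; ring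
  have hL := Lh_div_add_Lh_div hf hbox hρ e0 h1 hi
    (F := onLevels (P.h N) (P.ht M) P.f (m + 1) / onMesh (P.h N) P.ρ) (fun j => by
      simp only [Pi.div_apply, onLevels, onMesh, e0])
  simp only [WaveData.rhoOp, WaveData.fh, Pi.add_apply, Pi.smul_apply, smul_eq_mul, Pi.mul_apply]
  have hF : lamT (P.ht M) (onLevels (P.h N) (P.ht M) P.f) (m + 1) i
      = P.ρ (point (P.h N) i) * diffT (P.ht M) (dt P.X P.T (dt P.X P.T U)) (point (P.h N) i)
          ((m + 1) * P.ht M)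
        - ∑ k, P.a k ^ 2 * diffT (P.ht M) (dx P.X P.T k (dx P.X P.T k U)) (point (P.h N) i)
          ((m + 1) * P.ht M) := by
    simp only [lamT, onLevels, onMesh, Nat.add_sub_cancel, e0, e2]
    rw [hf _ (hbox i) _ h0, hf _ (hbox i) _ h1, hf _ (hbox i) _ h2]
    simp only [diffT, e1, mul_div_assoc', ← Finset.sum_div, mul_add, mul_sub,
      Finset.sum_add_distrib, Finset.sum_sub_distrib]
    have : ∀ k, P.a k ^ 2 * (2 * dx P.X P.T k (dx P.X P.T k U) (point (P.h N) i,
        (m + 1) * P.ht M)) = 2 * (P.a k ^ 2 * dx P.X P.T k (dx P.X P.T k U) (point (P.h N) i,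
        (m + 1) * P.ht M)) := fun k => by ring
    simp only [this, ← Finset.mul_sum]
    ring
  have hw2 : lamT (P.ht M) w (m + 1) i = diffT (P.ht M) U (point (P.h N) i)
      ((m + 1) * P.ht M) := by
    simp only [lamT, hw, Nat.add_sub_cancel, e0, e2, diffT, e1]
  have hr : onMesh (P.h N) P.ρ i * ((∑ k, P.a k ^ 2 • P.dxxMesh N M U (m + 1) k)
      / onMesh (P.h N) P.ρ : MeshFun N) i = ∑ k, P.a k ^ 2 * dx P.X P.T k (dx P.X P.T k U)
        (point (P.h N) i, (m + 1) * P.ht M) := by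
    rw [Pi.div_apply, sum_smul_apply]
    simp only [WaveData.dxxMesh, e0, onMesh]
    field_simp [hρ i]
  have hFi : onLevels (P.h N) (P.ht M) P.f (m + 1) i
      = P.f (point (P.h N) i) ((m + 1) * P.ht M) := by
    simp only [onLevels, onMesh, e0]
  have hLi : Lh P.a (P.h N) ((∑ k, P.a k ^ 2 • P.dxxMesh N M U (m + 1) k) / onMesh (P.h N) P.ρ) i
      = (∑ k, P.a k ^ 2 * diffX (P.h N k) k (dt P.X P.T (dt P.X P.T U)) (point (P.h N) i)
        ((m + 1) * P.ht M))
        - Lh P.a (P.h N) (onLevels (P.h N) (P.ht M) P.f (m + 1) / onMesh (P.h N) P.ρ) i := by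
    linarith
  rw [hw2, hr, hFi, hLi, hF, hf _ (hbox i) _ h1]
  simp only [WaveData.psiAt, mul_sub, Finset.sum_sub_distrib, resT, e1]
  -- The Numerov average in time is G + (τ²/12)Λ_t G. This absorbs the term ρΛ_t∂_t²U that comes
  -- from Λ_t f.
  have hd : diffT (P.ht M) (dt P.X P.T (dt P.X P.T U)) (point (P.h N) i) ((m + 1) * P.ht M)
      * P.ht M ^ 2 = dt P.X P.T (dt P.X P.T U) (point (P.h N) i, (m + 1) * P.ht M + P.ht M)
        - 2 * dt P.X P.T (dt P.X P.T U) (point (P.h N) i, (m + 1) * P.ht M)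
        + dt P.X P.T (dt P.X P.T U) (point (P.h N) i, m * P.ht M) := by
    simp only [diffT, e1]
    field_simp
  linear_combination (-P.ρ (point (P.h N) i) / 12) * hd

/-- The residual of the equation of the scheme at the first level. -/
theorem residual_start (hf : P.IsSource U)
    (hbox : ∀ i : Node N, point (P.h N) i ∈ closedBox P.X)
    (hρ : ∀ i : Node N, P.ρ (point (P.h N) i) ≠ 0) (hT : 0 < P.T)
    (hu₁ : ∀ x ∈ closedBox P.X, P.u₁ x = dt P.X P.T U (x, 0)) (rule : StartRule)
    {i : Node N} (hi : Interior i) {w : ℕ → MeshFun N}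
    (hw : ∀ l j, w l j = U (point (P.h N) j, l * P.ht M)) :
    P.ρ (point (P.h N) i) * dT (P.ht M) w 0 i
      = P.ht M / 2 * P.rhoOp M (∑ k, P.a k ^ 2 • P.dxxMesh N M U 0 k) i + P.u1h M i
        + P.ht M / 2 * P.fh0 M rule i
        + P.psiStart (P.h N) (P.ht M) U (P.fd0 M rule i) (point (P.h N) i) := by
  have h0 : (0 : ℝ) ∈ Icc 0 P.T := ⟨le_rfl, hT.le⟩
  have e0 : ((0 : ℕ) : ℝ) * P.ht M = 0 := by simp
  have hL := Lh_div_add_Lh_div hf hbox hρ e0 h0 hi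
    (F := onMesh (P.h N) (fun x => P.f x 0 / P.ρ x)) (fun j => rfl)
  have hw2 : dT (P.ht M) w 0 i
      = (U (point (P.h N) i, P.ht M) - U (point (P.h N) i, 0)) / P.ht M := by
    simp [dT, hw]
  have hr : onMesh (P.h N) P.ρ i * ((∑ k, P.a k ^ 2 • P.dxxMesh N M U 0 k)
      / onMesh (P.h N) P.ρ : MeshFun N) i = ∑ k, P.a k ^ 2 * dx P.X P.T k (dx P.X P.T k U)
        (point (P.h N) i, 0) := by
    rw [Pi.div_apply, sum_smul_apply]
    simp only [WaveData.dxxMesh, e0, onMesh]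
    field_simp [hρ i]
  have hL1 : Lh P.a (P.h N) (onMesh (P.h N) P.u₁) i
      = ∑ k, P.a k ^ 2 * diffX (P.h N k) k (dt P.X P.T U) (point (P.h N) i) 0 := by
    rw [Lh_apply]
    exact Finset.sum_congr rfl fun k _ => by
      rw [lam_eq_diffX (F := dt P.X P.T U) (w := onMesh (P.h N) P.u₁) (t := 0) (fun j => hu₁ _ (hbox j)) hi]
  have hu1i : onMesh (P.h N) P.u₁ i = dt P.X P.T U (point (P.h N) i, 0) := hu₁ _ (hbox i)
  have hρi : onMesh (P.h N) P.ρ i = P.ρ (point (P.h N) i) := rfl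
  have hfi := hf _ (hbox i) 0 h0
  simp only [WaveData.rhoOp, WaveData.u1h, WaveData.fh0, Pi.add_apply, Pi.smul_apply,
    smul_eq_mul, Pi.mul_apply]
  rw [hw2, hr, hL1, hu1i, hρi, WaveData.psiStart]
  linear_combination (-(P.ht M / 2 * (P.ht M ^ 2 / 12))) * hL - (P.ht M / 2) * hfi

end Scheme

/-! ### The error equations in H_h and the error bound -/

section Error

variable {n : ℕ} {P : WaveData n} {u : (Fin n → ℝ) → ℝ → ℝ} {N : Fin n → ℕ} {M : ℕ}
  {rule : StartRule} {v : ℕ → MeshFun N} {vv : ℕ → Fin n → MeshFun N}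

/-- The auxiliary functions of the scheme are exact at the boundary. -/
theorem IsSchemeSolution.vv_boundary (hv : IsSchemeSolution P N M rule v vv)
    (hu : IsSmoothSolution P u) (hX : ∀ k, 0 < P.X k) (hT : 0 < P.T) (ha : ∀ k, 0 < P.a k)
    (hh : ∀ k, 0 < P.h N k) (hNh : ∀ k, N k * P.h N k = P.X k) {m : ℕ} (hm : m < M)
    (htm : m * P.ht M ∈ Icc 0 P.T) (k : Fin n) {i : Node N} (hi : ¬ Interior i) :
    vv m k i = P.dxxMesh N M (fun p => u p.1 p.2) m k i := by
  have hbox := point_mem_closedBox hh hNh i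
  have hnot := point_notMem_openBox hNh hi
  have key : P.a k ^ 2 * vv m k i = P.gk k (point (P.h N) i) (m * P.ht M) →
      vv m k i = P.dxxMesh N M (fun p => u p.1 p.2) m k i := by
    intro h
    rw [hu.gk_eq hX hT k hbox hnot htm] at h
    exact mul_left_cancel₀ (pow_pos (ha k) 2).ne' h
  rcases Nat.eq_zero_or_pos m with rfl | h1
  · rcases hv.start_aux_boundary k with h | h
    · exact key (by simpa using h i hi)
    · rw [h i hi, hu.pdxx_u₀_eq hX hT k hbox]
      simp [WaveData.dxxMesh]
  · exact key (hv.aux_boundary m h1 (by omega) k i hi)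

theorem IsSchemeSolution.aux_all (hv : IsSchemeSolution P N M rule v vv) {m : ℕ} (hm : m < M)
    (k : Fin n) {i : Node N} (hi : Interior i) :
    numerov k (vv m k) i = lam (P.h N) k (v m) i := by
  rcases Nat.eq_zero_or_pos m with rfl | h1
  · exact hv.start_aux k i hi
  · exact hv.aux m h1 (by omega) k i hi

theorem cutoff_eq {w : MeshFun N} (hw : ∀ i, ¬ Interior i → w i = 0) :
    (cutoff N w : MeshFun N) = w := by
  funext i
  rw [cutoff_apply]
  split_ifs with hi
  · rfl
  · exact (hw i hi).symm

theorem sqrt_ipForm_cutoff_le {h X : Fin n → ℝ} (hh : ∀ k, 0 < h k) (hN : ∀ k, 1 ≤ N k)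
    (hNh : ∀ k, N k * h k = X k) {w : Hh N} {c : ℝ} (hc : 0 ≤ c)
    (hw : ∀ i, Interior i → |(w : MeshFun N) i| ≤ c) :
    √(ipForm h w w) ≤ √(∏ k, (2 * X k)) * c := by
  have h1 := normh_le_of_abs_le hh hN hc hw
  simp only [hNh] at h1
  exact h1

theorem residual_le_of_sq_le {B b η H : ℝ} (hb : 0 ≤ b) (h : η ^ 2 ≤ H)
    (hB : 3 * b ≤ B) : 3 * b * η ^ 4 ≤ B * H ^ 2 := by
  have h4 : η ^ 4 ≤ H ^ 2 := by
    have := pow_le_pow_left₀ (sq_nonneg η) h 2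
    rwa [← pow_mul] at this
  exact mul_le_mul hB h4 (by positivity) (by linarith)

/-- The error bound, with the constant expressed through a bound `B` of the derivatives of the
solution. Since `-L_h ≤ E_h` in `H_h`, the second stability condition already makes
`ρ I + h_t²/12 L_h` uniformly positive, so the first one is not needed here. -/
theorem IsSchemeSolution.error_bound (hv : IsSchemeSolution P N M rule v vv) (k₀ : Fin n)
    (hX : ∀ k, 0 < P.X k) (hT : 0 < P.T) (ha : ∀ k, 0 < P.a k)
    {ρmin ρmax B ε₀ : ℝ} (hρmin : 0 < ρmin)
    (hρ : ∀ x ∈ closedBox P.X, ρmin ≤ P.ρ x ∧ P.ρ x ≤ ρmax)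
    (hu : IsSmoothSolution P u) (hB : DerivBound P.X P.T (fun p => u p.1 p.2) B)
    (hN : ∀ k, 1 ≤ N k) (hM : 2 ≤ M) (hε : 0 < ε₀) (hε1 : ε₀ < 1)
    (hstab : StabCond2 P ρmin N M ε₀)
    (hv0 : v 0 = onMesh (P.h N) (fun x => u x 0)) {r : ℕ → MeshFun N}
    (hr : r = onLevels (P.h N) (P.ht M) u - v) {m : ℕ} (hm1 : 1 ≤ m) (hm : m ≤ M) :
    ε₀ * (normh (P.h N) (dBarT (P.ht M) r m) + normH1 P.a (P.h N) (r m)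
        + normh (P.h N) (sumT (P.ht M) (fun l => Lh P.a (P.h N) (r l)) m))
      ≤ stabConst ρmin ρmax (P.a k₀ ^ 2 / (4 * P.X k₀ ^ 2)) P.T (∑ k, P.a k ^ 2)
        * (√(∏ k, (2 * P.X k)) * ((3 + 3 * ρmax + (3 + P.T) * ∑ k, P.a k ^ 2) * B
          * P.stepNorm N M ^ 4)) := by
  set U : (Fin n → ℝ) × ℝ → ℝ := fun p => u p.1 p.2 with hU
  set τ := P.ht M with hτdef
  set h := P.h N with hhdef
  have hNpos : ∀ k, (0 : ℝ) < N k := fun k => by exact_mod_cast hN k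
  have hMpos : (0 : ℝ) < M := by exact_mod_cast (by omega : 0 < M)
  have hh : ∀ k, 0 < h k := fun k => div_pos (hX k) (hNpos k)
  have hNh : ∀ k, N k * h k = P.X k := fun k => mul_div_cancel₀ _ (hNpos k).ne'
  have hτ : 0 < τ := div_pos hT hMpos
  have hMτ : M * τ = P.T := mul_div_cancel₀ _ hMpos.ne'
  have hbox : ∀ i : Node N, point h i ∈ closedBox P.X := point_mem_closedBox hh hNh
  have hρ0 : ∀ i : Node N, 0 < P.ρ (point h i) := fun i => hρmin.trans_le (hρ _ (hbox i)).1
  have hρne : ∀ i : Node N, P.ρ (point h i) ≠ 0 := fun i => (hρ0 i).ne'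
  have hρmax : 0 ≤ ρmax := by
    have h0 : (fun _ => 0 : Fin n → ℝ) ∈ closedBox P.X := fun k => ⟨le_rfl, (hX k).le⟩
    linarith [(hρ _ h0).1, (hρ _ h0).2]
  have hlev : ∀ m : ℕ, m ≤ M → m * τ ∈ Icc 0 P.T := fun m hm => by
    refine ⟨by positivity, ?_⟩
    rw [← hMτ]
    exact mul_le_mul_of_nonneg_right (by exact_mod_cast hm) hτ.le
  have hf : P.IsSource U := hu.isSource hX hT
  have hUs : ContDiffOn ℝ ∞ U (cylinder P.X P.T) := hu.smooth
  have hB0 := hB.nonneg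
  set S := ∑ k, P.a k ^ 2 with hS
  have hS0 : 0 ≤ S := Finset.sum_nonneg fun k _ => sq_nonneg _
  set H := ∑ k, h k ^ 2 + τ ^ 2 with hH
  have hHs : P.stepNorm N M ^ 4 = H ^ 2 := by
    have : P.stepNorm N M ^ 2 = H := Real.sq_sqrt (by positivity)
    rw [← this]; ring
  have hτH : τ ^ 2 ≤ H := by
    have : 0 ≤ ∑ k, h k ^ 2 := Finset.sum_nonneg fun k _ => sq_nonneg _
    linarith
  have hηH : ∀ k, h k ^ 2 ≤ H := fun k => by
    have : h k ^ 2 ≤ ∑ k, h k ^ 2 :=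
      Finset.single_le_sum (f := fun k => h k ^ 2) (fun k _ => sq_nonneg _) (Finset.mem_univ k)
    linarith [sq_nonneg τ]
  -- One constant for all residuals: 3B for `φ`, (3ρmax + S)B for `ψ` at positive levels and (3ρmax
  -- + (3 + T)S)B for `ψ 0`.
  set Q := (3 + 3 * ρmax + (3 + P.T) * S) * B with hQ
  have hTS : 0 ≤ P.T * S := mul_nonneg hT.le hS0
  have hQB : 3 * B ≤ Q := by nlinarith
  have hQ0 : 0 ≤ Q := by linarith
  have hQ1 : (3 * ρmax + S) * B * H ^ 2 ≤ Q * H ^ 2 :=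
    mul_le_mul_of_nonneg_right (by nlinarith) (sq_nonneg H)
  have hQ2 : (3 * ρmax + (3 + P.T) * S) * B * H ^ 2 ≤ Q * H ^ 2 :=
    mul_le_mul_of_nonneg_right (by nlinarith) (sq_nonneg H)
  -- the errors
  set w : ℕ → MeshFun N := onLevels h τ u with hw
  have hwU : ∀ l j, w l j = U (point h j, l * τ) := fun l j => rfl
  have hrw : ∀ l, r l = w l - v l := fun l => by rw [hr]; rfl
  have hr0 : r 0 = 0 := by
    rw [hrw, hv0]; funext i
    simp [hw, onLevels, onMesh]
  have hrb : ∀ l, l ≤ M → ∀ i, ¬ Interior i → r l i = 0 := by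
    intro l hl i hi
    rcases Nat.eq_zero_or_pos l with rfl | h1
    · rw [hr0]; rfl
    · rw [hrw, Pi.sub_apply, hv.boundary l h1 hl i hi,
        ← hu.boundary _ ⟨hbox i, point_notMem_openBox hNh hi⟩ _ (hlev l hl)]
      exact sub_self _
  -- The cutoff changes nothing on the levels where the boundary values are prescribed; beyond level
  -- M the scheme says nothing about v.
  set rr : ℕ → Hh N := fun l => cutoff N (r l) with hrr
  have hrrc : ∀ l, l ≤ M → (rr l : MeshFun N) = r l := fun l hl => cutoff_eq (hrb l hl)
  set e : ℕ → Fin n → Hh N := fun l k => cutoff N (P.dxxMesh N M U l k - vv l k) with he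
  have hec : ∀ l, l < M → ∀ k, (e l k : MeshFun N) = P.dxxMesh N M U l k - vv l k :=
    fun l hl k => cutoff_eq fun i hi => by
      rw [Pi.sub_apply, hv.vv_boundary hu hX hT ha hh hNh hl (hlev l hl.le) k hi, sub_self]
  have hesum : ∀ l, l < M → ((∑ k, P.a k ^ 2 • e l k : Hh N) : MeshFun N)
      = ∑ k, P.a k ^ 2 • P.dxxMesh N M U l k - ∑ k, P.a k ^ 2 • vv l k := by
    intro l hl
    rw [Submodule.coe_sum, ← Finset.sum_sub_distrib]
    refine Finset.sum_congr rfl fun k _ => ?_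
    rw [Submodule.coe_smul, hec l hl, smul_sub]
  set φ : ℕ → Fin n → Hh N := fun l k => cutoff N fun i =>
    resX (h k) k U (dx P.X P.T k (dx P.X P.T k U)) (point h i) (l * τ) with hφ
  -- Slot 0 carries the residual of the starting equation.
  set ψ : ℕ → Hh N := fun l => cutoff N fun i =>
    if l = 0 then P.psiStart h τ U (P.fd0 M rule i) (point h i)
    else P.psiAt h τ U (point h i) (l * τ) with hψ
  have hφi : ∀ l k i, Interior i → (φ l k : MeshFun N) i
      = resX (h k) k U (dx P.X P.T k (dx P.X P.T k U)) (point h i) (l * τ) :=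
    fun l k i hi => cutoff_apply_of_interior _ hi
  have hψi : ∀ l i, Interior i → (ψ (l + 1) : MeshFun N) i
      = P.psiAt h τ U (point h i) ((l + 1 : ℕ) * τ) :=
    fun l i hi => by rw [hψ]; simp only; rw [cutoff_apply_of_interior _ hi, if_neg (by omega)]
  have hψ0 : ∀ i, Interior i → (ψ 0 : MeshFun N) i
      = P.psiStart h τ U (P.fd0 M rule i) (point h i) :=
    fun i hi => by rw [hψ]; simp only; rw [cutoff_apply_of_interior _ hi]; exact if_pos trivial
  set R : Hh N →ₗ[ℝ] Hh N := mulHh (onMesh h P.ρ) with hR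
  set Rinv : Hh N →ₗ[ℝ] Hh N := mulHh (onMesh h P.ρ)⁻¹ with hRinv
  have hRi : ∀ q : Hh N, ∀ i, (R q : MeshFun N) i = P.ρ (point h i) * (q : MeshFun N) i :=
    fun q i => rfl
  have hprod : 0 ≤ ∏ k, h k := Finset.prod_nonneg fun k _ => (hh k).le
  -- the hypotheses of the stability theorem
  have hstabil := stability_vector_bilinForm (ipForm h) (fun v w => ip_comm _ _)
    (fun v => ip_self_nonneg hh _) (fun v hv => eq_zero_of_ip_self hh hv)
    (A := fun k => negLam h k) (σ := fun k => numerovEquiv k) (a := P.a)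
    (κ := fun k => h k ^ 2 / 12) (R := R) (Rinv := Rinv) (α := ρmin) (β := ρmax)
    (c := P.a k₀ ^ 2 / (4 * P.X k₀ ^ 2)) (T := P.T) (τ := τ)
    (δ := √(∏ k, (2 * P.X k)) * (Q * H ^ 2)) (ε₀ := ε₀) (M := M) (r := rr) (ψ := ψ) (φ := φ)
    (e := e) (fun k => by positivity) (fun k v w => ip_negLam_comm k v w)
    (fun k w => ip_negLam_self_nonneg hh k w) (fun k w => ip_negLam_self_le hh k w)
    (fun k l w => negLam_comm h k l w) (fun k w => numerovEquiv_apply (hh k).ne' w)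
    (fun p q => by
      rw [ipForm_apply, ipForm_apply]
      simp only [ip, hRi]
      congr 1
      exact Finset.sum_congr rfl fun i _ => by ring)
    hρmin
    (fun p => by
      rw [ipForm_apply, ipForm_apply]
      simp only [ip, hRi]
      rw [mul_left_comm]
      refine mul_le_mul_of_nonneg_left ?_ hprod
      rw [Finset.mul_sum]
      refine Finset.sum_le_sum fun i _ => ?_
      rw [mul_assoc]
      exact mul_le_mul_of_nonneg_right (hρ _ (hbox i)).1 (mul_self_nonneg _))
    hρmax
    (fun p => by
      rw [ipForm_apply, ipForm_apply, ← Real.sqrt_sq hρmax, ← Real.sqrt_mul (sq_nonneg _)]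
      apply Real.sqrt_le_sqrt
      rw [ip_self, ip_self, mul_left_comm]
      refine mul_le_mul_of_nonneg_left ?_ hprod
      rw [Finset.mul_sum]
      refine Finset.sum_le_sum fun i _ => ?_
      rw [hRi, mul_pow]
      exact mul_le_mul_of_nonneg_right
        (pow_le_pow_left₀ (hρ0 i).le (hρ _ (hbox i)).2 2) (sq_nonneg _))
    (fun p => by
      apply Hh_ext
      intro i _
      rw [hRi, hRinv, mulHh_apply, Pi.inv_apply]
      exact mul_inv_cancel_left₀ (hρne i) _)
    (by have := hX k₀; have := ha k₀; positivity)
    -- Coercivity from the Poincaré inequality in the single direction `k₀`; the other directions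
    -- only add nonnegative terms.
    (fun p => by
      have h1 := ip_self_le_ip_negLam hh k₀ p
      rw [hNh] at h1
      have h2 : P.a k₀ ^ 2 * ipForm h (negLam h k₀ p) p
          ≤ ∑ k, P.a k ^ 2 * ipForm h (negLam h k p) p :=
        Finset.single_le_sum (f := fun k => P.a k ^ 2 * ipForm h (negLam h k p) p)
          (fun k _ => mul_nonneg (sq_nonneg _) (ip_negLam_self_nonneg hh k p))
          (Finset.mem_univ k₀)
      refine le_trans ?_ h2
      rw [ipForm_apply, ipForm_apply, div_mul_eq_mul_div, div_le_iff₀ (by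
        have := hX k₀; positivity)]
      nlinarith [mul_le_mul_of_nonneg_left h1 (sq_nonneg (P.a k₀))])
    hτ hε hε1
    (fun p => by
      have h1 := hstab p
      rw [Eh_apply] at h1
      exact h1)
    hM hMτ.le (by rw [hrr]; simp only; rw [hr0, map_zero])
    (fun l hl k => by
      apply Hh_ext
      intro i hi
      have e1 : (numerovEquiv k (e l k) : MeshFun N) i = numerov k (e l k : MeshFun N) i :=
        inHh_apply_of_interior _ _ hi
      have e2 : ((-negLam h k (rr l) + φ l k : Hh N) : MeshFun N) i
          = lam h k (rr l : MeshFun N) i + (φ l k : MeshFun N) i := by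
        rw [negLam, LinearMap.neg_apply, neg_neg, Submodule.coe_add, Pi.add_apply,
          inHh_apply_of_interior _ _ hi]
      have e3 := numerov_sub_lam_eq_resX (h := h) (F := U)
        (G := dx P.X P.T k (dx P.X P.T k U)) (w := w l) (z := P.dxxMesh N M U l k) (t := l * τ)
        (hwU l) (fun j => rfl) hi k
      rw [e1, e2, hφi l k i hi, hec l hl, hrrc l hl.le, hrw, map_sub, map_sub, Pi.sub_apply,
        Pi.sub_apply, hv.aux_all hl k hi, ← e3]
      ring)
    (fun l hl => by
      apply Hh_ext
      intro i hi
      have e1 := residual_main hf hbox hρne hτ (m := l) (by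
        have := (hlev (l + 1 + 1) (by omega)).2
        push_cast at this
        exact this) hi hwU
      have e2 := hv.main (l + 1) (by omega) (by omega) i hi
      have e3 := P.rhoOp_apply_Hh (M := M) (∑ k, P.a k ^ 2 • e (l + 1) k) hi
      rw [hesum (l + 1) hl, P.rhoOp_sub, Pi.sub_apply] at e3
      rw [Submodule.coe_add, Pi.add_apply, hψi l i hi, ← e3, Submodule.coe_smul, Pi.smul_apply, hRi]
      have e4 : ((rr (l + 2) - (2 : ℝ) • rr (l + 1) + rr l : Hh N) : MeshFun N) i
          = (w (l + 1 + 1) i - v (l + 1 + 1) i) - 2 * (w (l + 1) i - v (l + 1) i)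
            + (w l i - v l i) := by
        rw [Submodule.coe_add, Submodule.coe_sub, Submodule.coe_smul, hrrc _ (by omega),
          hrrc _ (by omega), hrrc _ (by omega), hrw, hrw, hrw]
        rfl
      rw [e4, smul_eq_mul]
      push_cast
      simp only [lamT, Nat.add_sub_cancel] at e1 e2
      linear_combination e1 - e2)
    (by
      apply Hh_ext
      intro i hi
      have e1 := residual_start hf hbox hρne hT (fun x hx => hu.u₁_eq hX hT hx) rule hi hwU
      have e2 := hv.start i hi
      have e3 := P.rhoOp_apply_Hh (M := M) (∑ k, P.a k ^ 2 • e 0 k) hi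
      rw [hesum 0 (by omega), P.rhoOp_sub, Pi.sub_apply] at e3
      rw [Submodule.coe_add, Pi.add_apply, hψ0 i hi, Submodule.coe_smul, Pi.smul_apply, hRi,
        Submodule.coe_smul, Pi.smul_apply, ← e3, hrrc 1 (by omega), hrw]
      have e4 : w 0 i = v 0 i := by
        have := congrFun hr0 i
        rw [hrw] at this
        exact sub_eq_zero.mp this
      simp only [dT, zero_add, e4] at e1 e2
      rw [Pi.sub_apply, smul_eq_mul, smul_eq_mul]
      linear_combination e1 - e2)
    (by positivity)
    (fun l hl k => sqrt_ipForm_cutoff_le hh hN hNh (by positivity) fun i hi => by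
      rw [hφi l k i hi]
      exact (abs_resX_le hX hT hUs (hB.dx6 k) (hbox i) (hh k) (point_sub_nonneg hh hi k)
        (point_add_le hh hNh hi k) (hlev l hl.le)).trans
        (residual_le_of_sq_le hB0 (hηH k) hQB))
    (fun l hl k => by
      refine (sqrt_ipForm_cutoff_le hh hN hNh (c := τ * (Q * H ^ 2)) (by positivity)
        fun i hi => ?_).trans (le_of_eq (by ring))
      have e1 := hlev (l + 1) hl.le
      have e2 : ((l + 1 : ℕ) : ℝ) * τ = l * τ + τ := by push_cast; ring
      rw [Submodule.coe_sub, Pi.sub_apply, hφi _ k i hi, hφi _ k i hi, e2]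
      rw [e2] at e1
      refine (abs_resX_diff_le hX hT hUs (hB.dt_dx6 k) (hbox i) (hh k) (point_sub_nonneg hh hi k)
        (point_add_le hh hNh hi k) hτ (hlev l (by omega)) e1).trans ?_
      have e3 := mul_le_mul_of_nonneg_left (residual_le_of_sq_le hB0 (hηH k) hQB) hτ.le
      linarith)
    (fun l hl => sqrt_ipForm_cutoff_le hh hN hNh (by positivity) fun i hi => by
      rcases Nat.eq_zero_or_pos l with rfl | h1
      · rw [hψ0 i hi]
        refine (abs_psiStart_le hX hT hUs hB hf (hρ0 i).le (hρ _ (hbox i)).2 (hbox i) hh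
          (point_sub_nonneg hh hi) (point_add_le hh hNh hi) hτ hτH hηH
          (by have := (hlev 2 hM).2; exact_mod_cast this) ?_).trans hQ2
        cases rule
        · left; rfl
        · right; rfl
      · obtain ⟨q, rfl⟩ : ∃ q, l = q + 1 := ⟨l - 1, by omega⟩
        have e2 : ((q + 1 : ℕ) : ℝ) * τ = q * τ + τ := by push_cast; ring
        have e3 := (hlev (q + 1 + 1) hl).2
        have e4 : ((q + 1 + 1 : ℕ) : ℝ) * τ = q * τ + τ + τ := by push_cast; ring
        have e5 := (hlev q (by omega)).1
        rw [hψi q i hi, e2]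
        exact (abs_psiAt_le hX hT hUs hB (hρ0 i).le (hρ _ (hbox i)).2 (hbox i) hh
          (point_sub_nonneg hh hi) (point_add_le hh hNh hi) hτ hτH hηH
          (by linarith) (by linarith)).trans hQ1)
    (fun l h1 hl => by
      refine (sqrt_ipForm_cutoff_le hh hN hNh (c := τ * (Q * H ^ 2)) (by positivity)
        fun i hi => ?_).trans (le_of_eq (by ring))
      obtain ⟨q, rfl⟩ : ∃ q, l = q + 1 := ⟨l - 1, by omega⟩
      have e2 : ((q + 1 : ℕ) : ℝ) * τ = q * τ + τ := by push_cast; ring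
      have e3 := (hlev (q + 1 + 1 + 1) hl).2
      have e4 : ((q + 1 + 1 : ℕ) : ℝ) * τ = q * τ + τ + τ := by push_cast; ring
      have e6 : ((q + 1 + 1 + 1 : ℕ) : ℝ) * τ = q * τ + τ + τ + τ := by push_cast; ring
      have e5 := (hlev q (by omega)).1
      rw [Submodule.coe_sub, Pi.sub_apply, hψi _ i hi, hψi _ i hi, e2, e4]
      exact (abs_psiAt_diff_le hX hT hUs hB (hρ0 i).le (hρ _ (hbox i)).2 (hbox i) hh
        (point_sub_nonneg hh hi) (point_add_le hh hNh hi) hτ hτH hηH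
        (by linarith) (by linarith)).trans (mul_le_mul_of_nonneg_left hQ1 hτ.le))
    hm1 hm
  -- the norms of the error
  have n1 : normh h (dBarT τ r m) = √(ipForm h ((1 / τ) • (rr m - rr (m - 1)))
      ((1 / τ) • (rr m - rr (m - 1)))) := by
    have e1 : ∀ i, Interior i → dBarT τ r m i
        = (((1 / τ) • (rr m - rr (m - 1)) : Hh N) : MeshFun N) i := fun i _ => by
      rw [Submodule.coe_smul, Submodule.coe_sub, hrrc m hm, hrrc (m - 1) (by omega)]
      simp only [dBarT, Pi.smul_apply, Pi.sub_apply, smul_eq_mul]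
      ring
    rw [normh, ipForm_apply, ip_congr e1 e1]
  have n2 : normH1 P.a h (r m) = √(∑ k, P.a k ^ 2 * ipForm h (negLam h k (rr m)) (rr m)) := by
    have e1 : ∀ i, Interior i → (-Lh P.a h (r m)) i
        = ((∑ k, P.a k ^ 2 • negLam h k (rr m) : Hh N) : MeshFun N) i := fun i hi => by
      rw [Pi.neg_apply, ← hrrc m hm, Lh_apply_Hh _ _ hi, neg_neg]
    have e2 : ∑ k, P.a k ^ 2 * ipForm h (negLam h k (rr m)) (rr m)
        = ipForm h (∑ k, P.a k ^ 2 • negLam h k (rr m)) (rr m) := by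
      simp [LinearMap.sum_apply]
    have e3 : ∀ i, Interior i → r m i = (rr m : MeshFun N) i := fun i _ => by rw [hrrc m hm]
    rw [normH1, e2, ipForm_apply, ip_congr e1 e3]
  have n3 : normh h (sumT τ (fun l => Lh P.a h (r l)) m)
      = √(ipForm h (τ • ∑ l ∈ Finset.Icc 1 m, ∑ k, P.a k ^ 2 • negLam h k (rr l))
          (τ • ∑ l ∈ Finset.Icc 1 m, ∑ k, P.a k ^ 2 • negLam h k (rr l))) := by
    -- The operator bound concerns -L_h; the sign is invisible to the norm.
    have e1 : ∀ i, Interior i → (-sumT τ (fun l => Lh P.a h (r l)) m : MeshFun N) i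
        = ((τ • ∑ l ∈ Finset.Icc 1 m, ∑ k, P.a k ^ 2 • negLam h k (rr l) : Hh N) : MeshFun N) i := by
      intro i hi
      rw [Submodule.coe_smul, Pi.smul_apply, Submodule.coe_sum, Finset.sum_apply, Pi.neg_apply,
        smul_eq_mul, sumT, ← mul_neg, ← Finset.sum_neg_distrib]
      congr 1
      refine Finset.sum_congr rfl fun l hl => ?_
      rw [← hrrc l ((Finset.mem_Icc.mp hl).2.trans hm), Lh_apply_Hh _ _ hi, neg_neg]
    rw [ipForm_apply, ← ip_congr e1 e1, normh]
    congr 1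
    simp [ip]
  rw [n1, n2, n3, hHs]
  exact hstabil

end Error

end WaveScheme

end

/-- The error bound holds with the factor ε₀ alone, and √ε ≤ 1 only decreases the left-hand side. As
n ≥ 1, direction 0 serves for the Poincaré inequality. -/
theorem theorem2 {n : ℕ} (hn : 1 ≤ n) (P : WaveScheme.WaveData n)
    (hX : ∀ k, 0 < P.X k) (hT : 0 < P.T) (ha : ∀ k, 0 < P.a k)
    (hρ_smooth : ContDiffOn ℝ ∞ P.ρ (WaveScheme.closedBox P.X))
    (ρmin ρmax : ℝ) (hρmin : 0 < ρmin)
    (hρ : ∀ x ∈ WaveScheme.closedBox P.X, ρmin ≤ P.ρ x ∧ P.ρ x ≤ ρmax)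
    (u : (Fin n → ℝ) → ℝ → ℝ) (hu : WaveScheme.IsSmoothSolution P u) :
    ∃ C : ℝ, ∀ (N : Fin n → ℕ) (M : ℕ), (∀ k, 1 ≤ N k) → 2 ≤ M →
      ∀ (rule : WaveScheme.StartRule) (ε ε₀ : ℝ), 0 < ε → ε < 1 → 0 < ε₀ → ε₀ < 1 →
      WaveScheme.StabCond1 P ρmin N M ε → WaveScheme.StabCond2 P ρmin N M ε₀ →
      ∀ (v : ℕ → WaveScheme.MeshFun N) (vv : ℕ → Fin n → WaveScheme.MeshFun N),
      WaveScheme.IsSchemeSolution P N M rule v vv →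
      v 0 = WaveScheme.onMesh (P.h N) (fun x => u x 0) →
      ∀ r : ℕ → WaveScheme.MeshFun N,
      r = WaveScheme.onLevels (P.h N) (P.ht M) u - v →
      ∀ m : ℕ, 1 ≤ m → m ≤ M →
        √ε * ε₀ * (WaveScheme.normh (P.h N) (WaveScheme.dBarT (P.ht M) r m)
            + WaveScheme.normH1 P.a (P.h N) (r m)
            + √ε * WaveScheme.normh (P.h N)
                (WaveScheme.sumT (P.ht M) (fun l => WaveScheme.Lh P.a (P.h N) (r l)) m))
          ≤ C * P.stepNorm N M ^ 4 := by
  obtain ⟨B, hB⟩ := WaveScheme.exists_derivBound hX hT hu.smooth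
  refine ⟨WaveScheme.stabConst ρmin ρmax (P.a ⟨0, hn⟩ ^ 2 / (4 * P.X ⟨0, hn⟩ ^ 2)) P.T
    (∑ k, P.a k ^ 2) * (√(∏ k, (2 * P.X k))
      * ((3 + 3 * ρmax + (3 + P.T) * ∑ k, P.a k ^ 2) * B)), ?_⟩
  intro N M hN hM rule ε ε₀ hε hε1 hε₀ hε₀1 _ hstab v vv hv hv0 r hr m hm1 hm
  have h := hv.error_bound ⟨0, hn⟩ hX hT ha hρmin hρ hu hB hN hM hε₀ hε₀1 hstab hv0 hr hm1 hm
  have hs : √ε ≤ 1 := Real.sqrt_le_one.mpr hε1.le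
  have hs0 : 0 ≤ √ε := Real.sqrt_nonneg _
  have h1 : 0 ≤ WaveScheme.normh (P.h N) (WaveScheme.dBarT (P.ht M) r m) := Real.sqrt_nonneg _
  have h2 : 0 ≤ WaveScheme.normH1 P.a (P.h N) (r m) := Real.sqrt_nonneg _
  have h3 : 0 ≤ WaveScheme.normh (P.h N)
    (WaveScheme.sumT (P.ht M) (fun l => WaveScheme.Lh P.a (P.h N) (r l)) m) := Real.sqrt_nonneg _
  have h4 : √ε * ε₀ ≤ ε₀ := mul_le_of_le_one_left hε₀.le hs
  refine (mul_le_mul h4 (add_le_add_right (mul_le_of_le_one_left h3 hs) _)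
    (by positivity) hε₀.le).trans (h.trans (le_of_eq (by ring)))
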